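/- Let $N\ge 1$, let $\omega\in\mathbb{C}$ be a primitive $N$-th root of unity, and write $\mathbb{Z}_N=\mathbb{Z}/N\mathbb{Z}$. A coaction $\rho$ of $C(\mathbb{Z}_N)$ on a unital C*-algebra $X$ is written as a family $(\rho_t)_{t\in\mathbb{Z}_N}$, using $X\otimes C(\mathbb{Z}_N)=C(\mathbb{Z}_N,X)$; an element $x$ is homogeneous of degree $d$ if $\rho_t(x)=\omega^{td}x$ for all $t$. The algebra $C(\mathbb{Z}_N)$, with generator $z(t)=\omega^t$, coacts on itself by its comultiplication, so that $z$ has degree $1$. Braided tensor products. Represent $(X,\rho^X)$ and $(Y,\rho^Y)$ faithfully and $\mathbb{Z}_N$-equivariantly on Hilbert spaces $L^X$, $L^Y$ carrying unitary representations of $\mathbb{Z}_N$. Let $c: L^X\otimes L^Y\to L^Y\otimes L^X$ be the unitary with $c(\xi\otimes\eta)=\omega^{pq}\,\eta\otimes\xi$ for $\xi,\eta$ of degrees $p,q$. Then $X\boxtimes Y\subset B(L^X\otimes L^Y)$ is the C*-algebra generated by $j_1(x)=x\otimes 1$ and $j_2(y)=c^{-1}(y\otimes 1)c$, $x\in X$,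 $y\in Y$. The representation of $\mathbb{Z}_N$ on $L^X\otimes L^Y$ is the diagonal one. The embeddings into an iterated product are $j_1,j_2,j_3$, and $\otimes$ between C*-algebras is the minimal (spatial) tensor product. The anyonic free unitary quantum group $U_N^+(R)$. The algebra $C(U_N^+(R))$ is the universal unital C*-algebra with generators $u_{ij}$, $i,j\in\mathbb{Z}_N$, subject to the relations that the matrices $u=(u_{ij})$ and $\overline{u}_R=(\omega^{-i(j-i)}u_{ij}^*)$ are unitary. Its coaction is $\rho_t(u_{ij})=\omega^{t(j-i)}u_{ij}$, and its comultiplication is the unique $\mathbb{Z}_N$-equivariant unital $*$-homomorphism $\Delta: C(U_N^+(R))\to C(U_N^+(R))\boxtimes C(U_N^+(R))$ with $\Delta(u_{ij})=\sum_k j_1(u_{ik})\,j_2(u_{kj})$. The bosonization $U_N^+(R)\rtimes\mathbb{Z}_N$ consists of the C*-algebra $C(\mathbb{Z}_N)\boxtimes C(U_N^+(R))$ with the comultiplication $\Delta_{\rtimes}=\psi\circ(\mathrm{id}\boxtimes\Delta)$. Here $\mathrm{id}\boxtimes\Delta$ is the unital $*$-homomorphism $C(\mathbb{Z}_N)\boxtimes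 C(U_N^+(R))\to C(\mathbb{Z}_N)\boxtimes C(U_N^+(R))\boxtimes C(U_N^+(R))$ that sends $j_1(f)j_2(x)$ to $j_1(f)\,j_2(\Delta(x))$, the second factor of the target being $C(U_N^+(R))\boxtimes C(U_N^+(R))$. The map $$\psi: C(\mathbb{Z}_N)\boxtimes C(U_N^+(R))\boxtimes C(U_N^+(R))\to \bigl(C(\mathbb{Z}_N)\boxtimes C(U_N^+(R))\bigr)\otimes\bigl(C(\mathbb{Z}_N)\boxtimes C(U_N^+(R))\bigr)$$ is the unital $*$-homomorphism with $\psi(j_1(f))=(j_1\otimes j_1)\Delta_{\mathbb{Z}_N}(f)$, $\psi(j_2(x))=(j_2\otimes j_1)(\rho(x))$ and $\psi(j_3(x))=1\otimes j_2(x)$. Theorem. For every choice of faithful equivariant representations of $C(\mathbb{Z}_N)$ and $C(U_N^+(R))$, the following hold. (a) The C*-algebra $C(U_N^+(R)\rtimes\mathbb{Z}_N)=C(\mathbb{Z}_N)\boxtimes C(U_N^+(R))$, with the elements $z:=j_1(z)$ and $u_{ij}:=j_2(u_{ij})$, is the universal unital C*-algebra generated by elements $z$ and $u_{ij}$, $i,j\in\mathbb{Z}_N$,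 subject to (1) $zz^*=z^*z=1=z^N$; (2) $zu_{ij}=\omega^{j-i}u_{ij}z$ for all $i,j$; (3) $u=(u_{ij})$ and $\overline{u}_R=(\omega^{-i(j-i)}u_{ij}^*)$ are unitary. (b) The homomorphisms $\Delta$ and $\Delta_{\rtimes}$ described above exist and are unique, and $$\Delta_{\rtimes}(z)=z\otimes z,\qquad \Delta_{\rtimes}(u_{ij})=\sum_{k\in\mathbb{Z}_N}u_{ik}\otimes z^{k-i}u_{kj}\qquad(i,j\in\mathbb{Z}_N).$$ -/

import Mathlib

open scoped TensorProduct

noncomputable section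

namespace Anyonic

/-! ### The free unital complex star-algebra on a set of generators -/

/-- The underlying algebra of the free unital `*`-algebra on `G`: noncommutative polynomials in
the letters `inl g` (standing for `g`) and `inr g` (standing for the adjoint of `g`). -/
def FreeStar (G : Type) : Type := FreeAlgebra ℂ (G ⊕ G)

namespace FreeStar

variable {G : Type}

instance : Ring (FreeStar G) := inferInstanceAs (Ring (FreeAlgebra ℂ (G ⊕ G)))
instance : Algebra ℂ (FreeStar G) := inferInstanceAs (Algebra ℂ (FreeAlgebra ℂ (G ⊕ G)))

/-- The letters. -/
def letter (x : G ⊕ G) : FreeStar G := FreeAlgebra.ι ℂ x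

/-- The generator attached to `g`. -/
def gen (g : G) : FreeStar G := letter (Sum.inl g)

/-- Evaluation of noncommutative polynomials. -/
def liftAlg {A : Type*} [Ring A] [Algebra ℂ A] (f : G ⊕ G → A) : FreeStar G →ₐ[ℂ] A :=
  FreeAlgebra.lift ℂ f

theorem liftAlg_letter {A : Type*} [Ring A] [Algebra ℂ A] (f : G ⊕ G → A) (x : G ⊕ G) :
    liftAlg f (letter x) = f x :=
  FreeAlgebra.lift_ι_apply f x

theorem induction {p : FreeStar G → Prop} (hc : ∀ c : ℂ, p (algebraMap ℂ _ c))
    (hl : ∀ x, p (letter x)) (hm : ∀ a b, p a → p b → p (a * b))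
    (ha : ∀ a b, p a → p b → p (a + b)) (a : FreeStar G) : p a :=
  FreeAlgebra.induction ℂ (G ⊕ G) hc hl hm ha a

/-- The opposite algebra with conjugated scalars: an algebra homomorphism into it is a
conjugate-linear antimultiplicative map. -/
def ConjOp (G : Type) : Type := (FreeStar G)ᵐᵒᵖ

instance : Ring (ConjOp G) := inferInstanceAs (Ring (FreeStar G)ᵐᵒᵖ)

instance : Algebra ℂ (ConjOp G) :=
  RingHom.toAlgebra' (S := ConjOp G)
    ((algebraMap ℂ (FreeStar G)ᵐᵒᵖ).comp (starRingEnd ℂ))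
    (fun c x => Algebra.commutes (A := (FreeStar G)ᵐᵒᵖ) (starRingEnd ℂ c) x)

/-- The adjoint of a letter. -/
def adjLetter (x : G ⊕ G) : ConjOp G := MulOpposite.op (letter x.swap)

/-- The involution, as a homomorphism: it exchanges the letters `inl g` and `inr g`. -/
def starHom : FreeStar G →ₐ[ℂ] ConjOp G := liftAlg adjLetter

instance : Star (FreeStar G) := ⟨fun a => MulOpposite.unop (starHom a)⟩

theorem star_def (a : FreeStar G) : star a = MulOpposite.unop (starHom a) := rfl

theorem star_letter (x : G ⊕ G) : star (letter x) = letter x.swap := by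
  rw [star_def, starHom, liftAlg_letter]
  rfl

theorem star_algebraMap (c : ℂ) :
    star (algebraMap ℂ (FreeStar G) c) = algebraMap ℂ (FreeStar G) (starRingEnd ℂ c) := by
  rw [star_def, AlgHom.commutes]
  rfl

theorem star_add' (a b : FreeStar G) : star (a + b) = star a + star b := by
  rw [star_def, map_add]
  rfl

theorem star_mul' (a b : FreeStar G) : star (a * b) = star b * star a := by
  rw [star_def, map_mul]
  rfl

instance : StarRing (FreeStar G) where
  star_involutive a := by
    induction a using induction with
    | hc c => rw [star_algebraMap, star_algebraMap, Complex.conj_conj]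
    | hl x => rw [star_letter, star_letter, Sum.swap_swap]
    | hm a b ha hb => rw [star_mul', star_mul', ha, hb]
    | ha a b ha hb => rw [star_add', star_add', ha, hb]
  star_mul := star_mul'
  star_add := star_add'

instance : StarModule ℂ (FreeStar G) where
  star_smul c a := by
    rw [Algebra.smul_def, star_mul, star_algebraMap, Algebra.smul_def, Algebra.commutes]
    rfl

/-- The universal property of the free unital `*`-algebra. -/
def eval {A : Type*} [Ring A] [StarRing A] [Algebra ℂ A] [StarModule ℂ A] (d : G → A) :
    FreeStar G →⋆ₐ[ℂ] A :=
  { liftAlg (Sum.elim d fun g => star (d g)) with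
    map_star' := fun a => by
      change liftAlg _ _ = star (liftAlg _ _)
      induction a using induction with
      | hc c => rw [star_algebraMap, AlgHom.commutes, AlgHom.commutes, ← algebraMap_star_comm]; rfl
      | hl x => rw [star_letter, liftAlg_letter, liftAlg_letter]; cases x <;> simp
      | hm a b ha hb => rw [star_mul', map_mul, ha, hb, map_mul, star_mul]
      | ha a b ha hb => rw [star_add', map_add, ha, hb, map_add, star_add] }

theorem eval_gen {A : Type*} [Ring A] [StarRing A] [Algebra ℂ A] [StarModule ℂ A] (d : G → A)
    (g : G) : eval d (gen g) = d g :=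
  liftAlg_letter _ _

theorem hom_ext {A : Type*} [Ring A] [StarRing A] [Algebra ℂ A] [StarModule ℂ A]
    {f f' : FreeStar G →⋆ₐ[ℂ] A} (h : ∀ g, f (gen g) = f' (gen g)) : f = f' := by
  ext a
  induction a using induction with
  | hc c => rw [AlgHomClass.commutes, AlgHomClass.commutes]
  | hl x =>
    rcases x with g | g
    · exact h g
    · have : (letter (Sum.inr g) : FreeStar G) = star (gen g) := by
        rw [gen, star_letter]; rfl
      rw [this, map_star, map_star, h]
  | hm a b ha hb => rw [map_mul, ha, hb, map_mul]
  | ha a b ha hb => rw [map_add, ha, hb, map_add]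

end FreeStar

/-! ### C*-seminorms and their completions -/

/-- A C*-seminorm on a unital complex `*`-algebra. -/
structure CStarSeminorm (F : Type) [Ring F] [StarRing F] [Algebra ℂ F] extends Seminorm ℂ F where
  mul_le' : ∀ a b, toFun (a * b) ≤ toFun a * toFun b
  star_mul_self' : ∀ a, toFun (star a * a) = toFun a * toFun a

namespace CStarSeminorm

variable {F : Type} [Ring F] [StarRing F] [Algebra ℂ F]

instance : CoeFun (CStarSeminorm F) fun _ => F → ℝ := ⟨fun p => p.toFun⟩

theorem nonneg (p : CStarSeminorm F) (a : F) : 0 ≤ p a := apply_nonneg p.toSeminorm a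

theorem star_le (p : CStarSeminorm F) (a : F) : p (star a) = p a := by
  have key : ∀ b : F, p b ≤ p (star b) := fun b => by
    have h := p.mul_le' (star b) b
    rw [p.star_mul_self'] at h
    rcases (p.nonneg b).eq_or_lt with h0 | h0
    · rw [← h0]; exact p.nonneg _
    · exact le_of_mul_le_mul_right h h0
  refine le_antisymm ?_ (key a)
  have := key (star a)
  rwa [star_star] at this

/-- The algebra `F` with the topology of a C*-seminorm. -/
@[nolint unusedArguments]
def Pre (_ : CStarSeminorm F) : Type := F

variable (p : CStarSeminorm F)

instance : Ring p.Pre := inferInstanceAs (Ring F)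
instance : StarRing p.Pre := inferInstanceAs (StarRing F)
instance : Algebra ℂ p.Pre := inferInstanceAs (Algebra ℂ F)
instance [StarModule ℂ F] : StarModule ℂ p.Pre := inferInstanceAs (StarModule ℂ F)

/-- The seminorm, on `p.Pre`. -/
def preSeminorm : RingSeminorm p.Pre where
  toFun := p.toFun
  map_zero' := p.map_zero'
  add_le' := p.add_le'
  neg' := p.neg'
  mul_le' := p.mul_le'

instance : SeminormedRing p.Pre := p.preSeminorm.toSeminormedRing

theorem norm_pre (a : p.Pre) : ‖a‖ = p a := rfl

instance : NormedAlgebra ℂ p.Pre where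
  norm_smul_le c a := (p.smul' c a).le

instance : NormedStarGroup p.Pre where
  norm_star_le a := (p.star_le a).le

/-- The C*-algebra obtained from a C*-seminorm by separation and completion. -/
def Compl : Type := UniformSpace.Completion p.Pre

open UniformSpace

instance : NormedRing p.Compl := inferInstanceAs (NormedRing (Completion p.Pre))
instance : CompleteSpace p.Compl := inferInstanceAs (CompleteSpace (Completion p.Pre))

instance : Algebra ℂ p.Compl := inferInstanceAs (Algebra ℂ (Completion p.Pre))

instance : NormedAlgebra ℂ p.Compl where
  norm_smul_le c a := norm_smul_le (β := Completion p.Pre) c a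

/-- The canonical map into the completion. -/
def toCompl : F →ₐ[ℂ] p.Compl where
  toFun a := Completion.coe' (α := p.Pre) a
  map_one' := Completion.coe_one p.Pre
  map_mul' a b := Completion.coe_mul (α := p.Pre) a b
  map_zero' := Completion.coe_zero (α := p.Pre)
  map_add' a b := Completion.coe_add (α := p.Pre) a b
  commutes' _ := rfl

theorem norm_toCompl (a : F) : ‖p.toCompl a‖ = p a := Completion.norm_coe (E := p.Pre) a

theorem denseRange_toCompl : DenseRange p.toCompl := Completion.denseRange_coe (α := p.Pre)

theorem compl_ind {P : p.Compl → Prop} (hP : IsClosed {a | P a}) (h : ∀ a : F, P (p.toCompl a))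
    (a : p.Compl) : P a :=
  Completion.induction_on (α := p.Pre) a hP h

instance : Star p.Compl := ⟨Completion.map (star : p.Pre → p.Pre)⟩

theorem star_toCompl (a : F) : star (p.toCompl a) = p.toCompl (star a) :=
  Completion.map_coe (f := (star : p.Pre → p.Pre))
    (star_isometry (E := p.Pre)).uniformContinuous a

theorem continuous_star' : Continuous (star : p.Compl → p.Compl) :=
  Completion.continuous_map (f := (star : p.Pre → p.Pre))

instance [StarModule ℂ F] : CStarAlgebra p.Compl :=
  { (inferInstance : NormedRing p.Compl), (inferInstance : CompleteSpace p.Compl),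
    (inferInstance : NormedAlgebra ℂ p.Compl) with
    star := star
    star_involutive := fun a => by
      have hs := p.continuous_star'
      refine p.compl_ind (P := fun a => star (star a) = a)
        (isClosed_eq (hs.comp hs) continuous_id) (fun a => ?_) a
      rw [star_toCompl, star_toCompl, star_star]
    star_mul := fun a b => by
      have hs := p.continuous_star'
      refine p.compl_ind (P := fun a => star (a * b) = star b * star a)
        (isClosed_eq (hs.comp (continuous_mul_const b)) (continuous_const.mul hs)) (fun a => ?_) a
      refine p.compl_ind (P := fun b => star (p.toCompl a * b) = star b * star (p.toCompl a))
        (isClosed_eq (hs.comp (continuous_const_mul _)) (hs.mul continuous_const)) (fun b => ?_) b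
      rw [← map_mul, star_toCompl, star_toCompl, star_toCompl, star_mul, map_mul]
    star_add := fun a b => by
      have hs := p.continuous_star'
      refine p.compl_ind (P := fun a => star (a + b) = star a + star b)
        (isClosed_eq (by fun_prop) (by fun_prop)) (fun a => ?_) a
      refine p.compl_ind (P := fun b => star (p.toCompl a + b) = star (p.toCompl a) + star b)
        (isClosed_eq (by fun_prop) (by fun_prop)) (fun b => ?_) b
      rw [← map_add, star_toCompl, star_toCompl, star_toCompl, star_add, map_add]
    norm_mul_self_le := fun a => by
      have hs := p.continuous_star'
      refine p.compl_ind (P := fun a => ‖a‖ * ‖a‖ ≤ ‖star a * a‖)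
        (isClosed_le (by fun_prop) (by fun_prop)) (fun a => ?_) a
      rw [star_toCompl, ← map_mul, norm_toCompl, norm_toCompl]
      exact (p.star_mul_self' a).ge
    star_smul := fun c a => by
      have hs := p.continuous_star'
      refine p.compl_ind (P := fun a => star (c • a) = star c • star a)
        (isClosed_eq (hs.comp (continuous_const_smul c)) (hs.const_smul (star c)))
        (fun a => ?_) a
      rw [← map_smul, star_toCompl, star_toCompl, star_smul, map_smul] }

/-- The canonical `*`-homomorphism into the completion. -/
def mkStar [StarModule ℂ F] : F →⋆ₐ[ℂ] p.Compl :=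
  { p.toCompl with map_star' := fun a => (p.star_toCompl a).symm }

theorem mkStar_apply [StarModule ℂ F] (a : F) : p.mkStar a = p.toCompl a := rfl

theorem continuous_pre {A : Type*} [CStarAlgebra A] (f : F →⋆ₐ[ℂ] A) (hf : ∀ a, ‖f a‖ ≤ p a) :
    Continuous (fun a : p.Pre => f a) :=
  AddMonoidHomClass.continuous_of_bound (E := p.Pre) (f : F →+ A) 1
    (fun a => by rw [one_mul]; exact hf a)

/-- Extension of a contractive `*`-homomorphism to the completion. -/
def extend [StarModule ℂ F] {A : Type*} [CStarAlgebra A] (f : F →⋆ₐ[ℂ] A) (hf : ∀ a, ‖f a‖ ≤ p a) :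
    p.Compl →⋆ₐ[ℂ] A :=
  have hc := p.continuous_pre f hf
  let e : Completion p.Pre →+* A :=
    Completion.extensionHom (α := p.Pre) ((f : F →ₐ[ℂ] A) : F →+* A) hc
  have he : ∀ a : F, e (Completion.coe' (α := p.Pre) a) = f a := fun a =>
    Completion.extensionHom_coe (α := p.Pre) ((f : F →ₐ[ℂ] A) : F →+* A) hc a
  have hec : Continuous e := Completion.continuous_extension
  { toFun := e
    map_one' := map_one e
    map_mul' := map_mul e
    map_zero' := map_zero e
    map_add' := map_add e
    commutes' := fun c => (he (algebraMap ℂ F c)).trans (AlgHomClass.commutes f c)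
    map_star' := fun a => by
      have hs := p.continuous_star'
      refine p.compl_ind (P := fun a => e (star a : p.Compl) = star (e a))
        (isClosed_eq (hec.comp hs) (continuous_star.comp hec)) (fun a => ?_) a
      rw [star_toCompl]
      exact (he (star a)).trans ((map_star f a).trans (congrArg star (he a).symm)) }

theorem extend_toCompl [StarModule ℂ F] {A : Type*} [CStarAlgebra A] (f : F →⋆ₐ[ℂ] A) (hf : ∀ a, ‖f a‖ ≤ p a) (a : F) :
    p.extend f hf (p.toCompl a) = f a :=
  Completion.extensionHom_coe (α := p.Pre) ((f : F →ₐ[ℂ] A) : F →+* A) (p.continuous_pre f hf) a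

/-- The C*-seminorm induced by a `*`-homomorphism into a C*-algebra. -/
def ofHom {A : Type*} [CStarAlgebra A] (f : F →⋆ₐ[ℂ] A) : CStarSeminorm F where
  toFun a := ‖f a‖
  map_zero' := by simp
  add_le' a b := by rw [map_add]; exact norm_add_le _ _
  neg' a := by rw [map_neg, norm_neg]
  smul' c a := by rw [map_smul, norm_smul]
  mul_le' a b := by rw [map_mul]; exact norm_mul_le _ _
  star_mul_self' a := by rw [map_mul, map_star, CStarRing.norm_star_mul_self]

theorem ofHom_apply {A : Type*} [CStarAlgebra A] (f : F →⋆ₐ[ℂ] A) (a : F) :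
    ofHom f a = ‖f a‖ := rfl

end CStarSeminorm

/-! ### The universal unital C*-algebra on generators and relations -/

/-- A C*-seminorm on the free `*`-algebra that vanishes on the relators `R`; equivalently, a
C*-seminorm on the universal unital `*`-algebra with generators `G` and relations `R`. -/
abbrev AdmissibleSeminorm {G : Type} (R : Set (FreeStar G)) : Type :=
  {p : CStarSeminorm (FreeStar G) // ∀ r ∈ R, p r = 0}

/-- The relations bound the generators uniformly in all C*-seminorms, so that there is a largest
one. -/
def IsBoundedRel {G : Type} (R : Set (FreeStar G)) : Prop :=
  ∀ g : G, ∃ C : ℝ, ∀ p : AdmissibleSeminorm R, p.1 (FreeStar.gen g) ≤ C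

namespace Universal

variable {G : Type} {R : Set (FreeStar G)}

theorem bddAbove (hR : IsBoundedRel R) (a : FreeStar G) :
    BddAbove (Set.range fun p : AdmissibleSeminorm R => p.1 a) := by
  suffices h : ∃ C : ℝ, 0 ≤ C ∧ ∀ p : AdmissibleSeminorm R, p.1 a ≤ C by
    obtain ⟨C, -, hC⟩ := h
    exact ⟨C, by rintro _ ⟨p, rfl⟩; exact hC p⟩
  induction a using FreeStar.induction with
  | hc c =>
    refine ⟨‖c‖, norm_nonneg c, fun p => ?_⟩
    have h1 : p.1 (1 : FreeStar G) ≤ 1 := by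
      have h := p.1.star_mul_self' 1
      rw [star_one, mul_one] at h
      nlinarith [p.1.nonneg 1]
    rw [Algebra.algebraMap_eq_smul_one, p.1.smul']
    exact mul_le_of_le_one_right (norm_nonneg c) h1
  | hl x =>
    rcases x with g | g
    · obtain ⟨C, hC⟩ := hR g
      exact ⟨max C 0, le_max_right _ _, fun p => (hC p).trans (le_max_left _ _)⟩
    · obtain ⟨C, hC⟩ := hR g
      refine ⟨max C 0, le_max_right _ _, fun p => ?_⟩
      have : (FreeStar.letter (Sum.inr g) : FreeStar G) = star (FreeStar.gen g) := by
        rw [FreeStar.gen, FreeStar.star_letter]; rfl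
      rw [this, p.1.star_le]
      exact (hC p).trans (le_max_left _ _)
  | hm a b ha hb =>
    obtain ⟨C, hC0, hC⟩ := ha
    obtain ⟨D, hD0, hD⟩ := hb
    exact ⟨C * D, mul_nonneg hC0 hD0, fun p => (p.1.mul_le' a b).trans
      (mul_le_mul (hC p) (hD p) (p.1.nonneg b) hC0)⟩
  | ha a b ha hb =>
    obtain ⟨C, hC0, hC⟩ := ha
    obtain ⟨D, hD0, hD⟩ := hb
    exact ⟨C + D, add_nonneg hC0 hD0, fun p => (p.1.add_le' a b).trans (add_le_add (hC p) (hD p))⟩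

instance : Nonempty (AdmissibleSeminorm R) :=
  ⟨⟨{ toSeminorm := 0
      mul_le' := fun _ _ => by
        change (0 : ℝ) ≤ 0 * 0
        simp
      star_mul_self' := fun _ => by
        change (0 : ℝ) = 0 * 0
        simp }, fun _ _ => rfl⟩⟩

/-- The largest C*-seminorm on the `*`-algebra with generators `G` and relations `R`. -/
def maxSeminorm (hR : IsBoundedRel R) : CStarSeminorm (FreeStar G) where
  toFun a := ⨆ p : AdmissibleSeminorm R, p.1 a
  map_zero' := by
    have : ∀ p : AdmissibleSeminorm R, p.1 (0 : FreeStar G) = 0 := fun p => p.1.map_zero'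
    simp [this]
  add_le' a b := ciSup_le fun p => (p.1.add_le' a b).trans
    (add_le_add (le_ciSup (bddAbove hR a) p) (le_ciSup (bddAbove hR b) p))
  neg' a := iSup_congr fun p => p.1.neg' a
  smul' c a := by
    rw [Real.mul_iSup_of_nonneg (norm_nonneg c)]
    exact iSup_congr fun p => p.1.smul' c a
  mul_le' a b := ciSup_le fun p => (p.1.mul_le' a b).trans
    (mul_le_mul (le_ciSup (bddAbove hR a) p) (le_ciSup (bddAbove hR b) p) (p.1.nonneg b)
      (Real.iSup_nonneg fun p => p.1.nonneg a))
  star_mul_self' a := by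
    apply le_antisymm
    · refine ciSup_le fun p => ?_
      rw [p.1.star_mul_self' a]
      have h := le_ciSup (bddAbove hR a) p
      exact mul_self_le_mul_self (p.1.nonneg a) h
    · have h0 : 0 ≤ ⨆ p : AdmissibleSeminorm R, p.1 (star a * a) :=
        Real.iSup_nonneg fun p => p.1.nonneg _
      have h : (⨆ p : AdmissibleSeminorm R, p.1 a)
          ≤ √(⨆ p : AdmissibleSeminorm R, p.1 (star a * a)) := by
        refine ciSup_le fun p => Real.le_sqrt_of_sq_le ?_
        rw [pow_two, ← p.1.star_mul_self' a]
        exact le_ciSup (bddAbove hR (star a * a)) p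
      calc _ ≤ _ := mul_self_le_mul_self (Real.iSup_nonneg fun p => p.1.nonneg a) h
        _ = _ := Real.mul_self_sqrt h0

theorem le_maxSeminorm (hR : IsBoundedRel R) (p : AdmissibleSeminorm R) (a : FreeStar G) :
    p.1 a ≤ maxSeminorm hR a :=
  le_ciSup (bddAbove hR a) p

theorem maxSeminorm_rel (hR : IsBoundedRel R) {r : FreeStar G} (hr : r ∈ R) :
    maxSeminorm hR r = 0 := by
  have : ∀ p : AdmissibleSeminorm R, p.1 r = 0 := fun p => p.2 r hr
  change (⨆ p : AdmissibleSeminorm R, p.1 r) = 0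
  simp [this]

end Universal

/-- The universal unital C*-algebra with generators `G` and relations `R`: the completion of the
universal unital `*`-algebra in its largest C*-seminorm. -/
def UniversalCStar {G : Type} {R : Set (FreeStar G)} (hR : IsBoundedRel R) : Type :=
  (Universal.maxSeminorm hR).Compl

instance {G : Type} {R : Set (FreeStar G)} (hR : IsBoundedRel R) :
    CStarAlgebra (UniversalCStar hR) :=
  inferInstanceAs (CStarAlgebra (Universal.maxSeminorm hR).Compl)

namespace Universal

variable {G : Type} {R : Set (FreeStar G)} (hR : IsBoundedRel R)

/-- The canonical homomorphism. -/
def toUniversal : FreeStar G →⋆ₐ[ℂ] UniversalCStar hR := (maxSeminorm hR).mkStar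

/-- The canonical generators. -/
def gen (g : G) : UniversalCStar hR := toUniversal hR (FreeStar.gen g)

theorem toUniversal_rel {r : FreeStar G} (hr : r ∈ R) : toUniversal hR r = 0 := by
  have h : ‖toUniversal hR r‖ = 0 :=
    ((maxSeminorm hR).norm_toCompl r).trans (maxSeminorm_rel hR hr)
  exact norm_eq_zero.mp h

/-- The universal property: existence. -/
def lift {A : Type*} [CStarAlgebra A] (d : G → A) (hd : ∀ r ∈ R, FreeStar.eval d r = 0) :
    UniversalCStar hR →⋆ₐ[ℂ] A :=
  (maxSeminorm hR).extend (FreeStar.eval d) fun a =>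
    le_maxSeminorm hR ⟨CStarSeminorm.ofHom (FreeStar.eval d), fun r hr => by
      rw [CStarSeminorm.ofHom_apply, hd r hr, norm_zero]⟩ a

theorem lift_gen {A : Type*} [CStarAlgebra A] (d : G → A)
    (hd : ∀ r ∈ R, FreeStar.eval d r = 0) (g : G) : lift hR d hd (gen hR g) = d g :=
  ((maxSeminorm hR).extend_toCompl _ _ _).trans (FreeStar.eval_gen d g)

/-- The universal property: uniqueness. -/
theorem hom_ext {A : Type*} [CStarAlgebra A] {f f' : UniversalCStar hR →⋆ₐ[ℂ] A}
    (h : ∀ g, f (gen hR g) = f' (gen hR g)) : f = f' := by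
  have hF : f.comp (toUniversal hR) = f'.comp (toUniversal hR) :=
    FreeStar.hom_ext h
  have hc : ∀ e : UniversalCStar hR →⋆ₐ[ℂ] A, Continuous e := fun e =>
    AddMonoidHomClass.continuous_of_bound e 1 fun a => by
      rw [one_mul]; exact NonUnitalStarAlgHom.norm_apply_le e a
  ext a
  refine (maxSeminorm hR).compl_ind (P := fun a => f a = f' a)
    (isClosed_eq (hc f) (hc f')) (fun a => ?_) a
  exact DFunLike.congr_fun hF a

end Universal

/-! ### Roots of unity and actions of the cyclic group -/

/-- `ω ^ a` for `a` in `ℤ/N` (well defined when `ω ^ N = 1`). -/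
def rootPow {N : ℕ} (ω : ℂ) (a : ZMod N) : ℂ := ω ^ a.val

section Roots

variable {N : ℕ} [NeZero N] {ω : ℂ}

theorem rootPow_add (hω : IsPrimitiveRoot ω N) (a b : ZMod N) : rootPow ω (a + b) = rootPow ω a * rootPow ω b := by
  rw [rootPow, rootPow, rootPow, ← pow_add, ZMod.val_add, ← pow_mod_orderOf ω (a.val + b.val),
    ← hω.eq_orderOf]

theorem rootPow_mul_conj (hω : IsPrimitiveRoot ω N) (a : ZMod N) : rootPow ω a * starRingEnd ℂ (rootPow ω a) = 1 := by
  rw [Complex.mul_conj, Complex.normSq_eq_norm_sq, rootPow, norm_pow,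
    hω.norm'_eq_one (NeZero.ne N)]
  simp

theorem rootPow_neg (hω : IsPrimitiveRoot ω N) (a : ZMod N) : rootPow ω (-a) = starRingEnd ℂ (rootPow ω a) := by
  have h0 : rootPow ω a * rootPow ω (-a) = 1 := by
    rw [← rootPow_add hω, add_neg_cancel, rootPow, ZMod.val_zero, pow_zero]
  have h1 := rootPow_mul_conj hω a
  have hne : rootPow ω a ≠ 0 := left_ne_zero_of_mul_eq_one h0
  exact mul_left_cancel₀ hne (h0.trans h1.symm)

end Roots

/-- A coaction of `C(ℤ/N)` on a unital C*-algebra `X`, as a unital `*`-homomorphism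
`ρ : X → C(ℤ/N, X) = X ⊗ C(ℤ/N)`, with value `ρ x t` of `ρ x` at `t`. -/
structure CyclicCoaction (N : ℕ) [NeZero N] (X : Type*) [CStarAlgebra X] where
  /-- The homomorphism `ρ`. -/
  hom : X →⋆ₐ[ℂ] (ZMod N → X)
  /-- `(ρ ⊗ id) ρ = (id ⊗ Δ) ρ`, evaluated at `(s, t)`. -/
  coassoc : ∀ (x : X) (s t : ZMod N), hom (hom x t) s = hom x (s + t)
  /-- `ρ(X) (1 ⊗ C(ℤ/N))` spans a dense subspace of `X ⊗ C(ℤ/N)`. -/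
  podles : closure (Submodule.span ℂ {y : ZMod N → X | ∃ (x : X) (f : ZMod N → ℂ),
    y = hom x * fun t => algebraMap ℂ X (f t)} : Set (ZMod N → X)) = Set.univ

/-- A coaction from an action of the group `ℤ/N` by automorphisms. -/
def CyclicCoaction.ofAction {N : ℕ} [NeZero N] {X : Type*} [CStarAlgebra X]
    (hom : X →⋆ₐ[ℂ] (ZMod N → X)) (coassoc : ∀ (x : X) (s t : ZMod N), hom (hom x t) s = hom x (s + t))
    (zero : ∀ x, hom x 0 = x) : CyclicCoaction N X where
  hom := hom
  coassoc := coassoc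
  podles := by
    refine Set.eq_univ_of_forall fun h => subset_closure ?_
    have : h = ∑ t : ZMod N, hom (hom (h t) (-t)) *
        fun s => algebraMap ℂ X ((Pi.single t 1 : ZMod N → ℂ) s) := by
      ext s
      rw [Finset.sum_apply, Finset.sum_eq_single s]
      · simp [coassoc, zero]
      · intro t _ hts
        simp [Pi.single_eq_of_ne (Ne.symm hts)]
      · simp
    rw [this]
    exact Submodule.sum_mem _ fun t _ => Submodule.subset_span ⟨_, _, rfl⟩

/-- The coaction of `C(ℤ/N)` on itself by its comultiplication `Δ(f)(s, t) = f (s + t)`. -/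
def cyclicCoaction (N : ℕ) [NeZero N] : CyclicCoaction N (ZMod N → ℂ) :=
  CyclicCoaction.ofAction
    { toFun := fun f t s => f (s + t)
      map_one' := rfl
      map_mul' := fun _ _ => rfl
      map_zero' := rfl
      map_add' := fun _ _ => rfl
      commutes' := fun _ => rfl
      map_star' := fun _ => rfl }
    (fun f s t => by
      funext r
      change f (r + s + t) = f (r + (s + t))
      rw [add_assoc])
    (fun f => by
      funext r
      change f (r + 0) = f r
      rw [add_zero])

/-- The generator `z(t) = ω ^ t` of `C(ℤ/N)`. -/
def zFun (N : ℕ) [NeZero N] (ω : ℂ) : ZMod N → ℂ := fun t => rootPow ω t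

/-! ### The C*-algebra of the anyonic free unitary quantum group -/

/-- The matrix `(ω ^ (-i (j - i)) u_ij^*)`. -/
def conjMatrix {N : ℕ} (ω : ℂ) {A : Type*} [Ring A] [StarRing A] [Algebra ℂ A]
    (u : Matrix (ZMod N) (ZMod N) A) : Matrix (ZMod N) (ZMod N) A :=
  Matrix.of fun i j => rootPow ω (-(i * (j - i))) • star (u i j)

/-- The matrices `u` and `(ω ^ (-i (j - i)) u_ij^*)` are unitary. -/
def IsAnyonicUnitary {N : ℕ} [NeZero N] (ω : ℂ) {A : Type*} [Ring A] [StarRing A] [Algebra ℂ A]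
    (u : Matrix (ZMod N) (ZMod N) A) : Prop :=
  u ∈ unitary (Matrix (ZMod N) (ZMod N) A) ∧ conjMatrix ω u ∈ unitary (Matrix (ZMod N) (ZMod N) A)

/-- The matrix of generators of the free `*`-algebra. -/
def genMatrix (N : ℕ) : Matrix (ZMod N) (ZMod N) (FreeStar (ZMod N × ZMod N)) :=
  Matrix.of fun i j => FreeStar.gen (i, j)

/-- The relators saying that the matrix `m` is unitary. -/
def unitaryRelators {N : ℕ} [NeZero N] {F : Type} [Ring F] [StarRing F]
    (m : Matrix (ZMod N) (ZMod N) F) : Set F :=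
  {r | ∃ i j, r = (star m * m - 1) i j ∨ r = (m * star m - 1) i j}

/-- The relators saying that `u` and `(ω ^ (-i (j - i)) u_ij^*)` are unitary. -/
def freeUnitaryRelators (N : ℕ) [NeZero N] (ω : ℂ) : Set (FreeStar (ZMod N × ZMod N)) :=
  unitaryRelators (genMatrix N) ∪ unitaryRelators (conjMatrix ω (genMatrix N))

theorem unitaryRelators_map_iff {N : ℕ} [NeZero N] {F : Type} {A : Type*} [Ring F] [StarRing F]
    [Algebra ℂ F] [Ring A] [StarRing A] [Algebra ℂ A] (f : F →⋆ₐ[ℂ] A)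
    (m : Matrix (ZMod N) (ZMod N) F) :
    (∀ r ∈ unitaryRelators m, f r = 0) ↔ m.map f ∈ unitary (Matrix (ZMod N) (ZMod N) A) := by
  have h1 : ∀ i j, f ((star m * m - 1) i j) = (star (m.map f) * m.map f - 1) i j := fun i j => by
    simp [Matrix.mul_apply, Matrix.star_apply, Matrix.one_apply, apply_ite f, map_star f]
  have h2 : ∀ i j, f ((m * star m - 1) i j) = (m.map f * star (m.map f) - 1) i j := fun i j => by
    simp [Matrix.mul_apply, Matrix.star_apply, Matrix.one_apply, apply_ite f, map_star f]
  rw [Unitary.mem_iff, ← sub_eq_zero, ← sub_eq_zero (a := m.map f * _)]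
  constructor
  · intro h
    constructor
    · ext i j
      rw [← h1]
      exact h _ ⟨i, j, Or.inl rfl⟩
    · ext i j
      rw [← h2]
      exact h _ ⟨i, j, Or.inr rfl⟩
  · rintro ⟨h, h'⟩ r ⟨i, j, rfl | rfl⟩
    · rw [h1, h]; rfl
    · rw [h2, h']; rfl

theorem conjMatrix_map {N : ℕ} (ω : ℂ) {F A : Type*} [Ring F] [StarRing F]
    [Algebra ℂ F] [Ring A] [StarRing A] [Algebra ℂ A] (f : F →⋆ₐ[ℂ] A)
    (m : Matrix (ZMod N) (ZMod N) F) : (conjMatrix ω m).map f = conjMatrix ω (m.map f) := by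
  ext i j
  simp [conjMatrix, map_star]

theorem freeUnitaryRelators_map_iff {N : ℕ} [NeZero N] (ω : ℂ) {A : Type*} [Ring A] [StarRing A]
    [Algebra ℂ A] (f : FreeStar (ZMod N × ZMod N) →⋆ₐ[ℂ] A) :
    (∀ r ∈ freeUnitaryRelators N ω, f r = 0) ↔ IsAnyonicUnitary ω ((genMatrix N).map f) := by
  rw [IsAnyonicUnitary, ← conjMatrix_map, ← unitaryRelators_map_iff, ← unitaryRelators_map_iff]
  constructor
  · intro h
    exact ⟨fun r hr => h r (Or.inl hr), fun r hr => h r (Or.inr hr)⟩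
  · rintro ⟨h, h'⟩ r (hr | hr)
    · exact h r hr
    · exact h' r hr

/-- Entries of unitary matrices over a C*-algebra are contractions. -/
theorem norm_entry_le_one {ι A : Type*} [Fintype ι] [DecidableEq ι] [CStarAlgebra A]
    {m : Matrix ι ι A} (hm : m ∈ unitary (Matrix ι ι A)) (i j : ι) : ‖m i j‖ ≤ 1 := by
  let _ := CStarAlgebra.spectralOrder A
  have _ := CStarAlgebra.spectralOrderedRing A
  have h : ∑ k, star (m k j) * m k j = 1 := by
    have := congrFun (congrFun (Unitary.mem_iff.mp hm).1 j) j
    simpa [Matrix.mul_apply, Matrix.star_apply] using this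
  have hle : star (m i j) * m i j ≤ 1 := by
    rw [← h]
    exact Finset.single_le_sum (f := fun k => star (m k j) * m k j)
      (fun k _ => star_mul_self_nonneg _) (Finset.mem_univ i)
  have hn := (CStarAlgebra.norm_le_one_iff_of_nonneg _ (star_mul_self_nonneg (m i j))).mpr hle
  rw [CStarRing.norm_star_mul_self] at hn
  nlinarith [norm_nonneg (m i j)]

theorem freeUnitary_bounded (N : ℕ) [NeZero N] (ω : ℂ) :
    IsBoundedRel (freeUnitaryRelators N ω) := by
  rintro ⟨i, j⟩
  refine ⟨1, fun p => ?_⟩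
  have h : ∀ r ∈ freeUnitaryRelators N ω, p.1.mkStar r = 0 := fun r hr => by
    rw [← norm_eq_zero, CStarSeminorm.mkStar_apply, CStarSeminorm.norm_toCompl]
    exact p.2 r hr
  have hu := ((freeUnitaryRelators_map_iff ω _).mp h).1
  have := norm_entry_le_one hu i j
  rwa [Matrix.map_apply, CStarSeminorm.mkStar_apply, CStarSeminorm.norm_toCompl] at this

/-- The universal unital C*-algebra generated by the entries of a matrix `u` such that `u` and
`(ω ^ (-i (j - i)) u_ij^*)` are unitary. -/
def FreeUnitary (N : ℕ) [NeZero N] (ω : ℂ) : Type :=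
  UniversalCStar (freeUnitary_bounded N ω)

instance (N : ℕ) [NeZero N] (ω : ℂ) : CStarAlgebra (FreeUnitary N ω) :=
  inferInstanceAs (CStarAlgebra (UniversalCStar (freeUnitary_bounded N ω)))

/-- The generators `u_ij`. -/
def FreeUnitary.u (N : ℕ) [NeZero N] (ω : ℂ) :
    Matrix (ZMod N) (ZMod N) (FreeUnitary N ω) :=
  Matrix.of fun i j => Universal.gen (freeUnitary_bounded N ω) (i, j)

theorem FreeUnitary.isAnyonicUnitary (N : ℕ) [NeZero N] (ω : ℂ) :
    IsAnyonicUnitary ω (FreeUnitary.u N ω) :=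
  (freeUnitaryRelators_map_iff ω (Universal.toUniversal (freeUnitary_bounded N ω))).mp
    fun _ hr => Universal.toUniversal_rel (freeUnitary_bounded N ω) hr

theorem eval_relators {N : ℕ} [NeZero N] (ω : ℂ) {A : Type*} [CStarAlgebra A]
    (d : Matrix (ZMod N) (ZMod N) A) (hd : IsAnyonicUnitary ω d) :
    ∀ r ∈ freeUnitaryRelators N ω, FreeStar.eval (fun g => d g.1 g.2) r = 0 := by
  rw [freeUnitaryRelators_map_iff]
  convert hd
  ext i j
  exact FreeStar.eval_gen _ _

/-- The universal property of `FreeUnitary`. -/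
def FreeUnitary.lift {N : ℕ} [NeZero N] (ω : ℂ) {A : Type*} [CStarAlgebra A]
    (d : Matrix (ZMod N) (ZMod N) A) (hd : IsAnyonicUnitary ω d) : FreeUnitary N ω →⋆ₐ[ℂ] A :=
  Universal.lift (freeUnitary_bounded N ω) (fun g => d g.1 g.2) (eval_relators ω d hd)

theorem FreeUnitary.lift_u {N : ℕ} [NeZero N] (ω : ℂ) {A : Type*} [CStarAlgebra A]
    (d : Matrix (ZMod N) (ZMod N) A) (hd : IsAnyonicUnitary ω d) (i j : ZMod N) :
    FreeUnitary.lift ω d hd (FreeUnitary.u N ω i j) = d i j :=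
  Universal.lift_gen _ _ _ _

theorem FreeUnitary.hom_ext {N : ℕ} [NeZero N] (ω : ℂ) {A : Type*} [CStarAlgebra A]
    {f f' : FreeUnitary N ω →⋆ₐ[ℂ] A}
    (h : ∀ i j, f (FreeUnitary.u N ω i j) = f' (FreeUnitary.u N ω i j)) : f = f' :=
  Universal.hom_ext _ fun g => h g.1 g.2

/-- The matrix `(ω ^ (t (j - i)) u_ij)`, as a function of `t`. -/
def rotatedMatrix (N : ℕ) [NeZero N] (ω : ℂ) :
    Matrix (ZMod N) (ZMod N) (ZMod N → FreeUnitary N ω) :=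
  Matrix.of fun i j t => rootPow ω (t * (j - i)) • FreeUnitary.u N ω i j

theorem rotatedMatrix_isAnyonicUnitary {N : ℕ} [NeZero N] {ω : ℂ} (hω : IsPrimitiveRoot ω N) :
    IsAnyonicUnitary ω (rotatedMatrix N ω) := by
  have hu := FreeUnitary.isAnyonicUnitary N ω
  set X := FreeUnitary N ω
  let M := Matrix (ZMod N) (ZMod N) (ZMod N → X)
  -- constant functions
  have hconst : ∀ m : Matrix (ZMod N) (ZMod N) X, m ∈ unitary (Matrix (ZMod N) (ZMod N) X) →
      (Matrix.of fun i j _ => m i j : M) ∈ unitary M := fun m hm => by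
    rw [Unitary.mem_iff] at hm ⊢
    constructor
    · ext i j t
      have := congrFun (congrFun hm.1 i) j
      simp only [Matrix.mul_apply, Matrix.star_apply, Matrix.one_apply] at this
      simp only [Matrix.mul_apply, Matrix.star_apply, Matrix.one_apply, Matrix.of_apply,
        Finset.sum_apply, Pi.mul_apply, Pi.star_apply, this]
      split_ifs <;> rfl
    · ext i j t
      have := congrFun (congrFun hm.2 i) j
      simp only [Matrix.mul_apply, Matrix.star_apply, Matrix.one_apply] at this
      simp only [Matrix.mul_apply, Matrix.star_apply, Matrix.one_apply, Matrix.of_apply,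
        Finset.sum_apply, Pi.mul_apply, Pi.star_apply, this]
      split_ifs <;> rfl
  let α : ZMod N → ZMod N → X := fun i t => algebraMap ℂ X (rootPow ω (t * i))
  have hα : ∀ i, star (α i) * α i = 1 ∧ α i * star (α i) = 1 := fun i => by
    constructor
    · ext t
      simp only [α, Pi.mul_apply, Pi.star_apply, ← algebraMap_star_comm, ← map_mul, Pi.one_apply]
      rw [mul_comm]
      exact (congrArg _ (rootPow_mul_conj hω _)).trans (map_one _)
    · ext t
      simp only [α, Pi.mul_apply, Pi.star_apply, ← algebraMap_star_comm, ← map_mul, Pi.one_apply]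
      exact (congrArg _ (rootPow_mul_conj hω _)).trans (map_one _)
  have hD : (Matrix.diagonal α : M) ∈ unitary M := by
    rw [Unitary.mem_iff, Matrix.star_eq_conjTranspose, Matrix.diagonal_conjTranspose,
      Matrix.diagonal_mul_diagonal, Matrix.diagonal_mul_diagonal]
    constructor
    · rw [← Matrix.diagonal_one]
      congr 1
      funext i
      exact (hα i).1
    · rw [← Matrix.diagonal_one]
      congr 1
      funext i
      exact (hα i).2
  have hD' := Unitary.star_mem hD
  have hsplit : ∀ i j t : ZMod N,
      rootPow ω (t * (j - i)) = rootPow ω (t * j) * starRingEnd ℂ (rootPow ω (t * i)) :=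
    fun i j t => by rw [← rootPow_neg hω, ← rootPow_add hω]; congr 1; ring
  constructor
  · convert mul_mem (mul_mem hD' (hconst _ hu.1)) hD using 1
    ext i j t
    rw [Matrix.mul_diagonal, Matrix.star_eq_conjTranspose, Matrix.diagonal_conjTranspose,
      Matrix.diagonal_mul]
    simp only [rotatedMatrix, α, Matrix.of_apply, Pi.mul_apply, Pi.star_apply,
      ← algebraMap_star_comm, ← Algebra.commutes (rootPow ω (t * j)), ← Algebra.smul_def, smul_smul,
      hsplit]
    rfl
  · convert mul_mem (mul_mem hD (hconst _ hu.2)) hD' using 1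
    ext i j t
    rw [Matrix.star_eq_conjTranspose, Matrix.diagonal_conjTranspose, Matrix.mul_diagonal,
      Matrix.diagonal_mul]
    simp only [rotatedMatrix, conjMatrix, α, Matrix.of_apply, Pi.mul_apply, Pi.star_apply,
      Pi.smul_apply, star_smul, ← algebraMap_star_comm,
      ← Algebra.commutes (star (rootPow ω (t * j))), ← Algebra.smul_def, smul_smul, hsplit]
    congr 1
    simp only [star_mul', starRingEnd_apply, star_star]
    ring

/-- The homomorphism `ρ(u_ij) = (t ↦ ω ^ (t (j - i)) u_ij)`. -/
def rotation {N : ℕ} [NeZero N] {ω : ℂ} (hω : IsPrimitiveRoot ω N) :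
    FreeUnitary N ω →⋆ₐ[ℂ] (ZMod N → FreeUnitary N ω) :=
  FreeUnitary.lift ω (rotatedMatrix N ω) (rotatedMatrix_isAnyonicUnitary hω)

theorem rotation_u {N : ℕ} [NeZero N] {ω : ℂ} (hω : IsPrimitiveRoot ω N) (i j t : ZMod N) :
    rotation hω (FreeUnitary.u N ω i j) t = rootPow ω (t * (j - i)) • FreeUnitary.u N ω i j := by
  rw [rotation, FreeUnitary.lift_u]
  rfl

/-- Evaluation at a point, as a `*`-homomorphism. -/
def evalAt {N : ℕ} (X : Type*) [CStarAlgebra X] (t : ZMod N) : (ZMod N → X) →⋆ₐ[ℂ] X where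
  toFun h := h t
  map_one' := rfl
  map_mul' _ _ := rfl
  map_zero' := rfl
  map_add' _ _ := rfl
  commutes' _ := rfl
  map_star' _ := rfl

theorem evalAt_apply {N : ℕ} {X : Type*} [CStarAlgebra X] (t : ZMod N) (h : ZMod N → X) :
    evalAt X t h = h t := rfl

theorem rotation_rotation {N : ℕ} [NeZero N] {ω : ℂ} (hω : IsPrimitiveRoot ω N)
    (x : FreeUnitary N ω) (s t : ZMod N) :
    rotation hω (rotation hω x t) s = rotation hω x (s + t) := by
  have h : ((evalAt _ s).comp (rotation hω)).comp ((evalAt _ t).comp (rotation hω)) =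
      (evalAt _ (s + t)).comp (rotation hω) := by
    refine FreeUnitary.hom_ext ω fun i j => ?_
    simp only [StarAlgHom.comp_apply, evalAt_apply]
    rw [rotation_u, rotation_u, map_smul, Pi.smul_apply, rotation_u, smul_smul, ← rootPow_add hω]
    congr 2
    ring
  have h' := DFunLike.congr_fun h x
  simpa only [StarAlgHom.comp_apply, evalAt_apply] using h'

theorem rotation_zero {N : ℕ} [NeZero N] {ω : ℂ} (hω : IsPrimitiveRoot ω N)
    (x : FreeUnitary N ω) : rotation hω x 0 = x := by
  have h : (evalAt _ 0).comp (rotation hω) = StarAlgHom.id ℂ (FreeUnitary N ω) := by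
    refine FreeUnitary.hom_ext ω fun i j => ?_
    rw [StarAlgHom.comp_apply, evalAt_apply, rotation_u, zero_mul, rootPow, ZMod.val_zero,
      pow_zero, one_smul, StarAlgHom.coe_id, id_eq]
  have h' := DFunLike.congr_fun h x
  simpa only [StarAlgHom.comp_apply, evalAt_apply, StarAlgHom.coe_id, id_eq] using h'

/-- The coaction `ρ_t(u_ij) = ω ^ (t (j - i)) u_ij` of `C(ℤ/N)`. -/
def freeUnitaryCoaction {N : ℕ} [NeZero N] {ω : ℂ} (hω : IsPrimitiveRoot ω N) :
    CyclicCoaction N (FreeUnitary N ω) :=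
  CyclicCoaction.ofAction (rotation hω) (rotation_rotation hω) (rotation_zero hω)

/-! ### Hilbert space tensor products and spatial tensor products -/

section Hilbert

variable {L L' L'' M M' M'' : Type*}
  [NormedAddCommGroup L] [InnerProductSpace ℂ L] [NormedAddCommGroup L'] [InnerProductSpace ℂ L']
  [NormedAddCommGroup L''] [InnerProductSpace ℂ L'']
  [NormedAddCommGroup M] [InnerProductSpace ℂ M] [NormedAddCommGroup M'] [InnerProductSpace ℂ M']
  [NormedAddCommGroup M''] [InnerProductSpace ℂ M'']

/-- The Hilbert space tensor product. -/
def HTensor (L M : Type*) [NormedAddCommGroup L] [InnerProductSpace ℂ L]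
    [NormedAddCommGroup M] [InnerProductSpace ℂ M] : Type _ :=
  UniformSpace.Completion (L ⊗[ℂ] M)

instance : NormedAddCommGroup (HTensor L M) :=
  inferInstanceAs (NormedAddCommGroup (UniformSpace.Completion (L ⊗[ℂ] M)))

instance : InnerProductSpace ℂ (HTensor L M) :=
  inferInstanceAs (InnerProductSpace ℂ (UniformSpace.Completion (L ⊗[ℂ] M)))

instance : CompleteSpace (HTensor L M) :=
  inferInstanceAs (CompleteSpace (UniformSpace.Completion (L ⊗[ℂ] M)))

variable (L M) in
/-- The canonical embedding of the algebraic tensor product. -/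
def tensorEmb : L ⊗[ℂ] M →ₗᵢ[ℂ] HTensor L M :=
  UniformSpace.Completion.toComplₗᵢ (𝕜 := ℂ) (E := L ⊗[ℂ] M)

/-- The elementary tensor `ξ ⊗ η`. -/
def vecTensor (ξ : L) (η : M) : HTensor L M := tensorEmb L M (ξ ⊗ₜ[ℂ] η)

/-- Extension of a bounded operator to the completion. -/
def extendOp (S : L ⊗[ℂ] M →L[ℂ] L' ⊗[ℂ] M') : HTensor L M →L[ℂ] HTensor L' M' :=
  S.completion

theorem extendOp_apply (S : L ⊗[ℂ] M →L[ℂ] L' ⊗[ℂ] M') (x : L ⊗[ℂ] M) :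
    extendOp S (tensorEmb L M x) = tensorEmb L' M' (S x) :=
  S.completion_apply_coe x

/-- The tensor product `S ⊗ T` of bounded operators. -/
def opTensor (S : L →L[ℂ] L') (T : M →L[ℂ] M') : HTensor L M →L[ℂ] HTensor L' M' :=
  extendOp (TensorProduct.mapL S T)

theorem opTensor_vecTensor (S : L →L[ℂ] L') (T : M →L[ℂ] M') (ξ : L) (η : M) :
    opTensor S T (vecTensor ξ η) = vecTensor (S ξ) (T η) := by
  rw [opTensor, vecTensor, extendOp_apply, TensorProduct.mapL_tmul, vecTensor]

theorem inner_vecTensor (ξ ξ' : L) (η η' : M) :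
    inner ℂ (vecTensor ξ η) (vecTensor ξ' η') = inner ℂ ξ ξ' * inner ℂ η η' := by
  rw [vecTensor, vecTensor, LinearIsometry.inner_map_map, TensorProduct.inner_tmul]

theorem denseRange_tensorEmb : DenseRange (tensorEmb L M) :=
  UniformSpace.Completion.denseRange_coe (α := L ⊗[ℂ] M)

/-- Bounded (semilinear) operators that agree on elementary tensors are equal. -/
theorem op_ext {K : Type*} [NormedAddCommGroup K] [InnerProductSpace ℂ K] {c : ℂ →+* ℂ}
    {S T : HTensor L M →SL[c] K} (h : ∀ ξ η, S (vecTensor ξ η) = T (vecTensor ξ η)) : S = T := by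
  refine DFunLike.coe_injective (denseRange_tensorEmb.equalizer S.continuous T.continuous ?_)
  funext x
  simp only [Function.comp_apply]
  induction x using TensorProduct.induction_on with
  | zero => rw [map_zero, map_zero, map_zero]
  | tmul ξ η => exact h ξ η
  | add x y hx hy => rw [map_add, map_add, map_add, hx, hy]

theorem opTensor_comp (S : L →L[ℂ] L') (S' : L' →L[ℂ] L'') (T : M →L[ℂ] M') (T' : M' →L[ℂ] M'') :
    opTensor S' T' ∘L opTensor S T = opTensor (S' ∘L S) (T' ∘L T) :=
  op_ext fun ξ η => by simp [opTensor_vecTensor]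

theorem opTensor_one : opTensor (1 : L →L[ℂ] L) (1 : M →L[ℂ] M) = 1 :=
  op_ext fun ξ η => by simp [opTensor_vecTensor]

theorem opTensor_star [CompleteSpace L] [CompleteSpace M] (S : L →L[ℂ] L) (T : M →L[ℂ] M) :
    star (opTensor S T) = opTensor (star S) (star T) := by
  refine op_ext fun ξ η => ?_
  refine (InnerProductSpace.toDual ℂ (HTensor L M)).injective (op_ext fun ξ' η' => ?_)
  simp only [InnerProductSpace.toDual_apply_apply]
  rw [ContinuousLinearMap.star_eq_adjoint, ContinuousLinearMap.adjoint_inner_left,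
    opTensor_vecTensor, opTensor_vecTensor, inner_vecTensor, inner_vecTensor,
    ContinuousLinearMap.star_eq_adjoint, ContinuousLinearMap.star_eq_adjoint,
    ContinuousLinearMap.adjoint_inner_left, ContinuousLinearMap.adjoint_inner_left]

variable (L M) in
/-- The flip `ξ ⊗ η ↦ η ⊗ ξ`. -/
def tensorFlip : HTensor L M →L[ℂ] HTensor M L :=
  extendOp (TensorProduct.commIsometry ℂ L M).toContinuousLinearEquiv.toContinuousLinearMap

theorem tensorFlip_vecTensor (ξ : L) (η : M) : tensorFlip L M (vecTensor ξ η) = vecTensor η ξ := by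
  rw [tensorFlip, vecTensor, extendOp_apply]
  rfl

variable [CompleteSpace L] [CompleteSpace M]

/-- The spatial (minimal) tensor product of C*-algebras of operators: the C*-algebra generated by
the operators `x ⊗ y`. -/
def spatialTensor (X : StarSubalgebra ℂ (L →L[ℂ] L)) (Y : StarSubalgebra ℂ (M →L[ℂ] M)) :
    StarSubalgebra ℂ (HTensor L M →L[ℂ] HTensor L M) :=
  (StarAlgebra.adjoin ℂ {T | ∃ x ∈ X, ∃ y ∈ Y, T = opTensor x y}).topologicalClosure

/-! ### Braided tensor products -/

variable {N : ℕ} [NeZero N]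

/-- Unitary representations of `ℤ/N`. -/
abbrev CyclicRep (N : ℕ) (L : Type*) [NormedAddCommGroup L] [InnerProductSpace ℂ L]
    [CompleteSpace L] : Type _ :=
  Multiplicative (ZMod N) →* unitary (L →L[ℂ] L)

/-- The unitary operator `π(t)`. -/
def CyclicRep.op (π : CyclicRep N L) (t : ZMod N) : L →L[ℂ] L := (π (Multiplicative.ofAdd t)).1

/-- The tensor product representation `π(t) ⊗ σ(t)`. -/
def CyclicRep.tensor (π : CyclicRep N L) (σ : CyclicRep N M) : CyclicRep N (HTensor L M) where
  toFun t := ⟨opTensor (π t).1 (σ t).1, by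
    rw [Unitary.mem_iff, opTensor_star]
    constructor
    · refine (opTensor_comp _ _ _ _).trans ?_
      refine (congrArg₂ opTensor (Unitary.mem_iff.mp (π t).2).1
        (Unitary.mem_iff.mp (σ t).2).1).trans opTensor_one
    · refine (opTensor_comp _ _ _ _).trans ?_
      refine (congrArg₂ opTensor (Unitary.mem_iff.mp (π t).2).2
        (Unitary.mem_iff.mp (σ t).2).2).trans opTensor_one⟩
  map_one' := Subtype.ext (by simpa using opTensor_one)
  map_mul' s t := Subtype.ext (by
    rw [map_mul, map_mul]
    exact (opTensor_comp _ _ _ _).symm)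

/-- The projection onto the spectral subspace `{ξ | π(t) ξ = ω ^ (t p) ξ for all t}`. -/
def spectralProj (ω : ℂ) (π : CyclicRep N L) (p : ZMod N) : L →L[ℂ] L :=
  (N : ℂ)⁻¹ • ∑ t : ZMod N, rootPow ω (-(t * p)) • π.op t

/-- The braiding `ξ ⊗ η ↦ ω ^ (p q) η ⊗ ξ` for `ξ` of degree `p` and `η` of degree `q`. -/
def braiding (ω : ℂ) (π : CyclicRep N L) (σ : CyclicRep N M) : HTensor L M →L[ℂ] HTensor M L :=
  ∑ p : ZMod N, ∑ q : ZMod N,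
    rootPow ω (p * q) • (tensorFlip L M ∘L opTensor (spectralProj ω π p) (spectralProj ω σ q))

/-- The dual braiding `η ⊗ ξ ↦ ω ^ (-p q) ξ ⊗ η` for `ξ` of degree `p` and `η` of degree `q`. -/
def dualBraiding (ω : ℂ) (π : CyclicRep N L) (σ : CyclicRep N M) :
    HTensor M L →L[ℂ] HTensor L M :=
  ∑ p : ZMod N, ∑ q : ZMod N,
    rootPow ω (-(p * q)) • (tensorFlip M L ∘L opTensor (spectralProj ω σ q) (spectralProj ω π p))

/-- The embedding `j₁(x) = x ⊗ 1`. -/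
def leftOp (M : Type*) [NormedAddCommGroup M] [InnerProductSpace ℂ M] (x : L →L[ℂ] L) :
    HTensor L M →L[ℂ] HTensor L M :=
  opTensor x 1

/-- The embedding `j₂(y)`: the operator `y ⊗ 1` on `M ⊗ L`, conjugated by the braiding. -/
def rightOp (ω : ℂ) (π : CyclicRep N L) (σ : CyclicRep N M) (y : M →L[ℂ] M) :
    HTensor L M →L[ℂ] HTensor L M :=
  dualBraiding ω π σ ∘L opTensor y 1 ∘L braiding ω π σ

/-- The braided tensor product `X ⊠ Y` of C*-algebras of operators: the C*-algebra generated by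
`j₁(X)` and `j₂(Y)`. -/
def braidedTensor (ω : ℂ) (π : CyclicRep N L) (σ : CyclicRep N M)
    (X : StarSubalgebra ℂ (L →L[ℂ] L)) (Y : StarSubalgebra ℂ (M →L[ℂ] M)) :
    StarSubalgebra ℂ (HTensor L M →L[ℂ] HTensor L M) :=
  (StarAlgebra.adjoin ℂ (leftOp M '' X ∪ rightOp ω π σ '' Y)).topologicalClosure

instance (ω : ℂ) (π : CyclicRep N L) (σ : CyclicRep N M)
    (X : StarSubalgebra ℂ (L →L[ℂ] L)) (Y : StarSubalgebra ℂ (M →L[ℂ] M)) :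
    CStarAlgebra (braidedTensor ω π σ X Y) :=
  StarSubalgebra.cstarAlgebra _ (h_closed := StarSubalgebra.isClosed_topologicalClosure _)

/-- The embedding `j₁ : X → X ⊠ Y`. -/
def braidedTensor.left {ω : ℂ} {π : CyclicRep N L} {σ : CyclicRep N M}
    {X : StarSubalgebra ℂ (L →L[ℂ] L)} {Y : StarSubalgebra ℂ (M →L[ℂ] M)} (x : X) :
    braidedTensor ω π σ X Y :=
  ⟨leftOp M x.1, StarSubalgebra.le_topologicalClosure _
    (StarAlgebra.subset_adjoin ℂ _ (Or.inl ⟨x.1, x.2, rfl⟩))⟩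

/-- The embedding `j₂ : Y → X ⊠ Y`. -/
def braidedTensor.right {ω : ℂ} {π : CyclicRep N L} {σ : CyclicRep N M}
    {X : StarSubalgebra ℂ (L →L[ℂ] L)} {Y : StarSubalgebra ℂ (M →L[ℂ] M)} (y : Y) :
    braidedTensor ω π σ X Y :=
  ⟨rightOp ω π σ y.1, StarSubalgebra.le_topologicalClosure _
    (StarAlgebra.subset_adjoin ℂ _ (Or.inr ⟨y.1, y.2, rfl⟩))⟩

theorem sum_rootPow {ω : ℂ} (hω : IsPrimitiveRoot ω N) (a : ZMod N) :
    ∑ t : ZMod N, rootPow ω (t * a) = if a = 0 then (N : ℂ) else 0 := by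
  split_ifs with h
  · simp [h, rootPow, ZMod.card]
  · have hne : rootPow ω a ≠ 1 := by
      refine hω.pow_ne_one_of_pos_of_lt ?_ (ZMod.val_lt a)
      exact fun h0 => h ((ZMod.val_eq_zero a).mp h0)
    have hS : (∑ t : ZMod N, rootPow ω (t * a)) * rootPow ω a =
        ∑ t : ZMod N, rootPow ω (t * a) := by
      rw [Finset.sum_mul]
      refine (Finset.sum_congr rfl fun t _ => ?_).trans
        (Equiv.sum_comp (Equiv.addRight (1 : ZMod N)) fun t => rootPow ω (t * a))
      rw [← rootPow_add hω, Equiv.coe_addRight, add_mul, one_mul]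
    have : (∑ t : ZMod N, rootPow ω (t * a)) * (rootPow ω a - 1) = 0 := by
      rw [mul_sub, hS, mul_one, sub_self]
    exact (mul_eq_zero.mp this).resolve_right (sub_ne_zero.mpr hne)

theorem spectralProj_apply {ω : ℂ} (hω : IsPrimitiveRoot ω N) (π : CyclicRep N L) {ξ : L}
    {p : ZMod N} (hξ : ∀ t, π.op t ξ = rootPow ω (t * p) • ξ) (q : ZMod N) :
    spectralProj ω π q ξ = if p = q then ξ else 0 := by
  have h : ∀ t : ZMod N, (rootPow ω (-(t * q)) • π.op t) ξ = rootPow ω (t * (p - q)) • ξ :=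
    fun t => by
      rw [smul_apply, hξ, smul_smul, ← rootPow_add hω]
      congr 2
      ring
  rw [spectralProj, smul_apply, sum_apply,
    Finset.sum_congr rfl fun t _ => h t, ← Finset.sum_smul, sum_rootPow hω, smul_smul]
  by_cases hpq : p = q
  · rw [if_pos (sub_eq_zero.mpr hpq), if_pos hpq,
      inv_mul_cancel₀ (Nat.cast_ne_zero.mpr (NeZero.ne N)), one_smul]
  · rw [if_neg (sub_ne_zero.mpr hpq), if_neg hpq, mul_zero, zero_smul]

/-- The braidings on homogeneous vectors. -/
theorem braiding_vecTensor {ω : ℂ} (hω : IsPrimitiveRoot ω N) (π : CyclicRep N L)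
    (σ : CyclicRep N M) {ξ : L} {η : M} {p q : ZMod N} (hξ : ∀ t, π.op t ξ = rootPow ω (t * p) • ξ)
    (hη : ∀ t, σ.op t η = rootPow ω (t * q) • η) :
    braiding ω π σ (vecTensor ξ η) = rootPow ω (p * q) • vecTensor η ξ ∧
      dualBraiding ω π σ (vecTensor η ξ) = rootPow ω (-(p * q)) • vecTensor ξ η := by
  have z1 : ∀ ξ : L, vecTensor ξ (0 : M) = 0 := fun ξ => by
    rw [vecTensor, TensorProduct.tmul_zero, map_zero]
  have z2 : ∀ η : M, vecTensor (0 : L) η = 0 := fun η => by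
    rw [vecTensor, TensorProduct.zero_tmul, map_zero]
  have z3 : ∀ η : M, vecTensor η (0 : L) = 0 := fun ξ => by
    rw [vecTensor, TensorProduct.tmul_zero, map_zero]
  have z4 : ∀ ξ : L, vecTensor (0 : M) ξ = 0 := fun η => by
    rw [vecTensor, TensorProduct.zero_tmul, map_zero]
  constructor
  · rw [braiding, sum_apply, Finset.sum_eq_single p,
      sum_apply, Finset.sum_eq_single q]
    · simp [opTensor_vecTensor, tensorFlip_vecTensor, spectralProj_apply hω π hξ,
        spectralProj_apply hω σ hη]
    · intro q' _ hq
      simp [opTensor_vecTensor, spectralProj_apply hω σ hη, Ne.symm hq, z1]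
    · simp
    · intro p' _ hp
      rw [sum_apply]
      refine Finset.sum_eq_zero fun q' _ => ?_
      simp [opTensor_vecTensor, spectralProj_apply hω π hξ, Ne.symm hp, z2]
    · simp
  · rw [dualBraiding, sum_apply, Finset.sum_eq_single p,
      sum_apply, Finset.sum_eq_single q]
    · simp [opTensor_vecTensor, tensorFlip_vecTensor, spectralProj_apply hω π hξ,
        spectralProj_apply hω σ hη]
    · intro q' _ hq
      simp [opTensor_vecTensor, spectralProj_apply hω σ hη, Ne.symm hq, z4]
    · simp
    · intro p' _ hp
      rw [sum_apply]
      refine Finset.sum_eq_zero fun q' _ => ?_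
      simp [opTensor_vecTensor, spectralProj_apply hω π hξ, Ne.symm hp, z3]
    · simp

end Hilbert

/-! ### Equivariant representations and bosonization -/

/-- A faithful `ℤ/N`-equivariant representation of a `ℤ/N`-C*-algebra `(X, ρ)` on a Hilbert space
`L` with a unitary representation of `ℤ/N`. -/
structure EquivariantRep {N : ℕ} [NeZero N] {X : Type*} [CStarAlgebra X] (ρ : CyclicCoaction N X)
    (L : Type*) [NormedAddCommGroup L] [InnerProductSpace ℂ L] [CompleteSpace L] where
  /-- The representation of `ℤ/N`. -/
  rep : CyclicRep N L
  /-- The representation of `X`. -/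
  hom : X →⋆ₐ[ℂ] (L →L[ℂ] L)
  injective : Function.Injective hom
  equivariant : ∀ (t : ZMod N) (x : X), hom (ρ.hom x t) = rep.op t * hom x * star (rep.op t)

section Bosonization

variable {N : ℕ} [NeZero N] {X Y : Type*} [CStarAlgebra X] [CStarAlgebra Y]
  {ρ : CyclicCoaction N X} {τ : CyclicCoaction N Y}
  {L M K : Type*} [NormedAddCommGroup L] [InnerProductSpace ℂ L] [CompleteSpace L]
  [NormedAddCommGroup M] [InnerProductSpace ℂ M] [CompleteSpace M]
  [NormedAddCommGroup K] [InnerProductSpace ℂ K] [CompleteSpace K]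

/-- The braided tensor product `X ⊠ Y` of two represented `ℤ/N`-C*-algebras. -/
abbrev boxTensor (ω : ℂ) (r : EquivariantRep ρ L) (s : EquivariantRep τ M) :
    StarSubalgebra ℂ (HTensor L M →L[ℂ] HTensor L M) :=
  braidedTensor ω r.rep s.rep r.hom.range s.hom.range

/-- The embedding `j₁ : X → X ⊠ Y`. -/
def j₁ (ω : ℂ) (r : EquivariantRep ρ L) (s : EquivariantRep τ M) (x : X) : boxTensor ω r s :=
  braidedTensor.left (r.hom.rangeRestrict x)

/-- The embedding `j₂ : Y → X ⊠ Y`. -/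
def j₂ (ω : ℂ) (r : EquivariantRep ρ L) (s : EquivariantRep τ M) (y : Y) : boxTensor ω r s :=
  braidedTensor.right (s.hom.rangeRestrict y)

/-- The iterated braided tensor product `X ⊠ (Y ⊠ Y)`. -/
abbrev tripleTensor (ω : ℂ) (r : EquivariantRep ρ L) (s : EquivariantRep τ M) :
    StarSubalgebra ℂ (HTensor L (HTensor M M) →L[ℂ] HTensor L (HTensor M M)) :=
  braidedTensor ω r.rep (s.rep.tensor s.rep) r.hom.range (boxTensor ω s s)

/-- `Δ_B` is the comultiplication of the bosonization of `(X, ρ, Δ)`: the composition of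
`Φ = id ⊠ Δ : C(ℤ/N) ⊠ X → C(ℤ/N) ⊠ X ⊠ X` with the homomorphism
`Ψ : C(ℤ/N) ⊠ X ⊠ X → (C(ℤ/N) ⊠ X) ⊗ (C(ℤ/N) ⊠ X)` determined by
`Ψ j₁(f) = (j₁ ⊗ j₁) Δ_{ℤ/N}(f)`, `Ψ j₂(x) = (j₂ ⊗ j₁) ρ(x)` and `Ψ j₃(x) = 1 ⊗ j₂(x)`.
Elements of `A ⊗ C(ℤ/N)` are written as `∑ t, a_t ⊗ δ_t`. -/
def IsBosonizationComult (ω : ℂ) (r : EquivariantRep (cyclicCoaction N) L)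
    (s : EquivariantRep ρ M) (Δ : X →⋆ₐ[ℂ] boxTensor ω s s)
    (Δ_B : boxTensor ω r s →⋆ₐ[ℂ] spatialTensor (boxTensor ω r s) (boxTensor ω r s)) : Prop :=
  ∃ (Φ : boxTensor ω r s →⋆ₐ[ℂ] tripleTensor ω r s)
    (Ψ : tripleTensor ω r s →⋆ₐ[ℂ] spatialTensor (boxTensor ω r s) (boxTensor ω r s)),
    (∀ (f : ZMod N → ℂ) (x : X), Φ (j₁ ω r s f * j₂ ω r s x) =
      braidedTensor.left (r.hom.rangeRestrict f) * braidedTensor.right (Δ x)) ∧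
    (∀ f : ZMod N → ℂ, (Ψ (braidedTensor.left (r.hom.rangeRestrict f))).1 =
      ∑ t : ZMod N, opTensor (j₁ ω r s ((cyclicCoaction N).hom f t)).1
        (j₁ ω r s (Pi.single t 1)).1) ∧
    (∀ x : X, (Ψ (braidedTensor.right (j₁ ω s s x))).1 =
      ∑ t : ZMod N, opTensor (j₂ ω r s (ρ.hom x t)).1 (j₁ ω r s (Pi.single t 1)).1) ∧
    (∀ x : X, (Ψ (braidedTensor.right (j₂ ω s s x))).1 = opTensor 1 (j₂ ω r s x).1) ∧
    Δ_B = Ψ.comp Φ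

end Bosonization

/-! ### The anyonic free unitary quantum group and the relations of its bosonization -/

/-- `Δ` is the comultiplication of the anyonic free unitary quantum group: the equivariant
homomorphism with `Δ(u_ij) = ∑ k, j₁(u_ik) j₂(u_kj)`. -/
def IsFreeUnitaryComult {N : ℕ} [NeZero N] {ω : ℂ} (hω : IsPrimitiveRoot ω N)
    {M : Type*} [NormedAddCommGroup M] [InnerProductSpace ℂ M] [CompleteSpace M]
    (s : EquivariantRep (freeUnitaryCoaction hω) M)
    (Δ : FreeUnitary N ω →⋆ₐ[ℂ] boxTensor ω s s) : Prop :=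
  (∀ i j, Δ (FreeUnitary.u N ω i j) =
    ∑ k, j₁ ω s s (FreeUnitary.u N ω i k) * j₂ ω s s (FreeUnitary.u N ω k j)) ∧
  ∀ (t : ZMod N) (x : FreeUnitary N ω), (Δ ((freeUnitaryCoaction hω).hom x t)).1 =
    (s.rep.tensor s.rep).op t * (Δ x).1 * star ((s.rep.tensor s.rep).op t)

/-- The relations: `z` is unitary with `z ^ N = 1`, `z u_ij = ω ^ (j - i) u_ij z`, and the matrices
`u` and `(ω ^ (-i (j - i)) u_ij^*)` are unitary. -/
structure BosonizationRelations {N : ℕ} [NeZero N] (ω : ℂ) {B : Type*} [Ring B] [StarRing B]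
    [Algebra ℂ B] (z : B) (u : Matrix (ZMod N) (ZMod N) B) : Prop where
  mul_star : z * star z = 1
  star_mul : star z * z = 1
  pow : z ^ N = 1
  comm : ∀ i j, z * u i j = rootPow ω (j - i) • (u i j * z)
  unitary : IsAnyonicUnitary ω u

/-- `B` is the universal unital C*-algebra generated by `z` and `u_ij` subject to these
relations. -/
structure IsUniversalBosonization.{u, w} {N : ℕ} [NeZero N] (ω : ℂ) {B : Type u} [CStarAlgebra B] (z : B)
    (u : Matrix (ZMod N) (ZMod N) B) : Prop where
  relations : BosonizationRelations ω z u
  generates : (StarAlgebra.adjoin ℂ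
    ({z} ∪ {b | ∃ i j, b = u i j})).topologicalClosure = ⊤
  universal : ∀ (D : Type w) [CStarAlgebra D] (z' : D) (u' : Matrix (ZMod N) (ZMod N) D),
    BosonizationRelations ω z' u' →
      ∃! φ : B →⋆ₐ[ℂ] D, φ z = z' ∧ ∀ i j, φ (u i j) = u' i j

end Anyonic

end

universe u v w

open Anyonic

noncomputable section

namespace Anyonic

/-! ### Injective *-homomorphisms are isometric with closed range. -/

section InjectiveHom

/-! Removing the flip from the braiding leaves a unitary `twist` on L ⊗ M that multiplies vectors of
bidegree (p, q) by ω^(-pq). Hence j₂(y) = twist (1 ⊗ y) twist*, which is π(-d) ⊗ y when y has degree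
d (`rightOp_eq`, `rightOp_of_isHomogeneous`), and j₁(x) j₂(y) = j₂(σ(d) y σ(d)*) j₁(x) when x has
degree d (`leftOp_mul_rightOp`).

For the factor C(ℤ/N) this says that the powers of z implement the action on j₂(Y). Conjugation by
π(t) ⊗ 1 fixes j₂(Y) and scales z^k by ω^(tk), so averaging over t recovers the coefficients of a
sum ∑ z^k j₂(y_k). Such sums therefore determine their coefficients and form a closed *-algebra:
C(ℤ/N) ⊠ Y is the crossed product of Y by ℤ/N (`crossedSum_box_bijective`), and covariant pairs
define homomorphisms out of it (`crossedLift`).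

For (a), elements z', u' satisfying the relations give a homomorphism of C(U_N^+(R)) by
universality, and the relation between z' and u' makes it covariant with the powers of z'
(`BosonizationRelations.isCovariant`).

For (b), Δ comes from universality of C(U_N^+(R)): the matrix of its values is a product of two
unitary matrices, and the braiding phase is what makes the twisted conjugate matrix multiplicative
as well (`comultMatrix_isAnyonicUnitary`). Since Δ is equivariant, id ⊠ Δ is again given by a
covariant pair. The domain of ψ is the crossed product of X ⊠ X, with X = C(U_N^+(R)), by the
diagonal action, so ψ amounts to a homomorphism on X ⊠ X covariant with z^k ⊗ z^k. As X ⊠ X is not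
presented by generators and relations here, this homomorphism is implemented spatially: T ↦ W T₂₄ W*
with W = twist₁₂ · middle₂₃ · twist₃₄ (`implementer`), where the middle factor is ∑ P_p ⊗ z^p. On
homogeneous elements it takes the prescribed values (`implementedHom_leftOp`,
`implementedHom_rightOp`), and z^k ⊗ z^k passes through W leaving the diagonal action
(`leg₁₃_mul_implementer`). The conditions on id ⊠ Δ and ψ force the values of Δ_⋊ on z and u_ij,
which generate; this gives both uniqueness and the formulas. -/

theorem spectrum_map_of_injective {A B : Type*} [CStarAlgebra A] [CStarAlgebra B]
    (f : A →⋆ₐ[ℂ] B) (hf : Function.Injective f) {a : A} (ha : IsSelfAdjoint a) :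
    spectrum ℝ (f a) = spectrum ℝ a := by
  have hc : Continuous f := AddMonoidHomClass.continuous_of_bound f 1 fun a => by
    rw [one_mul]; exact NonUnitalStarAlgHom.norm_apply_le f a
  have hfa : IsSelfAdjoint (f a) := ha.map f
  have hsub : spectrum ℝ (f a) ⊆ spectrum ℝ a :=
    AlgHom.spectrum_apply_subset (f.restrictScalars ℝ) a
  refine Set.Subset.antisymm hsub fun x hx => ?_
  by_contra hxn
  -- The empty spectrum is separate because the distance to the empty set is 0 by convention, so the
  -- test function used below would not detect `x`.
  rcases (spectrum ℝ (f a)).eq_empty_or_nonempty with he | hne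
  · have h1 : f a = algebraMap ℝ B 0 := CFC.eq_algebraMap_of_spectrum_subset_singleton (f a) 0
      (by rw [he]; exact Set.empty_subset _)
    have h2 : a = 0 := hf (by rw [h1, map_zero, map_zero])
    have hnt : Nontrivial A := by
      by_contra hA
      rw [not_nontrivial_iff_subsingleton] at hA
      rw [spectrum.of_subsingleton] at hx
      exact hx
    have hntB : Nontrivial B := hf.nontrivial
    rw [h2, map_zero, spectrum.zero_eq] at he
    exact Set.singleton_ne_empty _ he
  -- The distance vanishes on the spectrum of `f a` but not at `x`. Functional calculus gives
  -- f(g(a)) = g(f(a)) = 0, so g(a) = 0 by injectivity, while spectral mapping puts the nonzero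
  -- number `g x` in its spectrum.
  · let g : ℝ → ℝ := fun t => Metric.infDist t (spectrum ℝ (f a))
    have hg : Continuous g := Metric.continuous_infDist_pt _
    have h1 : f (cfc g a) = 0 := by
      rw [StarAlgHomClass.map_cfc f g a hg.continuousOn hc ha hfa]
      have : cfc g (f a) = cfc (fun _ => (0 : ℝ)) (f a) :=
        cfc_congr fun t ht => Metric.infDist_zero_of_mem ht
      rw [this, cfc_const_zero]
    have h2 : cfc g a = 0 := hf (by rw [h1, map_zero])
    have h3 : g x ∈ spectrum ℝ (cfc g a) := by
      rw [cfc_map_spectrum (R := ℝ) g a ha hg.continuousOn]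
      exact ⟨x, hx, rfl⟩
    have hcl : IsClosed (spectrum ℝ (f a)) := spectrum.isClosed (f a)
    have h4 : g x ≠ 0 := fun h0 => hxn ((hcl.mem_iff_infDist_zero hne).mpr h0)
    have hnt : Nontrivial A := by
      by_contra hA
      rw [not_nontrivial_iff_subsingleton] at hA
      rw [spectrum.of_subsingleton] at hx
      exact hx
    rw [h2, spectrum.zero_eq] at h3
    exact h4 h3

/-- Injective `*`-homomorphisms of C*-algebras are isometric. -/
theorem norm_map_of_injective {A B : Type*} [CStarAlgebra A] [CStarAlgebra B]
    (f : A →⋆ₐ[ℂ] B) (hf : Function.Injective f) (a : A) : ‖f a‖ = ‖a‖ := by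
  -- Norm and spectral radius agree on self-adjoint elements; the C*-identity reduces the general
  -- case to a*a.
  have key : ∀ b : A, IsSelfAdjoint b → ‖f b‖ = ‖b‖ := fun b hb => by
    have h1 := hb.toReal_spectralRadius_eq_norm
    have h2 := (hb.map f).toReal_spectralRadius_eq_norm
    rw [← h1, ← h2, spectralRadius, spectralRadius, spectrum_map_of_injective f hf hb]
  have h := key (star a * a) (IsSelfAdjoint.star_mul_self a)
  rw [map_mul, map_star, CStarRing.norm_star_mul_self, CStarRing.norm_star_mul_self] at h
  exact (mul_self_inj (norm_nonneg _) (norm_nonneg _)).mp h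

/-- An isometry out of a complete space has closed image. Applied to j₂, it makes the set of sums ∑
z^k j₂(y_k) closed. -/
theorem isClosed_range_of_injective {A B : Type*} [CStarAlgebra A] [CStarAlgebra B]
    (f : A →⋆ₐ[ℂ] B) (hf : Function.Injective f) : IsClosed (Set.range f) :=
  (AddMonoidHomClass.isometry_of_norm f (norm_map_of_injective f hf)).isClosedEmbedding.isClosed_range

theorem continuous_starAlgHom {A B : Type*} [CStarAlgebra A] [CStarAlgebra B] (f : A →⋆ₐ[ℂ] B) :
    Continuous f :=
  AddMonoidHomClass.continuous_of_bound f 1 fun a => by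
    rw [one_mul]; exact NonUnitalStarAlgHom.norm_apply_le f a

end InjectiveHom

/-! ### Bilinearity of S ⊗ T and the two leg embeddings. -/

section OpTensor

variable {L L' M M' : Type*}
  [NormedAddCommGroup L] [InnerProductSpace ℂ L] [NormedAddCommGroup L'] [InnerProductSpace ℂ L']
  [NormedAddCommGroup M] [InnerProductSpace ℂ M] [NormedAddCommGroup M'] [InnerProductSpace ℂ M']

theorem norm_vecTensor (ξ : L) (η : M) : ‖vecTensor ξ η‖ = ‖ξ‖ * ‖η‖ := by
  rw [vecTensor, LinearIsometry.norm_map, TensorProduct.norm_tmul]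

/-- The bilinear map `(ξ, η) ↦ ξ ⊗ η`. -/
def vecTensorₗ : L →ₗ[ℂ] M →ₗ[ℂ] HTensor L M :=
  (TensorProduct.mk ℂ L M).compr₂ (tensorEmb L M).toLinearMap

theorem vecTensorₗ_apply (ξ : L) (η : M) : vecTensorₗ ξ η = vecTensor ξ η := rfl

theorem opTensor_mul (a b : L →L[ℂ] L) (c d : M →L[ℂ] M) :
    opTensor a c * opTensor b d = opTensor (a * b) (c * d) := opTensor_comp _ _ _ _

theorem opTensor_add_left (a b : L →L[ℂ] L') (c : M →L[ℂ] M') :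
    opTensor (a + b) c = opTensor a c + opTensor b c :=
  op_ext fun ξ η => by
    simp only [opTensor_vecTensor, add_apply]
    simp only [← vecTensorₗ_apply, map_add,
      LinearMap.add_apply]

theorem opTensor_add_right (a : L →L[ℂ] L') (c d : M →L[ℂ] M') :
    opTensor a (c + d) = opTensor a c + opTensor a d :=
  op_ext fun ξ η => by
    simp only [opTensor_vecTensor, add_apply]
    simp only [← vecTensorₗ_apply, map_add]

theorem opTensor_smul_left (s : ℂ) (a : L →L[ℂ] L') (c : M →L[ℂ] M') :
    opTensor (s • a) c = s • opTensor a c :=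
  op_ext fun ξ η => by
    simp only [opTensor_vecTensor, smul_apply]
    simp only [← vecTensorₗ_apply, map_smul,
      LinearMap.smul_apply]

theorem opTensor_smul_right (s : ℂ) (a : L →L[ℂ] L') (c : M →L[ℂ] M') :
    opTensor a (s • c) = s • opTensor a c :=
  op_ext fun ξ η => by
    simp only [opTensor_vecTensor, smul_apply]
    simp only [← vecTensorₗ_apply, map_smul]

/-- The bilinear map `(S, T) ↦ S ⊗ T` on operators. -/
def opTensorₗ : (L →L[ℂ] L') →ₗ[ℂ] (M →L[ℂ] M') →ₗ[ℂ] (HTensor L M →L[ℂ] HTensor L' M') :=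
  LinearMap.mk₂ ℂ opTensor opTensor_add_left opTensor_smul_left opTensor_add_right
    opTensor_smul_right

theorem opTensorₗ_apply (a : L →L[ℂ] L') (c : M →L[ℂ] M') : opTensorₗ a c = opTensor a c := rfl

theorem opTensor_sum_left {ι : Type*} (s : Finset ι) (a : ι → L →L[ℂ] L') (c : M →L[ℂ] M') :
    opTensor (∑ i ∈ s, a i) c = ∑ i ∈ s, opTensor (a i) c := by
  simp only [← opTensorₗ_apply, map_sum, LinearMap.sum_apply]

theorem opTensor_sum_right {ι : Type*} (s : Finset ι) (a : L →L[ℂ] L') (c : ι → M →L[ℂ] M') :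
    opTensor a (∑ i ∈ s, c i) = ∑ i ∈ s, opTensor a (c i) := by
  simp only [← opTensorₗ_apply, map_sum]

theorem opTensor_zero_right (a : L →L[ℂ] L') : opTensor a (0 : M →L[ℂ] M') = 0 := by
  rw [← opTensorₗ_apply, map_zero]

/-- By the cross norm identity ‖ξ ⊗ η‖ = ‖ξ‖ ‖η‖, a single nonzero ξ detects b η − c η. -/
theorem opTensor_one_injective [Nontrivial L] :
    Function.Injective fun b : M →L[ℂ] M => opTensor (1 : L →L[ℂ] L) b := by
  intro b c h
  obtain ⟨ξ, hξ⟩ := exists_ne (0 : L)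
  ext η
  have h1 : vecTensor ξ (b η - c η) = 0 := by
    have := congrArg (fun T => T (vecTensor ξ η)) h
    simp only [opTensor_vecTensor, one_apply_eq_self] at this
    rw [← vecTensorₗ_apply, map_sub, vecTensorₗ_apply, vecTensorₗ_apply, this, sub_self]
  have h2 := norm_vecTensor ξ (b η - c η)
  rw [h1, norm_zero, eq_comm, mul_eq_zero, norm_eq_zero, norm_eq_zero] at h2
  exact sub_eq_zero.mp (h2.resolve_left hξ)

variable [CompleteSpace L] [CompleteSpace M]

variable (L M) in
/-- The homomorphism `a ↦ a ⊗ 1`. -/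
def inlHom : (L →L[ℂ] L) →⋆ₐ[ℂ] (HTensor L M →L[ℂ] HTensor L M) where
  toFun a := opTensor a 1
  map_one' := opTensor_one
  map_mul' a b := by rw [opTensor_mul, one_mul]
  map_zero' := by rw [← opTensorₗ_apply, map_zero, LinearMap.zero_apply]
  map_add' a b := opTensor_add_left a b 1
  commutes' c := by
    rw [Algebra.algebraMap_eq_smul_one, Algebra.algebraMap_eq_smul_one, opTensor_smul_left,
      opTensor_one]
  map_star' a := by rw [opTensor_star, star_one]

variable (L M) in
/-- The homomorphism `b ↦ 1 ⊗ b`. -/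
def inrHom : (M →L[ℂ] M) →⋆ₐ[ℂ] (HTensor L M →L[ℂ] HTensor L M) where
  toFun b := opTensor 1 b
  map_one' := opTensor_one
  map_mul' a b := by rw [opTensor_mul, one_mul]
  map_zero' := opTensor_zero_right 1
  map_add' a b := opTensor_add_right 1 a b
  commutes' c := by
    rw [Algebra.algebraMap_eq_smul_one, Algebra.algebraMap_eq_smul_one, opTensor_smul_right,
      opTensor_one]
  map_star' a := by rw [opTensor_star, star_one]

theorem inlHom_apply (a : L →L[ℂ] L) : inlHom L M a = opTensor a 1 := rfl

theorem inrHom_apply (b : M →L[ℂ] M) : inrHom L M b = opTensor 1 b := rfl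

/-- Conjugation by a unitary, after a homomorphism. -/
def conjHom {A B : Type*} [Ring A] [StarRing A] [Algebra ℂ A] [Ring B] [StarRing B] [Algebra ℂ B]
    (f : A →⋆ₐ[ℂ] B) (u : B) (h1 : star u * u = 1) (h2 : u * star u = 1) : A →⋆ₐ[ℂ] B where
  toFun a := u * f a * star u
  map_one' := by rw [map_one, mul_one, h2]
  map_mul' a b := by
    rw [map_mul]
    calc u * (f a * f b) * star u = u * f a * 1 * f b * star u := by noncomm_ring
      _ = u * f a * (star u * u) * f b * star u := by rw [h1]
      _ = _ := by noncomm_ring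
  map_zero' := by rw [map_zero, mul_zero, zero_mul]
  map_add' a b := by rw [map_add, mul_add, add_mul]
  commutes' c := by
    rw [AlgHomClass.commutes, ← Algebra.commutes, mul_assoc, h2, mul_one]
  map_star' a := by simp only [star_mul, star_star, map_star, mul_assoc]

theorem conjHom_apply {A B : Type*} [Ring A] [StarRing A] [Algebra ℂ A] [Ring B] [StarRing B]
    [Algebra ℂ B] (f : A →⋆ₐ[ℂ] B) (u : B) (h1 : star u * u = 1) (h2 : u * star u = 1) (a : A) :
    conjHom f u h1 h2 a = u * f a * star u := rfl

end OpTensor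

/-! ### Phases, gradings by projections, and controlled unitaries. -/

section Roots

variable {N : ℕ} [NeZero N] {ω : ℂ}

omit [NeZero N] in
theorem rootPow_zero : rootPow ω (0 : ZMod N) = 1 := by
  rw [rootPow, ZMod.val_zero, pow_zero]

theorem star_rootPow (hω : IsPrimitiveRoot ω N) (a : ZMod N) :
    star (rootPow ω a) = rootPow ω (-a) :=
  (rootPow_neg hω a).symm

end Roots

section Grading

variable {N : ℕ} [NeZero N] {R : Type*} [Ring R] [StarRing R] [Algebra ℂ R]

/-- Pairwise orthogonal projections with sum `1`. -/
structure IsProjDecomp (P : ZMod N → R) : Prop where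
  mul : ∀ p q, P p * P q = if p = q then P p else 0
  star : ∀ p, star (P p) = P p
  sum : ∑ p, P p = 1

/-- A unitary representation of `ℤ/N` in a `*`-ring. -/
structure IsUnitaryFamily (g : ZMod N → R) : Prop where
  zero : g 0 = 1
  add : ∀ a b, g (a + b) = g a * g b
  star : ∀ a, star (g a) = g (-a)

omit [NeZero N] [Algebra ℂ R] in
theorem IsUnitaryFamily.mul_neg {g : ZMod N → R} (hg : IsUnitaryFamily g) (a : ZMod N) :
    g a * g (-a) = 1 := by
  rw [← hg.add, add_neg_cancel, hg.zero]

omit [NeZero N] [Algebra ℂ R] in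
theorem IsUnitaryFamily.neg_mul {g : ZMod N → R} (hg : IsUnitaryFamily g) (a : ZMod N) :
    g (-a) * g a = 1 := by
  rw [← hg.add, neg_add_cancel, hg.zero]

/-- The controlled operator `∑ q, P_q g_q`. -/
def controlled (P g : ZMod N → R) : R := ∑ q, P q * g q

variable {P g : ZMod N → R}

omit [Algebra ℂ R] in
theorem star_controlled (hP : IsProjDecomp P) (hg : IsUnitaryFamily g)
    (hc : ∀ p q, Commute (P p) (g q)) : star (controlled P g) = ∑ q, P q * g (-q) := by
  rw [controlled, star_sum]
  refine Finset.sum_congr rfl fun q _ => ?_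
  rw [star_mul, hP.star, hg.star, (hc q (-q)).eq]

omit [Algebra ℂ R] in
theorem controlled_star_mul (hP : IsProjDecomp P) (hg : IsUnitaryFamily g)
    (hc : ∀ p q, Commute (P p) (g q)) : star (controlled P g) * controlled P g = 1 := by
  rw [star_controlled hP hg hc, controlled, Finset.sum_mul, ← hP.sum]
  refine Finset.sum_congr rfl fun q _ => ?_
  rw [Finset.mul_sum, Finset.sum_eq_single q]
  · rw [(hc q (-q)).eq, mul_assoc, ← mul_assoc (P q), hP.mul, if_pos rfl, (hc q q).eq,
      ← mul_assoc, hg.neg_mul, one_mul]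
  · intro p _ hp
    rw [(hc q (-q)).eq, mul_assoc, ← mul_assoc (P q), hP.mul, if_neg (Ne.symm hp), zero_mul,
      mul_zero]
  · simp

omit [Algebra ℂ R] in
theorem controlled_mul_star (hP : IsProjDecomp P) (hg : IsUnitaryFamily g)
    (hc : ∀ p q, Commute (P p) (g q)) : controlled P g * star (controlled P g) = 1 := by
  -- The adjoint ∑ P_q g_(-q) is itself the controlled operator of the inverted family, so the other
  -- unitarity relation follows from the first one.
  have h := controlled_star_mul hP (g := fun q => g (-q))
    ⟨by simpa using hg.zero, fun a b => by rw [neg_add, hg.add], fun a => hg.star _⟩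
    fun p q => hc p (-q)
  have h' : controlled P (fun q => g (-q)) = star (controlled P g) :=
    (star_controlled hP hg hc).symm
  rwa [h', star_star] at h

omit [Algebra ℂ R] in
/-- Commutation of a controlled operator with a homogeneous element. -/
theorem controlled_mul_of_shift (hg : IsUnitaryFamily g) (hc : ∀ p q, Commute (P p) (g q))
    {e : R} {d : ZMod N} (he : ∀ q, P q * e = e * P (q - d)) (hge : ∀ q, Commute (g q) e) :
    controlled P g * e = e * g d * controlled P g := by
  -- Shifting the index by `d` turns P_(q+d) e into e P_q, and splitting g_(q+d) leaves a factor g_d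
  -- independent of q.
  rw [controlled, Finset.sum_mul, Finset.mul_sum,
    ← Equiv.sum_comp (Equiv.addRight d) fun q => P q * g q * e]
  refine Finset.sum_congr rfl fun q _ => ?_
  simp only [Equiv.coe_addRight]
  rw [mul_assoc, (hge _).eq, ← mul_assoc, he, add_sub_cancel_right,
    add_comm, hg.add, mul_assoc, mul_assoc, ← mul_assoc (P q), (hc q d).eq, mul_assoc]

/-- Commutation of a controlled operator with an element that scales the controlled family. -/
theorem mul_controlled_of_scale (hP : IsProjDecomp P) {c : R} {s : ZMod N → ℂ}
    (hcP : ∀ q, Commute c (P q)) (hcg : ∀ q, c * g q = s q • (g q * c))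
    (hc : ∀ p q, Commute (P p) (g q)) :
    c * controlled P g = controlled P g * ((∑ q, s q • P q) * c) := by
  rw [controlled, Finset.mul_sum, Finset.sum_mul]
  refine Finset.sum_congr rfl fun q _ => ?_
  -- Next to P_q the scalar s_q may be replaced by the operator ∑ s_p P_p, which does not depend on
  -- q and so leaves the sum.
  have h1 : P q * ∑ p, s p • P p = s q • P q := by
    rw [Finset.mul_sum, Finset.sum_eq_single q]
    · rw [mul_smul_comm, hP.mul, if_pos rfl]
    · intro p _ hp
      rw [mul_smul_comm, hP.mul, if_neg (Ne.symm hp), smul_zero]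
    · simp
  rw [← mul_assoc, (hcP q).eq, mul_assoc, hcg, (hc q q).eq, mul_assoc, ← mul_assoc (P q), h1,
    smul_mul_assoc, mul_smul_comm, mul_smul_comm, ← mul_assoc, (hc q q).eq, mul_assoc]

theorem IsProjDecomp.map {R' : Type*} [Ring R'] [StarRing R'] [Algebra ℂ R'] (hP : IsProjDecomp P)
    (f : R →⋆ₐ[ℂ] R') : IsProjDecomp fun p => f (P p) where
  mul p q := by rw [← map_mul, hP.mul]; split_ifs <;> simp
  star p := by rw [← map_star, hP.star]
  sum := by rw [← map_sum, hP.sum, map_one]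

omit [NeZero N] in
theorem IsUnitaryFamily.map {R' : Type*} [Ring R'] [StarRing R'] [Algebra ℂ R']
    (hg : IsUnitaryFamily g) (f : R →⋆ₐ[ℂ] R') : IsUnitaryFamily fun p => f (g p) where
  zero := by rw [hg.zero, map_one]
  add a b := by rw [hg.add, map_mul]
  star a := by rw [← map_star, hg.star]

omit [NeZero N] [Algebra ℂ R] in
theorem IsUnitaryFamily.neg (hg : IsUnitaryFamily g) : IsUnitaryFamily fun p => g (-p) where
  zero := by rw [neg_zero, hg.zero]
  add a b := by rw [neg_add, hg.add]
  star a := hg.star _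

end Grading

/-! ### Spectral projections, and the twist describing the second braided embedding. -/

section Spectral

variable {N : ℕ} [NeZero N] {ω : ℂ} {L M : Type*}
  [NormedAddCommGroup L] [InnerProductSpace ℂ L] [CompleteSpace L]
  [NormedAddCommGroup M] [InnerProductSpace ℂ M] [CompleteSpace M]

omit [NeZero N] in
theorem CyclicRep.isUnitaryFamily (π : CyclicRep N L) : IsUnitaryFamily π.op where
  zero := congrArg Subtype.val (map_one π)
  add a b := congrArg Subtype.val (map_mul π (Multiplicative.ofAdd a) (Multiplicative.ofAdd b))
  star a := by
    have h : π (Multiplicative.ofAdd (-a)) = star (π (Multiplicative.ofAdd a)) := by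
      rw [ofAdd_neg, map_inv, Unitary.star_eq_inv]
    exact (congrArg Subtype.val h).symm

/-- Translate the summation variable by t. The range of the projection thus consists of vectors of
degree p, to which `spectralProj_apply` applies. -/
theorem op_mul_spectralProj (hω : IsPrimitiveRoot ω N) (π : CyclicRep N L) (t p : ZMod N) :
    π.op t * spectralProj ω π p = rootPow ω (t * p) • spectralProj ω π p := by
  rw [spectralProj, mul_smul_comm, smul_comm]
  congr 1
  rw [Finset.mul_sum, Finset.smul_sum,
    ← Equiv.sum_comp (Equiv.addLeft t) fun s => rootPow ω (t * p) • rootPow ω (-(s * p)) • π.op s]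
  refine Finset.sum_congr rfl fun s _ => ?_
  rw [Equiv.coe_addLeft, mul_smul_comm, ← π.isUnitaryFamily.add, smul_smul, ← rootPow_add hω]
  congr 2
  ring

theorem spectralProj_mul (hω : IsPrimitiveRoot ω N) (π : CyclicRep N L) (p q : ZMod N) :
    spectralProj ω π p * spectralProj ω π q = if p = q then spectralProj ω π p else 0 := by
  ext ξ
  have := spectralProj_apply hω π (ξ := spectralProj ω π q ξ) (p := q) (fun t =>
    congrArg (fun T => T ξ) (op_mul_spectralProj hω π t q)) p
  refine this.trans ?_
  by_cases h : p = q
  · rw [if_pos h, if_pos h.symm, h]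
  · rw [if_neg h, if_neg (Ne.symm h)]; rfl

/-- Fourier inversion: orthogonality of characters leaves the single term s = t. It converts phases
weighted by spectral projections back into group operators. -/
theorem sum_smul_spectralProj (hω : IsPrimitiveRoot ω N) (π : CyclicRep N L) (t : ZMod N) :
    ∑ p, rootPow ω (t * p) • spectralProj ω π p = π.op t := by
  have h : ∀ p, rootPow ω (t * p) • spectralProj ω π p =
      ∑ s, ((N : ℂ)⁻¹ * rootPow ω (p * (t - s))) • π.op s := fun p => by
    rw [spectralProj, smul_comm, Finset.smul_sum, Finset.smul_sum]
    refine Finset.sum_congr rfl fun s _ => ?_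
    rw [smul_smul (rootPow ω _), ← rootPow_add hω, smul_smul]
    congr 3
    ring
  rw [Finset.sum_congr rfl fun p _ => h p, Finset.sum_comm, Finset.sum_eq_single t]
  · rw [← Finset.sum_smul, ← Finset.mul_sum, sum_rootPow hω, sub_self, if_pos rfl,
      inv_mul_cancel₀ (Nat.cast_ne_zero.mpr (NeZero.ne N)), one_smul]
  · intro s _ hs
    rw [← Finset.sum_smul, ← Finset.mul_sum, sum_rootPow hω, if_neg (sub_ne_zero.mpr (Ne.symm hs)),
      mul_zero, zero_smul]
  · simp

theorem spectralProj_isProjDecomp (hω : IsPrimitiveRoot ω N) (π : CyclicRep N L) :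
    IsProjDecomp (spectralProj ω π) where
  mul := spectralProj_mul hω π
  star p := by
    rw [spectralProj, star_smul, star_sum, ← Equiv.sum_comp (Equiv.neg (ZMod N))]
    congr 1
    · simp
    · refine Finset.sum_congr rfl fun t _ => ?_
      rw [Equiv.neg_apply, star_smul, star_rootPow hω, π.isUnitaryFamily.star, neg_neg, neg_neg]
      congr 2
      ring
  sum := by
    have := sum_smul_spectralProj hω π 0
    simpa only [zero_mul, rootPow_zero, one_smul, π.isUnitaryFamily.zero] using this

/-- An operator is homogeneous of degree `d` for the adjoint action. -/
def IsHomogeneous (ω : ℂ) (π : CyclicRep N L) (d : ZMod N) (x : L →L[ℂ] L) : Prop :=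
  ∀ t, π.op t * x = rootPow ω (t * d) • (x * π.op t)

omit [NeZero N] in
theorem isHomogeneous_iff (π : CyclicRep N L) (d : ZMod N) (x : L →L[ℂ] L) :
    IsHomogeneous ω π d x ↔ ∀ t, π.op t * x * star (π.op t) = rootPow ω (t * d) • x := by
  refine forall_congr' fun t => ⟨fun h => ?_, fun h => ?_⟩
  · rw [h, smul_mul_assoc, mul_assoc, π.isUnitaryFamily.star, π.isUnitaryFamily.mul_neg, mul_one]
  · rw [← smul_mul_assoc, ← h, mul_assoc, π.isUnitaryFamily.star, π.isUnitaryFamily.neg_mul,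
      mul_one]

theorem IsHomogeneous.spectralProj_mul (hω : IsPrimitiveRoot ω N) {π : CyclicRep N L} {d : ZMod N}
    {x : L →L[ℂ] L} (hx : IsHomogeneous ω π d x) (p : ZMod N) :
    spectralProj ω π p * x = x * spectralProj ω π (p - d) := by
  rw [spectralProj, spectralProj, smul_mul_assoc, mul_smul_comm, Finset.sum_mul, Finset.mul_sum]
  congr 1
  refine Finset.sum_congr rfl fun t _ => ?_
  rw [smul_mul_assoc, hx, smul_smul, mul_smul_comm, ← rootPow_add hω]
  congr 2
  ring

omit [NeZero N] in
theorem commute_op (π : CyclicRep N L) (s t : ZMod N) : Commute (π.op s) (π.op t) := by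
  rw [commute_iff_eq, ← π.isUnitaryFamily.add, ← π.isUnitaryFamily.add, add_comm]

theorem commute_spectralProj (π : CyclicRep N L) (p t : ZMod N) :
    Commute (spectralProj ω π p) (π.op t) := by
  rw [spectralProj]
  exact (Commute.sum_left _ _ _ fun s _ => (commute_op π s t).smul_left _).smul_left _

omit [NeZero N] in
theorem isHomogeneous_op (π : CyclicRep N L) (s : ZMod N) : IsHomogeneous ω π 0 (π.op s) := by
  intro t
  rw [mul_zero, rootPow_zero, one_smul, (commute_op π t s).eq]

theorem commute_inl_inr (a : L →L[ℂ] L) (b : M →L[ℂ] M) : Commute (inlHom L M a) (inrHom L M b) := by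
  rw [commute_iff_eq, inlHom_apply, inrHom_apply, opTensor_mul, opTensor_mul, one_mul, mul_one,
    one_mul, mul_one]

theorem opTensor_eq (a : L →L[ℂ] L) (b : M →L[ℂ] M) :
    opTensor a b = inlHom L M a * inrHom L M b := by
  rw [inlHom_apply, inrHom_apply, opTensor_mul, one_mul, mul_one]

/-- The unitary `ξ ⊗ η ↦ ω ^ (-p q) ξ ⊗ η` for `ξ` of degree `p` and `η` of degree `q`. -/
def twist (ω : ℂ) (π : CyclicRep N L) (σ : CyclicRep N M) : HTensor L M →L[ℂ] HTensor L M :=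
  controlled (fun q => inrHom L M (spectralProj ω σ q)) fun q => inlHom L M (π.op (-q))

theorem commute_twist_aux (ω : ℂ) (π : CyclicRep N L) (σ : CyclicRep N M) (p q : ZMod N) :
    Commute (inrHom L M (spectralProj ω σ p)) (inlHom L M (π.op (-q))) :=
  (commute_inl_inr _ _).symm

theorem twist_star_mul (hω : IsPrimitiveRoot ω N) (π : CyclicRep N L) (σ : CyclicRep N M) :
    star (twist ω π σ) * twist ω π σ = 1 :=
  controlled_star_mul ((spectralProj_isProjDecomp hω σ).map _) (π.isUnitaryFamily.neg.map _)
    (commute_twist_aux ω π σ)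

theorem twist_mul_star (hω : IsPrimitiveRoot ω N) (π : CyclicRep N L) (σ : CyclicRep N M) :
    twist ω π σ * star (twist ω π σ) = 1 :=
  controlled_mul_star ((spectralProj_isProjDecomp hω σ).map _) (π.isUnitaryFamily.neg.map _)
    (commute_twist_aux ω π σ)

/-- Expanding π(-q) over its spectral projections makes the twist diagonal in the bidegree, the form
that can be compared with the braiding. -/
theorem twist_eq (hω : IsPrimitiveRoot ω N) (π : CyclicRep N L) (σ : CyclicRep N M) :
    twist ω π σ = ∑ p, ∑ q, rootPow ω (-(p * q)) •
      opTensor (spectralProj ω π p) (spectralProj ω σ q) := by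
  rw [twist, controlled, Finset.sum_comm]
  refine Finset.sum_congr rfl fun q _ => ?_
  rw [← (commute_inl_inr _ _).eq, ← opTensor_eq, ← sum_smul_spectralProj hω π (-q),
    opTensor_sum_left]
  refine Finset.sum_congr rfl fun p _ => ?_
  rw [opTensor_smul_left]
  congr 2
  ring

theorem star_twist_eq (hω : IsPrimitiveRoot ω N) (π : CyclicRep N L) (σ : CyclicRep N M) :
    star (twist ω π σ) = ∑ p, ∑ q, rootPow ω (p * q) •
      opTensor (spectralProj ω π p) (spectralProj ω σ q) := by
  rw [twist_eq hω, star_sum]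
  refine Finset.sum_congr rfl fun p _ => ?_
  rw [star_sum]
  refine Finset.sum_congr rfl fun q _ => ?_
  rw [star_smul, star_rootPow hω, neg_neg, opTensor_star, (spectralProj_isProjDecomp hω π).star,
    (spectralProj_isProjDecomp hω σ).star]

/-- The braiding is the flip after twist*, the dual braiding is the twist after the flip, and the
two flips carry y ⊗ 1 to 1 ⊗ y. The embedding j₂ is thereby conjugation by a unitary on one Hilbert
space, so it is a *-homomorphism. -/
theorem rightOp_eq (hω : IsPrimitiveRoot ω N) (π : CyclicRep N L) (σ : CyclicRep N M)
    (y : M →L[ℂ] M) :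
    rightOp ω π σ y = twist ω π σ * inrHom L M y * star (twist ω π σ) := by
  have h1 : braiding ω π σ = tensorFlip L M ∘L star (twist ω π σ) := by
    rw [star_twist_eq hω, braiding]
    ext x
    simp [map_sum]
  have h2 : dualBraiding ω π σ = twist ω π σ ∘L tensorFlip M L := by
    rw [twist_eq hω, dualBraiding]
    have : ∀ p q, tensorFlip M L ∘L opTensor (spectralProj ω σ q) (spectralProj ω π p) =
        opTensor (spectralProj ω π p) (spectralProj ω σ q) ∘L tensorFlip M L := fun p q =>
      op_ext fun ξ η => by simp [opTensor_vecTensor, tensorFlip_vecTensor]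
    simp only [this]
    ext x
    simp
  have h3 : tensorFlip M L ∘L opTensor y 1 ∘L tensorFlip L M = inrHom L M y :=
    op_ext fun ξ η => by simp [opTensor_vecTensor, tensorFlip_vecTensor, inrHom_apply]
  rw [rightOp, h1, h2, ← h3]
  rfl

/-- The embedding `j₂` on all bounded operators. -/
def rightHom (hω : IsPrimitiveRoot ω N) (π : CyclicRep N L) (σ : CyclicRep N M) :
    (M →L[ℂ] M) →⋆ₐ[ℂ] (HTensor L M →L[ℂ] HTensor L M) :=
  conjHom (inrHom L M) (twist ω π σ) (twist_star_mul hω π σ) (twist_mul_star hω π σ)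

theorem rightHom_apply (hω : IsPrimitiveRoot ω N) (π : CyclicRep N L) (σ : CyclicRep N M)
    (y : M →L[ℂ] M) : rightHom hω π σ y = rightOp ω π σ y :=
  (rightOp_eq hω π σ y).symm

theorem rightHom_injective [Nontrivial L] (hω : IsPrimitiveRoot ω N) (π : CyclicRep N L)
    (σ : CyclicRep N M) : Function.Injective (rightHom hω π σ) := by
  intro a b h
  have h' := congrArg (fun T => star (twist ω π σ) * T * twist ω π σ) h
  have key : ∀ a, star (twist ω π σ) * rightHom hω π σ a * twist ω π σ = inrHom L M a := fun a => by
    rw [rightHom, conjHom_apply, mul_assoc, mul_assoc, mul_assoc, twist_star_mul hω, mul_one,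
      ← mul_assoc, twist_star_mul hω, one_mul]
  simp only [key] at h'
  exact opTensor_one_injective h'

/-- Since y raises degrees by d, moving it past the control Q_q shifts q by d, which costs one
factor π(-d). -/
theorem twist_mul_inr (hω : IsPrimitiveRoot ω N) (π : CyclicRep N L) {σ : CyclicRep N M}
    {d : ZMod N} {y : M →L[ℂ] M} (hy : IsHomogeneous ω σ d y) :
    twist ω π σ * inrHom L M y = inrHom L M y * inlHom L M (π.op (-d)) * twist ω π σ :=
  controlled_mul_of_shift (π.isUnitaryFamily.neg.map _) (commute_twist_aux ω π σ)
    (fun q => by rw [← map_mul, hy.spectralProj_mul hω, map_mul]) fun q => commute_inl_inr _ _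

/-- Once y has moved out, the twist cancels against its adjoint. Homogeneous elements thus become
elementary tensors, which is what allows leg-by-leg computation later. -/
theorem rightOp_of_isHomogeneous (hω : IsPrimitiveRoot ω N) (π : CyclicRep N L)
    {σ : CyclicRep N M} {d : ZMod N} {y : M →L[ℂ] M} (hy : IsHomogeneous ω σ d y) :
    rightOp ω π σ y = opTensor (π.op (-d)) y := by
  rw [rightOp_eq hω, twist_mul_inr hω π hy, mul_assoc, twist_mul_star hω, mul_one, opTensor_eq,
    (commute_inl_inr _ _).eq]

/-- A homogeneous operator of degree `d` intertwines the twist. -/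
theorem inl_mul_twist (hω : IsPrimitiveRoot ω N) {π : CyclicRep N L} (σ : CyclicRep N M)
    {d : ZMod N} {x : L →L[ℂ] L} (hx : IsHomogeneous ω π d x) :
    inlHom L M x * twist ω π σ = twist ω π σ * opTensor x (σ.op d) := by
  rw [twist, mul_controlled_of_scale (s := fun q => rootPow ω (d * q))
    ((spectralProj_isProjDecomp hω σ).map _) (fun q => commute_inl_inr _ _) ?_
    (commute_twist_aux ω π σ)]
  · congr 1
    -- The phases ω^(dq) that x picks up against π(-q) assemble into σ(d).
    have : ∑ q, rootPow ω (d * q) • inrHom L M (spectralProj ω σ q) = inrHom L M (σ.op d) := by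
      simp_rw [← map_smul, ← map_sum, sum_smul_spectralProj hω]
    rw [this, opTensor_eq, (commute_inl_inr _ _).eq]
  · intro q
    rw [← map_mul, ← map_mul, ← map_smul]
    congr 1
    rw [hx (-q), smul_smul, ← rootPow_add hω]
    have : d * q + -q * d = 0 := by ring
    rw [this, rootPow_zero, one_smul]

theorem twist_mul_inr_op (π : CyclicRep N L) (σ : CyclicRep N M) (t : ZMod N) :
    twist ω π σ * inrHom L M (σ.op t) = inrHom L M (σ.op t) * twist ω π σ := by
  refine Commute.eq ?_
  refine Commute.sum_left _ _ _ fun q _ => Commute.mul_left ?_ (commute_inl_inr _ _)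
  exact (commute_spectralProj σ q t).map (inrHom L M)

/-- A homogeneous operator on the first factor acts on `j₂` by the adjoint action. -/
theorem leftOp_mul_rightOp (hω : IsPrimitiveRoot ω N) {π : CyclicRep N L} (σ : CyclicRep N M)
    {d : ZMod N} {x : L →L[ℂ] L} (hx : IsHomogeneous ω π d x) (y : M →L[ℂ] M) :
    leftOp M x * rightOp ω π σ y =
      rightOp ω π σ (σ.op d * y * star (σ.op d)) * leftOp M x := by
  -- This is `inl_mul_twist` for the adjoint, needed to return x ⊗ 1 through the right-hand twist of
  -- j₂.
  have hd : star (twist ω π σ) * inlHom L M x = opTensor x (σ.op d) * star (twist ω π σ) := by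
    calc star (twist ω π σ) * inlHom L M x
        = star (twist ω π σ) * (inlHom L M x * twist ω π σ) * star (twist ω π σ) := by
          rw [mul_assoc, mul_assoc, twist_mul_star hω, mul_one]
      _ = _ := by rw [inl_mul_twist hω σ hx, ← mul_assoc, twist_star_mul hω, one_mul]
  change inlHom L M x * _ = _ * inlHom L M x
  -- Between the two twists x carries σ(d) on the second leg; this is where the phase of the
  -- braiding becomes the action on y.
  have hc : opTensor x (σ.op d) * inrHom L M y =
      inrHom L M (σ.op d * y * star (σ.op d)) * opTensor x (σ.op d) := by
    rw [inrHom_apply, inrHom_apply, opTensor_mul, opTensor_mul, one_mul, mul_one, mul_assoc,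
      σ.isUnitaryFamily.star, σ.isUnitaryFamily.neg_mul, mul_one]
  rw [rightOp_eq hω, rightOp_eq hω]
  calc _ = inlHom L M x * twist ω π σ * inrHom L M y * star (twist ω π σ) := by
        simp only [mul_assoc]
    _ = twist ω π σ * (opTensor x (σ.op d) * inrHom L M y) * star (twist ω π σ) := by
        rw [inl_mul_twist hω σ hx]; simp only [mul_assoc]
    _ = twist ω π σ * inrHom L M (σ.op d * y * star (σ.op d)) *
          (star (twist ω π σ) * inlHom L M x) := by rw [hc, hd]; simp only [mul_assoc]
    _ = _ := by simp only [mul_assoc]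

end Spectral

/-! ### Crossed products by ℤ/N through covariant pairs. -/

section Crossed

variable {N : ℕ} [NeZero N] {A B D : Type*} [Ring A] [StarRing A] [Algebra ℂ A]
  [Ring B] [StarRing B] [Algebra ℂ B] [Ring D] [StarRing D] [Algebra ℂ D]

/-- A homomorphism `j` and a unitary family `ι` implementing the maps `τ`. -/
structure IsCovariant (τ : ZMod N → A → A) (j : A →⋆ₐ[ℂ] B) (ι : ZMod N → B) : Prop where
  family : IsUnitaryFamily ι
  comm : ∀ k x, j x * ι k = ι k * j (τ k x)

/-- The map `x ↦ ∑ k, ι_k j(x_k)`. -/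
def crossedSum (j : A →⋆ₐ[ℂ] B) (ι : ZMod N → B) : (ZMod N → A) →ₗ[ℂ] B where
  toFun x := ∑ k, ι k * j (x k)
  map_add' x y := by
    rw [← Finset.sum_add_distrib]
    exact Finset.sum_congr rfl fun k _ => by rw [Pi.add_apply, map_add, mul_add]
  map_smul' c x := by
    rw [RingHom.id_apply, Finset.smul_sum]
    exact Finset.sum_congr rfl fun k _ => by rw [Pi.smul_apply, map_smul, mul_smul_comm]

variable {j : A →⋆ₐ[ℂ] B} {ι : ZMod N → B} {τ : ZMod N → A → A}
  {j' : A →⋆ₐ[ℂ] D} {ι' : ZMod N → D}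

theorem crossedSum_apply (x : ZMod N → A) : crossedSum j ι x = ∑ k, ι k * j (x k) := rfl

theorem crossedSum_single (k : ZMod N) (a : A) : crossedSum j ι (Pi.single k a) = ι k * j a := by
  rw [crossedSum_apply, Finset.sum_eq_single k]
  · rw [Pi.single_eq_same]
  · intro l _ hl
    rw [Pi.single_eq_of_ne hl, map_zero, mul_zero]
  · simp

/-- Moving j(x_k) past ι_l costs τ_l, and the exponents add. The coefficients on the right involve τ
but not the pair (j, ι), which is why passing from one covariant pair to another with the same τ is
multiplicative. -/
theorem IsCovariant.crossedSum_mul (h : IsCovariant τ j ι) (x y : ZMod N → A) :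
    crossedSum j ι x * crossedSum j ι y =
      crossedSum j ι (∑ k, ∑ l, Pi.single (k + l) (τ l (x k) * y l)) := by
  simp only [map_sum, crossedSum_single]
  rw [crossedSum_apply, crossedSum_apply, Finset.sum_mul_sum]
  refine Finset.sum_congr rfl fun k _ => Finset.sum_congr rfl fun l _ => ?_
  rw [h.family.add, map_mul, mul_assoc, ← mul_assoc (j _), h.comm]
  simp only [mul_assoc]

theorem IsCovariant.star_crossedSum (h : IsCovariant τ j ι) (x : ZMod N → A) :
    star (crossedSum j ι x) = crossedSum j ι (∑ k, Pi.single (-k) (τ (-k) (star (x k)))) := by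
  simp only [map_sum, crossedSum_single]
  rw [crossedSum_apply, star_sum]
  refine Finset.sum_congr rfl fun k _ => ?_
  rw [star_mul, ← map_star, h.family.star, h.comm]

theorem IsCovariant.crossedSum_one (h : IsCovariant τ j ι) :
    crossedSum j ι (Pi.single 0 1) = 1 := by
  rw [crossedSum_single, h.family.zero, map_one, mul_one]

theorem IsCovariant.crossedSum_algebraMap (h : IsCovariant τ j ι) (c : ℂ) :
    crossedSum j ι (c • Pi.single 0 1) = algebraMap ℂ B c := by
  rw [map_smul, h.crossedSum_one, Algebra.algebraMap_eq_smul_one]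

/-- The homomorphism out of a crossed product given by a covariant pair. -/
def crossedLift (h : IsCovariant τ j ι) (hb : Function.Bijective (crossedSum j ι))
    (h' : IsCovariant τ j' ι') : B →⋆ₐ[ℂ] D :=
  let e := LinearEquiv.ofBijective (crossedSum j ι) hb
  have he : ∀ x, crossedSum j' ι' (e.symm (crossedSum j ι x)) = crossedSum j' ι' x := fun x =>
    congrArg _ (e.symm_apply_apply x)
  { toFun := fun T => crossedSum j' ι' (e.symm T)
    map_one' := by rw [← h.crossedSum_one, he, h'.crossedSum_one]
    map_mul' := fun S T => by
      obtain ⟨x, rfl⟩ := hb.2 S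
      obtain ⟨y, rfl⟩ := hb.2 T
      rw [h.crossedSum_mul, he, he, he, h'.crossedSum_mul]
    map_zero' := by rw [map_zero, map_zero]
    map_add' := fun S T => by rw [map_add, map_add]
    commutes' := fun c => by rw [← h.crossedSum_algebraMap, he, h'.crossedSum_algebraMap]
    map_star' := fun T => by
      obtain ⟨x, rfl⟩ := hb.2 T
      rw [h.star_crossedSum, he, he, h'.star_crossedSum] }

theorem crossedLift_crossedSum (h : IsCovariant τ j ι) (hb : Function.Bijective (crossedSum j ι))
    (h' : IsCovariant τ j' ι') (x : ZMod N → A) :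
    crossedLift h hb h' (crossedSum j ι x) = crossedSum j' ι' x :=
  congrArg (crossedSum j' ι') ((LinearEquiv.ofBijective (crossedSum j ι) hb).symm_apply_apply x)

theorem crossedLift_mul (h : IsCovariant τ j ι) (hb : Function.Bijective (crossedSum j ι))
    (h' : IsCovariant τ j' ι') (k : ZMod N) (a : A) :
    crossedLift h hb h' (ι k * j a) = ι' k * j' a := by
  rw [← crossedSum_single, crossedLift_crossedSum, crossedSum_single]

theorem crossedLift_family (h : IsCovariant τ j ι) (hb : Function.Bijective (crossedSum j ι))
    (h' : IsCovariant τ j' ι') (k : ZMod N) : crossedLift h hb h' (ι k) = ι' k := by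
  have := crossedLift_mul h hb h' k 1
  rwa [map_one, mul_one, map_one, mul_one] at this

theorem crossedLift_hom (h : IsCovariant τ j ι) (hb : Function.Bijective (crossedSum j ι))
    (h' : IsCovariant τ j' ι') (a : A) : crossedLift h hb h' (j a) = j' a := by
  have := crossedLift_mul h hb h' 0 a
  rwa [h.family.zero, one_mul, h'.family.zero, one_mul] at this

theorem hom_ext_of_crossedSum (hb : Function.Bijective (crossedSum j ι)) {f g : B →⋆ₐ[ℂ] D}
    (hι : ∀ k, f (ι k) = g (ι k)) (hj : ∀ a, f (j a) = g (j a)) : f = g := by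
  ext T
  obtain ⟨x, rfl⟩ := hb.2 T
  simp only [crossedSum_apply, map_sum, map_mul, hι, hj]

end Crossed

/-! ### The characters z^k and their degrees. -/

section Characters

variable {N : ℕ} [NeZero N] {ω : ℂ}

/-- The characters `z ^ k` of `ℤ/N`. -/
def character (ω : ℂ) (k : ZMod N) : ZMod N → ℂ := fun t => rootPow ω (k * t)

theorem character_one : character ω (1 : ZMod N) = zFun N ω := by
  funext t
  rw [character, one_mul, zFun]

theorem character_isUnitaryFamily (hω : IsPrimitiveRoot ω N) :
    IsUnitaryFamily (character ω : ZMod N → ZMod N → ℂ) where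
  zero := by funext t; rw [character, zero_mul, rootPow_zero]; rfl
  add a b := by
    funext t
    rw [Pi.mul_apply, character, character, character, add_mul, rootPow_add hω]
  star a := by
    funext t
    rw [Pi.star_apply, character, character, star_rootPow hω, neg_mul]

/-- Fourier inversion on ℤ/N. It reduces identities between linear maps on C(ℤ/N) to the powers of
z. -/
theorem character_fourier (hω : IsPrimitiveRoot ω N) (f : ZMod N → ℂ) :
    ∃ a : ZMod N → ℂ, f = ∑ k, a k • character ω k := by
  refine ⟨fun k => (N : ℂ)⁻¹ * ∑ s, f s * rootPow ω (-(k * s)), ?_⟩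
  funext t
  have h : ∀ k, ((N : ℂ)⁻¹ * ∑ s, f s * rootPow ω (-(k * s))) * rootPow ω (k * t) =
      ∑ s, (N : ℂ)⁻¹ * f s * rootPow ω (k * (t - s)) := fun k => by
    rw [Finset.mul_sum, Finset.sum_mul]
    refine Finset.sum_congr rfl fun s _ => ?_
    have : k * (t - s) = -(k * s) + k * t := by ring
    rw [this, rootPow_add hω]
    ring
  simp only [Finset.sum_apply, Pi.smul_apply, smul_eq_mul, character, h]
  rw [Finset.sum_comm, Finset.sum_eq_single t]
  · rw [← Finset.mul_sum, sum_rootPow hω, sub_self, if_pos rfl, mul_right_comm,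
      inv_mul_cancel₀ (Nat.cast_ne_zero.mpr (NeZero.ne N)), one_mul]
  · intro s _ hs
    rw [← Finset.mul_sum, sum_rootPow hω, if_neg (sub_ne_zero.mpr (Ne.symm hs)), mul_zero]
  · simp

/-- Translation by t multiplies z^k by ω^(tk); equivariance turns translation into conjugation by
the representation. -/
theorem hom_character {L : Type*} [NormedAddCommGroup L] [InnerProductSpace ℂ L] [CompleteSpace L]
    (hω : IsPrimitiveRoot ω N) (r : EquivariantRep (cyclicCoaction N) L) (k : ZMod N) :
    IsHomogeneous ω r.rep k (r.hom (character ω k)) := by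
  rw [isHomogeneous_iff]
  intro t
  rw [← r.equivariant, ← map_smul]
  congr 1
  funext s
  change rootPow ω (k * (s + t)) = rootPow ω (t * k) * rootPow ω (k * s)
  rw [← rootPow_add hω]
  congr 1
  ring

theorem EquivariantRep.nontrivial {X L : Type*} [CStarAlgebra X] [Nontrivial X]
    [NormedAddCommGroup L] [InnerProductSpace ℂ L] [CompleteSpace L] {ρ : CyclicCoaction N X}
    (r : EquivariantRep ρ L) : Nontrivial L := by
  by_contra h
  rw [not_nontrivial_iff_subsingleton] at h
  exact zero_ne_one (α := X) (r.injective (Subsingleton.elim _ _))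

end Characters

/-! ### The braided product with C(ℤ/N) as a crossed product. -/

section Braided

variable {N : ℕ} [NeZero N] {ω : ℂ} {L M : Type*}
  [NormedAddCommGroup L] [InnerProductSpace ℂ L] [CompleteSpace L]
  [NormedAddCommGroup M] [InnerProductSpace ℂ M] [CompleteSpace M]
  {X Y : Type*} [CStarAlgebra X] [CStarAlgebra Y]

/-- The embedding `j₁`, as a homomorphism. -/
def boxLeft (ω : ℂ) (π : CyclicRep N L) (σ : CyclicRep N M) (f : X →⋆ₐ[ℂ] (L →L[ℂ] L))
    (T : StarSubalgebra ℂ (M →L[ℂ] M)) : X →⋆ₐ[ℂ] braidedTensor ω π σ f.range T :=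
  ((inlHom L M).comp f).codRestrict _ fun x =>
    (braidedTensor.left (ω := ω) (π := π) (σ := σ) (Y := T) (f.rangeRestrict x)).2

/-- The embedding `j₂`, as a homomorphism. -/
def boxRight (hω : IsPrimitiveRoot ω N) (π : CyclicRep N L) (σ : CyclicRep N M)
    (S : StarSubalgebra ℂ (L →L[ℂ] L)) (T : StarSubalgebra ℂ (M →L[ℂ] M))
    (g : Y →⋆ₐ[ℂ] (M →L[ℂ] M)) (hg : ∀ y, g y ∈ T) : Y →⋆ₐ[ℂ] braidedTensor ω π σ S T :=
  ((rightHom hω π σ).comp g).codRestrict _ fun y => by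
    have := (braidedTensor.right (ω := ω) (π := π) (σ := σ) (X := S) (Y := T) ⟨g y, hg y⟩).2
    rw [StarAlgHom.comp_apply, rightHom_apply]
    exact this

theorem boxRight_coe (hω : IsPrimitiveRoot ω N) (π : CyclicRep N L) (σ : CyclicRep N M)
    (S : StarSubalgebra ℂ (L →L[ℂ] L)) (T : StarSubalgebra ℂ (M →L[ℂ] M))
    (g : Y →⋆ₐ[ℂ] (M →L[ℂ] M)) (hg : ∀ y, g y ∈ T) (y : Y) :
    (boxRight hω π σ S T g hg y).1 = rightHom hω π σ (g y) := rfl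

theorem boxRight_apply (hω : IsPrimitiveRoot ω N) (π : CyclicRep N L) (σ : CyclicRep N M)
    (S : StarSubalgebra ℂ (L →L[ℂ] L)) (T : StarSubalgebra ℂ (M →L[ℂ] M))
    (g : Y →⋆ₐ[ℂ] (M →L[ℂ] M)) (hg : ∀ y, g y ∈ T) (y : Y) :
    boxRight hω π σ S T g hg y = braidedTensor.right ⟨g y, hg y⟩ :=
  Subtype.ext (by rw [boxRight_coe, rightHom_apply]; rfl)

/-- The homogeneous components, divided by the powers of `z`. -/
def coefficient (ω : ℂ) (r : EquivariantRep (cyclicCoaction N) L) (M : Type*)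
    [NormedAddCommGroup M] [InnerProductSpace ℂ M] [CompleteSpace M] (l : ZMod N) :
    (HTensor L M →L[ℂ] HTensor L M) →ₗ[ℂ] (HTensor L M →L[ℂ] HTensor L M) :=
  (N : ℂ)⁻¹ • ∑ t : ZMod N, rootPow ω (-(t * l)) • LinearMap.mulLeftRight ℂ
    (inlHom L M (r.hom (character ω (-l))) * inlHom L M (r.rep.op t), inlHom L M (r.rep.op (-t)))

theorem coefficient_apply (r : EquivariantRep (cyclicCoaction N) L) (l : ZMod N)
    (T : HTensor L M →L[ℂ] HTensor L M) :
    coefficient ω r M l T = (N : ℂ)⁻¹ • ∑ t : ZMod N, rootPow ω (-(t * l)) •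
      (inlHom L M (r.hom (character ω (-l))) * inlHom L M (r.rep.op t) * T *
        inlHom L M (r.rep.op (-t))) := by
  simp [coefficient]

theorem continuous_coefficient (r : EquivariantRep (cyclicCoaction N) L) (l : ZMod N) :
    Continuous (coefficient ω r M l) := by
  have h : ∀ t, Continuous fun T : HTensor L M →L[ℂ] HTensor L M => rootPow ω (-(t * l)) •
      (inlHom L M (r.hom (character ω (-l))) * inlHom L M (r.rep.op t) * T *
        inlHom L M (r.rep.op (-t))) := fun t =>
    (continuous_const_smul _).comp ((continuous_mul_const _).comp (continuous_const_mul _))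
  rw [funext (coefficient_apply (ω := ω) (M := M) r l)]
  exact (continuous_const_smul _).comp (continuous_finsetSum Finset.univ fun t _ => h t)

theorem character_family (hω : IsPrimitiveRoot ω N) (r : EquivariantRep (cyclicCoaction N) L) :
    IsUnitaryFamily fun k => inlHom L M (r.hom (character ω k)) :=
  (character_isUnitaryFamily hω).map ((inlHom L M).comp r.hom)

/-- Summing over l leaves only t = 0. Every operator on L ⊗ M is recovered in this way, whether or
not it lies in the braided product, so crossed sums can be recognised by their coefficients. -/
theorem sum_coefficient (hω : IsPrimitiveRoot ω N) (r : EquivariantRep (cyclicCoaction N) L)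
    (T : HTensor L M →L[ℂ] HTensor L M) :
    ∑ l, inlHom L M (r.hom (character ω l)) * coefficient ω r M l T = T := by
  have h : ∀ l, inlHom L M (r.hom (character ω l)) * coefficient ω r M l T =
      ∑ t, ((N : ℂ)⁻¹ * rootPow ω (l * (-t))) •
        (inlHom L M (r.rep.op t) * T * inlHom L M (r.rep.op (-t))) := fun l => by
    rw [coefficient_apply, mul_smul_comm, Finset.mul_sum, Finset.smul_sum]
    refine Finset.sum_congr rfl fun t _ => ?_
    rw [mul_smul_comm, smul_smul]
    congr 1
    · congr 2; ring
    · simp only [← mul_assoc]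
      rw [(character_family hω r).mul_neg, one_mul]
  rw [Finset.sum_congr rfl fun l _ => h l, Finset.sum_comm, Finset.sum_eq_single 0]
  · rw [← Finset.sum_smul, ← Finset.mul_sum, sum_rootPow hω, neg_zero, if_pos rfl,
      inv_mul_cancel₀ (Nat.cast_ne_zero.mpr (NeZero.ne N)), one_smul, r.rep.isUnitaryFamily.zero,
      map_one, one_mul, mul_one]
  · intro t _ ht
    rw [← Finset.sum_smul, ← Finset.mul_sum, sum_rootPow hω, if_neg (neg_ne_zero.mpr ht),
      mul_zero, zero_smul]
  · simp

/-- Conjugation by π(t) ⊗ 1 fixes j₂(y) and scales z^k by ω^(tk). Averaging against ω^(-tl) keeps k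
= l, and the factor z^(-l) then cancels the power of z. -/
theorem coefficient_mul (hω : IsPrimitiveRoot ω N) (r : EquivariantRep (cyclicCoaction N) L)
    (σ : CyclicRep N M) (k l : ZMod N) (y : M →L[ℂ] M) :
    coefficient ω r M l (inlHom L M (r.hom (character ω k)) * rightHom hω r.rep σ y) =
      if k = l then rightHom hω r.rep σ y else 0 := by
  -- As an operator π(t) has degree 0, so it commutes with j₂(y) for every y, homogeneous or not.
  have hcomm : ∀ t, inlHom L M (r.rep.op t) * rightHom hω r.rep σ y =
      rightHom hω r.rep σ y * inlHom L M (r.rep.op t) := fun t => by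
    rw [rightHom_apply]
    have := leftOp_mul_rightOp hω σ (isHomogeneous_op (ω := ω) r.rep t) y
    rwa [σ.isUnitaryFamily.zero, star_one, one_mul, mul_one] at this
  have hz : ∀ t, inlHom L M (r.rep.op t) * inlHom L M (r.hom (character ω k)) =
      rootPow ω (t * k) • (inlHom L M (r.hom (character ω k)) * inlHom L M (r.rep.op t)) :=
    fun t => by rw [← map_mul, hom_character hω r k t, map_smul, map_mul]
  have h : ∀ t, rootPow ω (-(t * l)) •
      (inlHom L M (r.hom (character ω (-l))) * inlHom L M (r.rep.op t) *
        (inlHom L M (r.hom (character ω k)) * rightHom hω r.rep σ y) *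
          inlHom L M (r.rep.op (-t))) =
      rootPow ω (t * (k - l)) • (inlHom L M (r.hom (character ω (k - l))) *
        rightHom hω r.rep σ y) := fun t => by
    have h1 : inlHom L M (r.hom (character ω (k - l))) =
        inlHom L M (r.hom (character ω (-l))) * inlHom L M (r.hom (character ω k)) := by
      rw [← (character_family hω r).add]
      congr 3
      ring
    have h2 : t * (k - l) = -(t * l) + t * k := by ring
    rw [h1, h2, rootPow_add hω, ← smul_smul]
    congr 1
    calc _ = inlHom L M (r.hom (character ω (-l))) *
            (inlHom L M (r.rep.op t) * inlHom L M (r.hom (character ω k))) *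
            (rightHom hω r.rep σ y * inlHom L M (r.rep.op (-t))) := by simp only [mul_assoc]
      _ = rootPow ω (t * k) • (inlHom L M (r.hom (character ω (-l))) *
            inlHom L M (r.hom (character ω k)) *
            (inlHom L M (r.rep.op t) * inlHom L M (r.rep.op (-t))) * rightHom hω r.rep σ y) := by
          rw [hz, ← hcomm, mul_smul_comm, smul_mul_assoc]
          simp only [mul_assoc]
      _ = _ := by
          rw [← map_mul (inlHom L M) (r.rep.op t), r.rep.isUnitaryFamily.mul_neg, map_one, mul_one]
  rw [coefficient_apply, Finset.sum_congr rfl fun t _ => h t, ← Finset.sum_smul, sum_rootPow hω]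
  split_ifs with h1 h2 h2
  · rw [smul_smul, inv_mul_cancel₀ (Nat.cast_ne_zero.mpr (NeZero.ne N)), one_smul, h1,
      (character_family hω r).zero, one_mul]
  · exact absurd (sub_eq_zero.mp h1) h2
  · exact absurd (sub_eq_zero.mpr h2) h1
  · rw [zero_smul, smul_zero]

/-- The action by conjugation: `g (τ_k y) = σ(-k) g(y) σ(-k)*`. -/
def Implements (σ : CyclicRep N M) (g : Y →⋆ₐ[ℂ] (M →L[ℂ] M)) (τ : ZMod N → Y → Y) : Prop :=
  ∀ k y, g (τ k y) = σ.op (-k) * g y * star (σ.op (-k))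

variable {r : EquivariantRep (cyclicCoaction N) L} {σ : CyclicRep N M}
  {g : Y →⋆ₐ[ℂ] (M →L[ℂ] M)} {τ : ZMod N → Y → Y} {T : StarSubalgebra ℂ (M →L[ℂ] M)}

/-- The element z^k has degree k, so moving it past j₂ conjugates by σ(k); this undoes the
conjugation by σ(-k) that implements τ_k. -/
theorem isCovariant_operators (hω : IsPrimitiveRoot ω N) (hτ : Implements σ g τ) :
    IsCovariant τ ((rightHom hω r.rep σ).comp g)
      fun k => inlHom L M (r.hom (character ω k)) where
  family := character_family hω r
  comm k y := by
    simp only [StarAlgHom.comp_apply, rightHom_apply]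
    have := leftOp_mul_rightOp hω σ (hom_character hω r k) (g (τ k y))
    refine Eq.trans ?_ this.symm
    change _ = _ * inlHom L M (r.hom (character ω k))
    congr 2
    have h1 := σ.isUnitaryFamily.mul_neg k
    rw [hτ, σ.isUnitaryFamily.star, σ.isUnitaryFamily.star, neg_neg]
    calc g y = 1 * g y * 1 := by rw [one_mul, mul_one]
      _ = _ := by rw [← h1]; simp only [mul_assoc]

theorem boxRight_isCovariant (hω : IsPrimitiveRoot ω N) (hτ : Implements σ g τ)
    (hg : ∀ y, g y ∈ T) :
    IsCovariant τ (boxRight hω r.rep σ r.hom.range T g hg)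
      fun k => boxLeft ω r.rep σ r.hom T (character ω k) where
  family := (character_isUnitaryFamily hω).map _
  comm k y := Subtype.ext ((isCovariant_operators (r := r) hω hτ).comm k y)

theorem crossedSum_box_coe (hω : IsPrimitiveRoot ω N) (hg : ∀ y, g y ∈ T) (x : ZMod N → Y) :
    (crossedSum (boxRight hω r.rep σ r.hom.range T g hg)
      (fun k => boxLeft ω r.rep σ r.hom T (character ω k)) x).1 =
    crossedSum ((rightHom hω r.rep σ).comp g) (fun k => inlHom L M (r.hom (character ω k))) x := by
  rw [crossedSum_apply, crossedSum_apply]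
  exact map_sum (braidedTensor ω r.rep σ r.hom.range T).subtype _ _

theorem coefficient_crossedSum (hω : IsPrimitiveRoot ω N) (x : ZMod N → Y) (l : ZMod N) :
    coefficient ω r M l (crossedSum ((rightHom hω r.rep σ).comp g)
      (fun k => inlHom L M (r.hom (character ω k))) x) = rightHom hω r.rep σ (g (x l)) := by
  rw [crossedSum_apply, map_sum, Finset.sum_eq_single l]
  · rw [StarAlgHom.comp_apply, coefficient_mul, if_pos rfl]
  · intro k _ hk
    rw [StarAlgHom.comp_apply, coefficient_mul, if_neg hk]
  · simp

/-- The braided tensor product `C(ℤ/N) ⊠ Y` is the crossed product of `Y` by `ℤ/N`. -/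
theorem crossedSum_box_bijective (hω : IsPrimitiveRoot ω N) (hτ : Implements σ g τ)
    (hinj : Function.Injective g) (hg : ∀ y, g y ∈ T) (hT : ∀ a ∈ T, ∃ y, g y = a) :
    Function.Bijective (crossedSum (boxRight hω r.rep σ r.hom.range T g hg)
      fun k => boxLeft ω r.rep σ r.hom T (character ω k)) := by
  have hL : Nontrivial L := r.nontrivial
  have hinj' : Function.Injective ((rightHom hω r.rep σ).comp g) :=
    (rightHom_injective hω r.rep σ).comp hinj
  constructor
  · intro x y hxy
    have h := congrArg Subtype.val hxy
    rw [crossedSum_box_coe, crossedSum_box_coe] at h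
    funext l
    have h' := congrArg (coefficient ω r M l) h
    rw [coefficient_crossedSum, coefficient_crossedSum] at h'
    exact hinj' h'
  · let C := crossedSum ((rightHom hω r.rep σ).comp g)
      (fun k => inlHom L M (r.hom (character ω k)))
    have hC := isCovariant_operators (r := r) hω hτ
    let S : StarSubalgebra ℂ (HTensor L M →L[ℂ] HTensor L M) :=
      { carrier := Set.range C
        mul_mem' := by
          rintro _ _ ⟨x, rfl⟩ ⟨y, rfl⟩
          exact ⟨_, (hC.crossedSum_mul x y).symm⟩
        add_mem' := by
          rintro _ _ ⟨x, rfl⟩ ⟨y, rfl⟩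
          exact ⟨_, map_add C x y⟩
        algebraMap_mem' := fun c => ⟨_, hC.crossedSum_algebraMap c⟩
        star_mem' := by
          rintro _ ⟨x, rfl⟩
          exact ⟨_, (hC.star_crossedSum x).symm⟩ }
    -- An operator is a crossed sum exactly when all its coefficients lie in j₂(Y). The coefficient
    -- maps are continuous and j₂(Y) is closed.
    have hcl : IsClosed (S : Set (HTensor L M →L[ℂ] HTensor L M)) := by
      have : (S : Set (HTensor L M →L[ℂ] HTensor L M)) =
          ⋂ l, coefficient ω r M l ⁻¹' Set.range ((rightHom hω r.rep σ).comp g) := by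
        ext a
        rw [Set.mem_iInter]
        constructor
        · rintro ⟨x, rfl⟩ l
          exact ⟨x l, (coefficient_crossedSum hω x l).symm⟩
        · intro h
          choose x hx using h
          refine ⟨x, ?_⟩
          rw [← sum_coefficient hω r a]
          exact Finset.sum_congr rfl fun l _ => by rw [hx]
      rw [this]
      exact isClosed_iInter fun l =>
        (isClosed_range_of_injective _ hinj').preimage (continuous_coefficient r l)
    -- Both kinds of generators are crossed sums: a function through its Fourier expansion with
    -- scalar coefficients, and j₂(y) with its only coefficient at 0.
    have hle : braidedTensor ω r.rep σ r.hom.range T ≤ S := by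
      refine StarSubalgebra.topologicalClosure_minimal ?_ hcl
      refine StarAlgebra.adjoin_le ?_
      rintro _ (⟨_, ⟨f, rfl⟩, rfl⟩ | ⟨a, ha, rfl⟩)
      · obtain ⟨a, rfl⟩ := character_fourier hω f
        refine ⟨fun k => a k • 1, ?_⟩
        change crossedSum _ _ _ = inlHom L M (r.hom _)
        simp only [crossedSum_apply, map_sum, map_smul, map_one, mul_smul_comm, mul_one]
      · obtain ⟨y, rfl⟩ := hT a ha
        refine ⟨Pi.single 0 y, ?_⟩
        change crossedSum _ _ _ = _
        rw [crossedSum_single, hC.family.zero, one_mul, StarAlgHom.comp_apply, rightHom_apply]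
    intro a
    obtain ⟨x, hx⟩ := hle a.2
    exact ⟨x, Subtype.ext ((crossedSum_box_coe hω hg x).trans hx)⟩

end Braided

/-! ### Powers of z, topological generation by u_ij, and the covariant pair (j₂, z). -/

section Generalities

variable {N : ℕ} [NeZero N] {ω : ℂ}

omit [NeZero N] in
theorem IsUnitaryFamily.natCast_mul {R : Type*} [Ring R] [StarRing R] {g : ZMod N → R}
    (hg : IsUnitaryFamily g) (n : ℕ) (a : ZMod N) : g ((n : ZMod N) * a) = g a ^ n := by
  induction n with
  | zero => rw [Nat.cast_zero, zero_mul, hg.zero, pow_zero]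
  | succ n ih => rw [Nat.cast_succ, add_mul, one_mul, hg.add, ih, pow_succ]

theorem IsUnitaryFamily.eq_pow {R : Type*} [Ring R] [StarRing R] {g : ZMod N → R}
    (hg : IsUnitaryFamily g) (a : ZMod N) : g a = g 1 ^ a.val := by
  rw [← hg.natCast_mul, mul_one, ZMod.natCast_zmod_val]

omit [NeZero N] in
theorem IsUnitaryFamily.pow_card {R : Type*} [Ring R] [StarRing R] {g : ZMod N → R}
    (hg : IsUnitaryFamily g) (a : ZMod N) : g a ^ N = 1 := by
  rw [← hg.natCast_mul, ZMod.natCast_self, zero_mul, hg.zero]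

/-- Exponents add modulo N because z^N = 1. Then z^(-a) z^a = 1, and multiplying by the adjoint of
z^a identifies it with z^(-a). -/
theorem isUnitaryFamily_pow {R : Type*} [Ring R] [StarRing R] {z : R} (h1 : z * star z = 1)
    (h2 : z ^ N = 1) : IsUnitaryFamily fun a : ZMod N => z ^ a.val := by
  have hadd : ∀ a b : ZMod N, z ^ (a + b).val = z ^ a.val * z ^ b.val := fun a b => by
    rw [ZMod.val_add, ← pow_add]
    conv_rhs => rw [← Nat.mod_add_div (a.val + b.val) N, pow_add, pow_mul, h2, one_pow, mul_one]
  refine ⟨by rw [ZMod.val_zero, pow_zero], hadd, fun a => ?_⟩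
  have h3 : ∀ n : ℕ, z ^ n * star (z ^ n) = 1 := fun n => by
    induction n with
    | zero => simp
    | succ n ih =>
      rw [pow_succ, star_mul, mul_assoc, ← mul_assoc z, h1, one_mul, ih]
  calc star (z ^ a.val) = z ^ (-a).val * z ^ a.val * star (z ^ a.val) := by
        rw [← hadd, neg_add_cancel, ZMod.val_zero, pow_zero, one_mul]
    _ = _ := by rw [mul_assoc, h3, mul_one]

-- The exponent is `1 % N`, which is 0 when N = 1; in that case z^N = 1 already says z = 1.
omit [NeZero N] in
theorem pow_val_one {R : Type*} [Ring R] {z : R} (h : z ^ N = 1) : z ^ (1 : ZMod N).val = z := by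
  rw [ZMod.val_one_eq_one_mod]
  conv_rhs => rw [← pow_one z, ← Nat.mod_add_div 1 N, pow_add, pow_mul, h, one_pow, mul_one]

theorem unitary_matrix_map {A B : Type*} [Ring A] [StarRing A] [Algebra ℂ A] [Ring B] [StarRing B]
    [Algebra ℂ B] (f : A →⋆ₐ[ℂ] B) {m : Matrix (ZMod N) (ZMod N) A}
    (hm : m ∈ unitary (Matrix (ZMod N) (ZMod N) A)) :
    m.map f ∈ unitary (Matrix (ZMod N) (ZMod N) B) := by
  rw [Unitary.mem_iff] at hm ⊢
  have hs : star (m.map f) = (star m).map f := by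
    ext i j
    simp [Matrix.star_apply, map_star]
  have hmul : ∀ a b : Matrix (ZMod N) (ZMod N) A, a.map f * b.map f = (a * b).map f := fun a b => by
    ext i j
    simp [Matrix.mul_apply]
  have h1 : (1 : Matrix (ZMod N) (ZMod N) A).map f = 1 :=
    Matrix.map_one f (map_zero f) (map_one f)
  rw [hs, hmul, hmul, hm.1, hm.2, h1]
  exact ⟨rfl, rfl⟩

theorem IsAnyonicUnitary.map {A B : Type*} [Ring A] [StarRing A] [Algebra ℂ A] [Ring B] [StarRing B]
    [Algebra ℂ B] (f : A →⋆ₐ[ℂ] B) {m : Matrix (ZMod N) (ZMod N) A} (hm : IsAnyonicUnitary ω m) :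
    IsAnyonicUnitary ω (m.map f) :=
  ⟨unitary_matrix_map f hm.1, by rw [← conjMatrix_map]; exact unitary_matrix_map f hm.2⟩

/-- The generators `u_ij` generate `FreeUnitary` topologically. -/
theorem FreeUnitary.mem_of_isClosed {S : StarSubalgebra ℂ (FreeUnitary N ω)}
    (hS : IsClosed (S : Set (FreeUnitary N ω))) (hu : ∀ i j, FreeUnitary.u N ω i j ∈ S)
    (x : FreeUnitary N ω) : x ∈ S := by
  refine (Universal.maxSeminorm (freeUnitary_bounded N ω)).compl_ind (P := fun a => a ∈ S) hS
    (fun a => ?_) x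
  change Universal.toUniversal (freeUnitary_bounded N ω) a ∈ S
  induction a using FreeStar.induction with
  | hc c =>
    rw [AlgHomClass.commutes]
    exact S.algebraMap_mem c
  | hl y =>
    rcases y with ⟨i, j⟩ | ⟨i, j⟩
    · exact hu i j
    · have : (FreeStar.letter (Sum.inr (i, j)) : FreeStar (ZMod N × ZMod N)) =
          star (FreeStar.gen (i, j)) := by
        rw [FreeStar.gen, FreeStar.star_letter]; rfl
      rw [this, map_star]
      exact S.star_mem' (hu i j)
  | hm a b ha hb => rw [map_mul]; exact mul_mem ha hb
  | ha a b ha hb => rw [map_add]; exact add_mem ha hb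

theorem freeUnitaryCoaction_u (hω : IsPrimitiveRoot ω N) (i j t : ZMod N) :
    (freeUnitaryCoaction hω).hom (FreeUnitary.u N ω i j) t =
      rootPow ω (t * (j - i)) • FreeUnitary.u N ω i j :=
  rotation_u hω i j t

variable {L M : Type*}
  [NormedAddCommGroup L] [InnerProductSpace ℂ L] [CompleteSpace L]
  [NormedAddCommGroup M] [InnerProductSpace ℂ M] [CompleteSpace M]
  {X : Type*} [CStarAlgebra X] {ρ : CyclicCoaction N X}

theorem EquivariantRep.implements (s : EquivariantRep ρ M) :
    Implements s.rep s.hom fun k x => ρ.hom x (-k) :=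
  fun k x => s.equivariant (-k) x

/-- The covariant pair `(j₂, z)` of `C(ℤ/N) ⊠ X`. -/
abbrev boxEmbed (hω : IsPrimitiveRoot ω N) (r : EquivariantRep (cyclicCoaction N) L)
    (s : EquivariantRep ρ M) : X →⋆ₐ[ℂ] boxTensor ω r s :=
  boxRight hω r.rep s.rep r.hom.range s.hom.range s.hom fun x => ⟨x, rfl⟩

/-- The powers of `z` in `C(ℤ/N) ⊠ X`. -/
abbrev boxCharacter (ω : ℂ) (r : EquivariantRep (cyclicCoaction N) L) (s : EquivariantRep ρ M)
    (k : ZMod N) : boxTensor ω r s :=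
  boxLeft ω r.rep s.rep r.hom s.hom.range (character ω k)

theorem boxEmbed_apply (hω : IsPrimitiveRoot ω N) (r : EquivariantRep (cyclicCoaction N) L)
    (s : EquivariantRep ρ M) (x : X) : boxEmbed hω r s x = j₂ ω r s x :=
  boxRight_apply _ _ _ _ _ _ _ _

theorem boxEmbed_isCovariant (hω : IsPrimitiveRoot ω N) (r : EquivariantRep (cyclicCoaction N) L)
    (s : EquivariantRep ρ M) :
    IsCovariant (fun k x => ρ.hom x (-k)) (boxEmbed hω r s) (boxCharacter ω r s) :=
  boxRight_isCovariant hω s.implements _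

theorem boxEmbed_bijective (hω : IsPrimitiveRoot ω N) (r : EquivariantRep (cyclicCoaction N) L)
    (s : EquivariantRep ρ M) :
    Function.Bijective (crossedSum (boxEmbed hω r s) (boxCharacter ω r s)) :=
  crossedSum_box_bijective hω s.implements s.injective _ fun _ ⟨x, hx⟩ => ⟨x, hx⟩

end Generalities

/-! ### The universal property of the bosonization. -/

section UniversalProperty

variable {N : ℕ} [NeZero N] {ω : ℂ} {L M : Type*}
  [NormedAddCommGroup L] [InnerProductSpace ℂ L] [CompleteSpace L]
  [NormedAddCommGroup M] [InnerProductSpace ℂ M] [CompleteSpace M]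

theorem bosonizationRelations (hω : IsPrimitiveRoot ω N)
    (r : EquivariantRep (cyclicCoaction N) L) (s : EquivariantRep (freeUnitaryCoaction hω) M) :
    BosonizationRelations ω (boxCharacter ω r s 1)
      ((FreeUnitary.u N ω).map (boxEmbed hω r s)) := by
  have h := boxEmbed_isCovariant hω r s
  constructor
  · rw [h.family.star, h.family.mul_neg]
  · rw [h.family.star, h.family.neg_mul]
  · exact h.family.pow_card 1
  · intro i j
    rw [Matrix.map_apply, h.comm, freeUnitaryCoaction_u, map_smul, mul_smul_comm, smul_smul,
      ← rootPow_add hω]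
    -- Covariance brings z to the left at the cost of the action of -1, whose phase is inverse to
    -- ω^(j-i).
    have : j - i + -1 * (j - i) = 0 := by ring
    rw [this, rootPow_zero, one_smul]
  · exact (FreeUnitary.isAnyonicUnitary N ω).map _

/-- With φ the lift of u, both x ↦ φ(ρ_(-k) x) and x ↦ z^(-k) φ(x) z^k are *-homomorphisms, and the
iterated commutation relation makes them agree on the generators. Universality carries the relation
over to all x. -/
theorem BosonizationRelations.isCovariant (hω : IsPrimitiveRoot ω N) {D : Type*} [CStarAlgebra D]
    {z : D} {u : Matrix (ZMod N) (ZMod N) D} (h : BosonizationRelations ω z u) :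
    IsCovariant (fun k x => (freeUnitaryCoaction hω).hom x (-k)) (FreeUnitary.lift ω u h.unitary)
      fun k => z ^ k.val := by
  have hf : IsUnitaryFamily fun k : ZMod N => z ^ k.val := isUnitaryFamily_pow h.mul_star h.pow
  refine ⟨hf, fun k x => ?_⟩
  have hpow : ∀ (n : ℕ) i j, z ^ n * u i j = rootPow ω ((n : ZMod N) * (j - i)) • (u i j * z ^ n) :=
    fun n i j => by
      induction n with
      | zero => rw [pow_zero, one_mul, mul_one, Nat.cast_zero, zero_mul, rootPow_zero, one_smul]
      | succ n ih =>
        rw [pow_succ, mul_assoc, h.comm, mul_smul_comm, ← mul_assoc, ih, smul_mul_assoc,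
          smul_smul, ← rootPow_add hω, mul_assoc, Nat.cast_succ]
        congr 2
        ring
  have h1 : star (star (z ^ k.val)) * star (z ^ k.val) = 1 := by
    rw [star_star]
    exact (congrArg _ (hf.star k)).trans (hf.mul_neg k)
  have h2 : star (z ^ k.val) * star (star (z ^ k.val)) = 1 := by
    rw [star_star]
    exact (congrArg (· * z ^ k.val) (hf.star k)).trans (hf.neg_mul k)
  have key : (FreeUnitary.lift ω u h.unitary).comp
      ((evalAt _ (-k)).comp (freeUnitaryCoaction hω).hom) =
      conjHom (FreeUnitary.lift ω u h.unitary) (star (z ^ k.val)) h1 h2 := by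
    refine FreeUnitary.hom_ext ω fun i j => ?_
    rw [StarAlgHom.comp_apply, StarAlgHom.comp_apply, evalAt_apply, freeUnitaryCoaction_u,
      map_smul, conjHom_apply, FreeUnitary.lift_u, star_star]
    have h3 := hpow k.val i j
    rw [ZMod.natCast_zmod_val] at h3
    have h4 : u i j * z ^ k.val = rootPow ω (-k * (j - i)) • (z ^ k.val * u i j) := by
      rw [h3, smul_smul, ← rootPow_add hω]
      have : -k * (j - i) + k * (j - i) = 0 := by ring
      rw [this, rootPow_zero, one_smul]
    rw [mul_assoc, h4, mul_smul_comm, ← mul_assoc]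
    rw [star_star] at h2
    rw [h2, one_mul]
  have h5 := DFunLike.congr_fun key x
  rw [StarAlgHom.comp_apply, StarAlgHom.comp_apply, evalAt_apply, conjHom_apply, star_star] at h5
  rw [h5, ← mul_assoc, ← mul_assoc]
  rw [star_star] at h1
  rw [h1, one_mul]

/-- Every element is a sum of products z^k j₂(x); z fixes its powers, and the u_ij fix the
homomorphism on j₂(x). -/
theorem hom_ext_bosonization (hω : IsPrimitiveRoot ω N) (r : EquivariantRep (cyclicCoaction N) L)
    (s : EquivariantRep (freeUnitaryCoaction hω) M) {D : Type*} [CStarAlgebra D]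
    {φ ψ : boxTensor ω r s →⋆ₐ[ℂ] D} (hz : φ (boxCharacter ω r s 1) = ψ (boxCharacter ω r s 1))
    (hu : ∀ i j, φ (boxEmbed hω r s (FreeUnitary.u N ω i j)) =
      ψ (boxEmbed hω r s (FreeUnitary.u N ω i j))) : φ = ψ := by
  refine hom_ext_of_crossedSum (boxEmbed_bijective hω r s) (fun k => ?_) fun x => ?_
  · rw [(boxEmbed_isCovariant hω r s).family.eq_pow k, map_pow, map_pow, hz]
  · have : φ.comp (boxEmbed hω r s) = ψ.comp (boxEmbed hω r s) := FreeUnitary.hom_ext ω hu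
    exact DFunLike.congr_fun this x

theorem isUniversalBosonization {L : Type u} {M : Type v}
    [NormedAddCommGroup L] [InnerProductSpace ℂ L] [CompleteSpace L]
    [NormedAddCommGroup M] [InnerProductSpace ℂ M] [CompleteSpace M] (hω : IsPrimitiveRoot ω N)
    (r : EquivariantRep (cyclicCoaction N) L) (s : EquivariantRep (freeUnitaryCoaction hω) M) :
    IsUniversalBosonization.{max u v, w} ω (boxCharacter ω r s 1)
      ((FreeUnitary.u N ω).map (boxEmbed hω r s)) where
  relations := bosonizationRelations hω r s
  generates := by
    set S := (StarAlgebra.adjoin ℂ ({boxCharacter ω r s 1} ∪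
      {b | ∃ i j, b = ((FreeUnitary.u N ω).map (boxEmbed hω r s)) i j})).topologicalClosure with hS
    have hsub : ∀ b ∈ ({boxCharacter ω r s 1} ∪
      {b | ∃ i j, b = ((FreeUnitary.u N ω).map (boxEmbed hω r s)) i j}), b ∈ S := fun b hb =>
      StarSubalgebra.le_topologicalClosure _ (StarAlgebra.subset_adjoin ℂ _ hb)
    have hcl : IsClosed (S : Set (boxTensor ω r s)) :=
      StarSubalgebra.isClosed_topologicalClosure _
    -- The x with j₂(x) in S form a closed *-subalgebra containing the u_ij.
    have hx : ∀ x, boxEmbed hω r s x ∈ S := fun x =>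
      FreeUnitary.mem_of_isClosed (S := S.comap (boxEmbed hω r s))
        (hcl.preimage (continuous_starAlgHom (boxEmbed hω r s)))
        (fun i j => hsub _ (Or.inr ⟨i, j, rfl⟩)) x
    refine eq_top_iff.mpr fun b _ => ?_
    obtain ⟨x, rfl⟩ := (boxEmbed_bijective hω r s).2 b
    rw [crossedSum_apply]
    refine sum_mem fun k _ => mul_mem ?_ (hx _)
    rw [(boxEmbed_isCovariant hω r s).family.eq_pow k]
    exact pow_mem (hsub _ (Or.inl rfl)) _
  universal D _ z' u' h := by
    have hc := boxEmbed_isCovariant hω r s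
    have hb := boxEmbed_bijective hω r s
    -- The lift of u' and the powers of z' implement the same maps as (j₂, z), so the crossed
    -- product maps to D.
    refine ⟨crossedLift hc hb (h.isCovariant hω), ⟨?_, fun i j => ?_⟩, ?_⟩
    · rw [crossedLift_family, pow_val_one h.pow]
    · rw [Matrix.map_apply, crossedLift_hom, FreeUnitary.lift_u]
    · rintro φ ⟨hφ, hφ'⟩
      refine hom_ext_bosonization hω r s ?_ fun i j => ?_
      · rw [crossedLift_family, pow_val_one h.pow]
        exact hφ
      · rw [crossedLift_hom, FreeUnitary.lift_u]
        exact hφ' i j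

end UniversalProperty

/-! ### Degrees and the diagonal action on braided products. -/

section Homogeneous

variable {N : ℕ} [NeZero N] {ω : ℂ} {L M : Type*}
  [NormedAddCommGroup L] [InnerProductSpace ℂ L] [CompleteSpace L]
  [NormedAddCommGroup M] [InnerProductSpace ℂ M] [CompleteSpace M]

theorem IsHomogeneous.mul (hω : IsPrimitiveRoot ω N) {π : CyclicRep N L} {c d : ZMod N}
    {x y : L →L[ℂ] L} (hx : IsHomogeneous ω π c x) (hy : IsHomogeneous ω π d y) :
    IsHomogeneous ω π (c + d) (x * y) := fun t => by
  rw [← mul_assoc, hx, smul_mul_assoc, mul_assoc, hy, mul_smul_comm, smul_smul,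
    ← rootPow_add hω, mul_assoc, mul_add]

omit [NeZero N] in
theorem IsHomogeneous.sum {π : CyclicRep N L} {d : ZMod N} {κ : Type*} (S : Finset κ)
    {x : κ → L →L[ℂ] L} (hx : ∀ k ∈ S, IsHomogeneous ω π d (x k)) :
    IsHomogeneous ω π d (∑ k ∈ S, x k) := fun t => by
  rw [Finset.mul_sum, Finset.sum_mul, Finset.smul_sum]
  exact Finset.sum_congr rfl fun k hk => hx k hk t

omit [NeZero N] in
theorem isHomogeneous_one (π : CyclicRep N L) : IsHomogeneous ω π 0 1 := fun t => by
  rw [mul_zero, rootPow_zero, one_smul, mul_one, one_mul]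

omit [NeZero N] in
theorem CyclicRep.tensor_op (π : CyclicRep N L) (σ : CyclicRep N M) (t : ZMod N) :
    (π.tensor σ).op t = opTensor (π.op t) (σ.op t) := rfl

theorem IsHomogeneous.opTensor (hω : IsPrimitiveRoot ω N) {π : CyclicRep N L} {σ : CyclicRep N M}
    {c d : ZMod N} {x : L →L[ℂ] L} {y : M →L[ℂ] M} (hx : IsHomogeneous ω π c x)
    (hy : IsHomogeneous ω σ d y) : IsHomogeneous ω (π.tensor σ) (c + d) (opTensor x y) :=
  fun t => by
    rw [CyclicRep.tensor_op, opTensor_mul, hx, hy, opTensor_smul_left, opTensor_smul_right,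
      smul_smul, ← rootPow_add hω, opTensor_mul, mul_add]

omit [NeZero N] in
theorem conj_leftOp (π : CyclicRep N L) (σ : CyclicRep N M) (t : ZMod N) (x : L →L[ℂ] L) :
    (π.tensor σ).op t * leftOp M x * star ((π.tensor σ).op t) =
      leftOp M (π.op t * x * star (π.op t)) := by
  rw [CyclicRep.tensor_op, leftOp, leftOp, opTensor_star, opTensor_mul, opTensor_mul, mul_one,
    σ.isUnitaryFamily.star, σ.isUnitaryFamily.mul_neg]

/-- The factor π(t) ⊗ 1 has degree 0 and commutes with j₂(y), while 1 ⊗ σ(t) commutes with the twist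
and so acts directly on y. -/
theorem conj_rightOp (hω : IsPrimitiveRoot ω N) (π : CyclicRep N L) (σ : CyclicRep N M)
    (t : ZMod N) (y : M →L[ℂ] M) :
    (π.tensor σ).op t * rightOp ω π σ y * star ((π.tensor σ).op t) =
      rightOp ω π σ (σ.op t * y * star (σ.op t)) := by
  have h1 : inlHom L M (π.op t) * rightOp ω π σ y = rightOp ω π σ y * inlHom L M (π.op t) := by
    have := leftOp_mul_rightOp hω σ (isHomogeneous_op (ω := ω) π t) y
    rwa [σ.isUnitaryFamily.zero, star_one, one_mul, mul_one] at this
  have h2 : star (twist ω π σ) * inrHom L M (star (σ.op t)) =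
      inrHom L M (star (σ.op t)) * star (twist ω π σ) := by
    rw [map_star, ← star_mul, ← star_mul, twist_mul_inr_op]
  have h3 : (π.tensor σ).op t = inrHom L M (σ.op t) * inlHom L M (π.op t) := by
    rw [CyclicRep.tensor_op, opTensor_eq, (commute_inl_inr _ _).eq]
  rw [h3, star_mul, ← map_star (inrHom L M), ← map_star (inlHom L M), π.isUnitaryFamily.star]
  calc _ = inrHom L M (σ.op t) * (inlHom L M (π.op t) * rightOp ω π σ y) *
          (inlHom L M (π.op (-t)) * inrHom L M (star (σ.op t))) := by simp only [mul_assoc]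
    _ = inrHom L M (σ.op t) * rightOp ω π σ y * (inlHom L M (π.op t) * inlHom L M (π.op (-t))) *
          inrHom L M (star (σ.op t)) := by rw [h1]; simp only [mul_assoc]
    _ = inrHom L M (σ.op t) * (twist ω π σ * inrHom L M y *
          (star (twist ω π σ) * inrHom L M (star (σ.op t)))) := by
        rw [← map_mul (inlHom L M), π.isUnitaryFamily.mul_neg, map_one, mul_one, rightOp_eq hω]
        simp only [mul_assoc]
    _ = inrHom L M (σ.op t) * twist ω π σ * inrHom L M y * inrHom L M (star (σ.op t)) *
          star (twist ω π σ) := by rw [h2]; simp only [mul_assoc]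
    _ = _ := by
        rw [← twist_mul_inr_op, rightOp_eq hω, map_mul, map_mul]
        simp only [mul_assoc]

variable {X Y : Type*} [CStarAlgebra X] [CStarAlgebra Y] {ρ : CyclicCoaction N X}
  {τ : CyclicCoaction N Y}

/-- Homomorphisms of C*-algebras are continuous, so the preimage of a closed subalgebra is closed
and only the generators need checking. -/
theorem braidedTensor_map_mem {π : CyclicRep N L} {σ : CyclicRep N M}
    {X : StarSubalgebra ℂ (L →L[ℂ] L)} {Y : StarSubalgebra ℂ (M →L[ℂ] M)} {D : Type*}
    [CStarAlgebra D] (S : StarSubalgebra ℂ D) (hS : IsClosed (S : Set D))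
    (f : (HTensor L M →L[ℂ] HTensor L M) →⋆ₐ[ℂ] D) (hX : ∀ a ∈ X, f (leftOp M a) ∈ S)
    (hY : ∀ b ∈ Y, f (rightOp ω π σ b) ∈ S) : ∀ a ∈ braidedTensor ω π σ X Y, f a ∈ S := by
  suffices h : braidedTensor ω π σ X Y ≤ S.comap f from fun a ha => h ha
  refine StarSubalgebra.topologicalClosure_minimal (StarAlgebra.adjoin_le ?_)
    (hS.preimage (continuous_starAlgHom f))
  rintro _ (⟨a, ha, rfl⟩ | ⟨b, hb, rfl⟩)
  · exact hX a ha
  · exact hY b hb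

/-- The braided tensor product is invariant under the diagonal action. -/
theorem conj_mem_boxTensor (hω : IsPrimitiveRoot ω N) (r : EquivariantRep ρ L)
    (s : EquivariantRep τ M) (t : ZMod N) {a : HTensor L M →L[ℂ] HTensor L M}
    (ha : a ∈ boxTensor ω r s) :
    (r.rep.tensor s.rep).op t * a * star ((r.rep.tensor s.rep).op t) ∈ boxTensor ω r s := by
  have hU := (r.rep.tensor s.rep).isUnitaryFamily
  have h1 : star ((r.rep.tensor s.rep).op t) * (r.rep.tensor s.rep).op t = 1 := by
    rw [hU.star, hU.neg_mul]
  have h2 : (r.rep.tensor s.rep).op t * star ((r.rep.tensor s.rep).op t) = 1 := by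
    rw [hU.star, hU.mul_neg]
  have key := braidedTensor_map_mem (boxTensor ω r s) (StarSubalgebra.isClosed_topologicalClosure _)
    (conjHom (StarAlgHom.id ℂ (HTensor L M →L[ℂ] HTensor L M)) _ h1 h2)
    (π := r.rep) (σ := s.rep) (X := r.hom.range) (Y := s.hom.range) (ω := ω)
    (fun a ha => by
      obtain ⟨x, rfl⟩ := ha
      have hx := conj_leftOp r.rep s.rep t (r.hom x)
      rw [← r.equivariant] at hx
      have hm : leftOp M (r.hom (ρ.hom x t)) ∈ boxTensor ω r s := (j₁ ω r s (ρ.hom x t)).2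
      rw [← hx] at hm
      exact hm)
    (fun a ha => by
      obtain ⟨y, rfl⟩ := ha
      have hy := conj_rightOp hω r.rep s.rep t (s.hom y)
      rw [← s.equivariant] at hy
      have hm : rightOp ω r.rep s.rep (s.hom (τ.hom y t)) ∈ boxTensor ω r s :=
        (j₂ ω r s (τ.hom y t)).2
      rw [← hy] at hm
      exact hm)
  exact key a ha

/-- The diagonal action on the braided tensor product. -/
def diagonalAction (hω : IsPrimitiveRoot ω N) (r : EquivariantRep ρ L) (s : EquivariantRep τ M)
    (k : ZMod N) (a : boxTensor ω r s) : boxTensor ω r s :=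
  ⟨_, conj_mem_boxTensor hω r s (-k) a.2⟩

theorem diagonalAction_implements (hω : IsPrimitiveRoot ω N) (r : EquivariantRep ρ L)
    (s : EquivariantRep τ M) :
    Implements (r.rep.tensor s.rep) (boxTensor ω r s).subtype (diagonalAction hω r s) :=
  fun _ _ => rfl

end Homogeneous

/-! ### The comultiplication of the free unitary algebra. -/

section FreeUnitaryComult

variable {N : ℕ} [NeZero N] {ω : ℂ} {M : Type*}
  [NormedAddCommGroup M] [InnerProductSpace ℂ M] [CompleteSpace M]

theorem hom_u_isHomogeneous (hω : IsPrimitiveRoot ω N)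
    (s : EquivariantRep (freeUnitaryCoaction hω) M) (i j : ZMod N) :
    IsHomogeneous ω s.rep (j - i) (s.hom (FreeUnitary.u N ω i j)) := by
  rw [isHomogeneous_iff]
  intro t
  rw [← s.equivariant, freeUnitaryCoaction_u, map_smul]

/-- The embedding `j₁` of `FreeUnitary` in its braided square. -/
abbrev squareLeft (hω : IsPrimitiveRoot ω N) (s : EquivariantRep (freeUnitaryCoaction hω) M) :
    FreeUnitary N ω →⋆ₐ[ℂ] boxTensor ω s s :=
  boxLeft ω s.rep s.rep s.hom s.hom.range

/-- The embedding `j₂` of `FreeUnitary` in its braided square. -/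
abbrev squareRight (hω : IsPrimitiveRoot ω N) (s : EquivariantRep (freeUnitaryCoaction hω) M) :
    FreeUnitary N ω →⋆ₐ[ℂ] boxTensor ω s s :=
  boxRight hω s.rep s.rep s.hom.range s.hom.range s.hom fun x => ⟨x, rfl⟩

theorem squareRight_apply (hω : IsPrimitiveRoot ω N) (s : EquivariantRep (freeUnitaryCoaction hω) M)
    (x : FreeUnitary N ω) : squareRight hω s x = j₂ ω s s x := boxRight_apply _ _ _ _ _ _ _ _

/-- On the homogeneous u_kl the action by the degree of u_ij is a scalar, so `leftOp_mul_rightOp`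
becomes commutation up to a phase. -/
theorem squareRight_mul_squareLeft (hω : IsPrimitiveRoot ω N)
    (s : EquivariantRep (freeUnitaryCoaction hω) M) (i j k l : ZMod N) :
    squareLeft hω s (FreeUnitary.u N ω i j) * squareRight hω s (FreeUnitary.u N ω k l) =
      rootPow ω ((j - i) * (l - k)) •
        (squareRight hω s (FreeUnitary.u N ω k l) * squareLeft hω s (FreeUnitary.u N ω i j)) := by
  have hx := hom_u_isHomogeneous hω s i j
  have hy := hom_u_isHomogeneous hω s k l
  refine Subtype.ext ?_
  change leftOp M (s.hom _) * rightHom hω s.rep s.rep (s.hom _) =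
    _ • (rightHom hω s.rep s.rep (s.hom _) * leftOp M (s.hom _))
  rw [rightHom_apply, leftOp_mul_rightOp hω s.rep hx, (isHomogeneous_iff _ _ _).mp hy,
    ← rightHom_apply hω, map_smul, smul_mul_assoc, rightHom_apply]

/-- The matrix `(∑ k, j₁(u_ik) j₂(u_kj))`. -/
def comultMatrix (hω : IsPrimitiveRoot ω N) (s : EquivariantRep (freeUnitaryCoaction hω) M) :
    Matrix (ZMod N) (ZMod N) (boxTensor ω s s) :=
  (FreeUnitary.u N ω).map (squareLeft hω s) * (FreeUnitary.u N ω).map (squareRight hω s)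

/-- The twisted conjugate is again a product of the two twisted conjugates: adjoints reverse the
factors, and the braiding phase restores their order. The exponents match because -i(j-i) -
(k-i)(j-k) = -i(k-i) - k(j-k). -/
theorem comultMatrix_isAnyonicUnitary (hω : IsPrimitiveRoot ω N)
    (s : EquivariantRep (freeUnitaryCoaction hω) M) : IsAnyonicUnitary ω (comultMatrix hω s) := by
  have h1 := (FreeUnitary.isAnyonicUnitary N ω).map (squareLeft hω s)
  have h2 := (FreeUnitary.isAnyonicUnitary N ω).map (squareRight hω s)
  refine ⟨mul_mem h1.1 h2.1, ?_⟩
  have h3 : conjMatrix ω (comultMatrix hω s) =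
      conjMatrix ω ((FreeUnitary.u N ω).map (squareLeft hω s)) *
        conjMatrix ω ((FreeUnitary.u N ω).map (squareRight hω s)) := by
    ext1 i j
    simp only [conjMatrix, comultMatrix, Matrix.of_apply, Matrix.mul_apply, Matrix.map_apply,
      star_sum, Finset.smul_sum]
    refine Finset.sum_congr rfl fun k _ => ?_
    rw [squareRight_mul_squareLeft, star_smul, star_mul, star_rootPow hω, smul_smul,
      smul_mul_smul_comm, ← rootPow_add hω, ← rootPow_add hω]
    congr 2
    ring
  rw [h3]
  exact mul_mem h1.2 h2.2

/-- The comultiplication of `FreeUnitary`. -/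
def freeUnitaryComult (hω : IsPrimitiveRoot ω N) (s : EquivariantRep (freeUnitaryCoaction hω) M) :
    FreeUnitary N ω →⋆ₐ[ℂ] boxTensor ω s s :=
  FreeUnitary.lift ω (comultMatrix hω s) (comultMatrix_isAnyonicUnitary hω s)

theorem freeUnitaryComult_u (hω : IsPrimitiveRoot ω N)
    (s : EquivariantRep (freeUnitaryCoaction hω) M) (i j : ZMod N) :
    freeUnitaryComult hω s (FreeUnitary.u N ω i j) =
      ∑ k, squareLeft hω s (FreeUnitary.u N ω i k) * squareRight hω s (FreeUnitary.u N ω k j) := by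
  rw [freeUnitaryComult, FreeUnitary.lift_u]
  rfl

theorem freeUnitaryComult_u_isHomogeneous (hω : IsPrimitiveRoot ω N)
    (s : EquivariantRep (freeUnitaryCoaction hω) M) (i j : ZMod N) :
    IsHomogeneous ω (s.rep.tensor s.rep) (j - i)
      (freeUnitaryComult hω s (FreeUnitary.u N ω i j)).1 := by
  rw [freeUnitaryComult_u]
  have hsum : ∀ f : ZMod N → boxTensor ω s s, (∑ k, f k).1 = ∑ k, (f k).1 := fun f =>
    map_sum (boxTensor ω s s).subtype _ _
  rw [hsum]
  refine IsHomogeneous.sum _ fun k _ => ?_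
  have h1 : IsHomogeneous ω (s.rep.tensor s.rep) (k - i)
      (squareLeft hω s (FreeUnitary.u N ω i k)).1 := by
    have := (hom_u_isHomogeneous hω s i k).opTensor hω (isHomogeneous_one s.rep)
    rwa [add_zero] at this
  have h2 : IsHomogeneous ω (s.rep.tensor s.rep) (j - k)
      (squareRight hω s (FreeUnitary.u N ω k j)).1 := by
    have hy := hom_u_isHomogeneous hω s k j
    -- Here j₂(y) is the representation operator at -(j-k), of degree 0, tensored with y.
    have := (isHomogeneous_op (ω := ω) s.rep (-(j - k))).opTensor hω hy
    rwa [zero_add, ← rightOp_of_isHomogeneous hω s.rep hy, ← rightHom_apply hω] at this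
  have h3 := h1.mul hω h2
  have : k - i + (j - k) = j - i := by ring
  rwa [this] at h3

/-- Both sides are homomorphisms in x. On u_ij each summand has degree (k-i) + (j-k) = j-i, so
conjugation is the phase of the coaction. -/
theorem freeUnitaryComult_equivariant (hω : IsPrimitiveRoot ω N)
    (s : EquivariantRep (freeUnitaryCoaction hω) M) (t : ZMod N) (x : FreeUnitary N ω) :
    (freeUnitaryComult hω s ((freeUnitaryCoaction hω).hom x t)).1 =
      (s.rep.tensor s.rep).op t * (freeUnitaryComult hω s x).1 *
        star ((s.rep.tensor s.rep).op t) := by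
  have hU := (s.rep.tensor s.rep).isUnitaryFamily
  let f := (boxTensor ω s s).subtype.comp (freeUnitaryComult hω s)
  have key : f.comp ((evalAt _ t).comp (freeUnitaryCoaction hω).hom) =
      conjHom f ((s.rep.tensor s.rep).op t) (by rw [hU.star, hU.neg_mul])
        (by rw [hU.star, hU.mul_neg]) := by
    refine FreeUnitary.hom_ext ω fun i j => ?_
    rw [StarAlgHom.comp_apply, StarAlgHom.comp_apply, StarAlgHom.comp_apply, evalAt_apply,
      freeUnitaryCoaction_u, map_smul, map_smul, conjHom_apply]
    exact ((isHomogeneous_iff _ _ _).mp (freeUnitaryComult_u_isHomogeneous hω s i j) t).symm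
  exact DFunLike.congr_fun key x

theorem freeUnitaryComult_isFreeUnitaryComult (hω : IsPrimitiveRoot ω N)
    (s : EquivariantRep (freeUnitaryCoaction hω) M) :
    IsFreeUnitaryComult hω s (freeUnitaryComult hω s) := by
  refine ⟨fun i j => ?_, freeUnitaryComult_equivariant hω s⟩
  simp only [freeUnitaryComult_u, squareRight_apply]
  rfl

theorem IsFreeUnitaryComult.eq (hω : IsPrimitiveRoot ω N)
    (s : EquivariantRep (freeUnitaryCoaction hω) M) {Δ Δ' : FreeUnitary N ω →⋆ₐ[ℂ] boxTensor ω s s}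
    (h : IsFreeUnitaryComult hω s Δ) (h' : IsFreeUnitaryComult hω s Δ') : Δ' = Δ :=
  FreeUnitary.hom_ext ω fun i j => (h'.1 i j).trans (h.1 i j).symm

end FreeUnitaryComult

/-! ### The iterated braided product and id ⊠ Δ. -/

section Triple

variable {N : ℕ} [NeZero N] {ω : ℂ} {L M : Type*}
  [NormedAddCommGroup L] [InnerProductSpace ℂ L] [CompleteSpace L]
  [NormedAddCommGroup M] [InnerProductSpace ℂ M] [CompleteSpace M]
  {X : Type*} [CStarAlgebra X] {ρ : CyclicCoaction N X}

/-- The embedding of `X ⊠ X` in `C(ℤ/N) ⊠ (X ⊠ X)`. -/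
abbrev tripleEmbed (hω : IsPrimitiveRoot ω N) (r : EquivariantRep (cyclicCoaction N) L)
    (s : EquivariantRep ρ M) : boxTensor ω s s →⋆ₐ[ℂ] tripleTensor ω r s :=
  boxRight hω r.rep (s.rep.tensor s.rep) r.hom.range (boxTensor ω s s) (boxTensor ω s s).subtype
    fun x => x.2

/-- The embedding of `C(ℤ/N)` in `C(ℤ/N) ⊠ (X ⊠ X)`. -/
abbrev tripleLeft (ω : ℂ) (r : EquivariantRep (cyclicCoaction N) L) (s : EquivariantRep ρ M) :
    (ZMod N → ℂ) →⋆ₐ[ℂ] tripleTensor ω r s :=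
  boxLeft ω r.rep (s.rep.tensor s.rep) r.hom (boxTensor ω s s)

theorem tripleEmbed_apply (hω : IsPrimitiveRoot ω N) (r : EquivariantRep (cyclicCoaction N) L)
    (s : EquivariantRep ρ M) (x : boxTensor ω s s) :
    tripleEmbed hω r s x = braidedTensor.right x :=
  boxRight_apply _ _ _ _ _ _ _ _

theorem tripleEmbed_isCovariant (hω : IsPrimitiveRoot ω N)
    (r : EquivariantRep (cyclicCoaction N) L) (s : EquivariantRep ρ M) :
    IsCovariant (diagonalAction hω s s) (tripleEmbed hω r s)
      fun k => tripleLeft ω r s (character ω k) :=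
  boxRight_isCovariant hω (diagonalAction_implements hω s s) _

/-- The crossed product description applies to Y = X ⊠ X, represented by its inclusion and acted on
diagonally. -/
theorem tripleEmbed_bijective (hω : IsPrimitiveRoot ω N)
    (r : EquivariantRep (cyclicCoaction N) L) (s : EquivariantRep ρ M) :
    Function.Bijective (crossedSum (tripleEmbed hω r s)
      fun k => tripleLeft ω r s (character ω k)) :=
  crossedSum_box_bijective hω (diagonalAction_implements hω s s) Subtype.val_injective _
    fun a ha => ⟨⟨a, ha⟩, rfl⟩

/-- Equivariance of Δ converts covariance for the diagonal action on X ⊠ X into covariance for the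
coaction on X. -/
theorem idBox_isCovariant (hω : IsPrimitiveRoot ω N) (r : EquivariantRep (cyclicCoaction N) L)
    (s : EquivariantRep (freeUnitaryCoaction hω) M) :
    IsCovariant (fun k x => (freeUnitaryCoaction hω).hom x (-k))
      ((tripleEmbed hω r s).comp (freeUnitaryComult hω s))
      fun k => tripleLeft ω r s (character ω k) where
  family := (tripleEmbed_isCovariant hω r s).family
  comm k x := by
    rw [StarAlgHom.comp_apply, (tripleEmbed_isCovariant hω r s).comm, StarAlgHom.comp_apply]
    congr 2
    exact Subtype.ext (freeUnitaryComult_equivariant hω s (-k) x).symm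

/-- The homomorphism `id ⊠ Δ`. -/
def idBoxComult (hω : IsPrimitiveRoot ω N) (r : EquivariantRep (cyclicCoaction N) L)
    (s : EquivariantRep (freeUnitaryCoaction hω) M) : boxTensor ω r s →⋆ₐ[ℂ] tripleTensor ω r s :=
  crossedLift (boxEmbed_isCovariant hω r s) (boxEmbed_bijective hω r s) (idBox_isCovariant hω r s)

theorem idBoxComult_apply (hω : IsPrimitiveRoot ω N) (r : EquivariantRep (cyclicCoaction N) L)
    (s : EquivariantRep (freeUnitaryCoaction hω) M) (f : ZMod N → ℂ) (x : FreeUnitary N ω) :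
    idBoxComult hω r s (j₁ ω r s f * j₂ ω r s x) =
      braidedTensor.left (r.hom.rangeRestrict f) *
        braidedTensor.right (freeUnitaryComult hω s x) := by
  have h1 : idBoxComult hω r s (boxLeft ω r.rep s.rep r.hom s.hom.range f) =
      tripleLeft ω r s f := by
    obtain ⟨a, rfl⟩ := character_fourier hω f
    simp only [map_sum, map_smul]
    refine Finset.sum_congr rfl fun k _ => ?_
    rw [idBoxComult, crossedLift_family]
  rw [map_mul, ← boxEmbed_apply hω, ← tripleEmbed_apply hω r s]
  refine congrArg₂ (· * ·) h1 ?_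
  rw [idBoxComult, crossedLift_hom, StarAlgHom.comp_apply]

end Triple

/-! ### Rearranging four tensor factors. -/

section Shuffle

variable {L L' M M' : Type*}
  [NormedAddCommGroup L] [InnerProductSpace ℂ L] [NormedAddCommGroup L'] [InnerProductSpace ℂ L']
  [NormedAddCommGroup M] [InnerProductSpace ℂ M] [NormedAddCommGroup M'] [InnerProductSpace ℂ M']

variable (L L' M M') in
/-- The embedding of the algebraic tensor product of four spaces in the completed one. -/
def tensorEmb₄ : (L ⊗[ℂ] L') ⊗[ℂ] (M ⊗[ℂ] M') →ₗᵢ[ℂ] HTensor (HTensor L L') (HTensor M M') :=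
  (tensorEmb (HTensor L L') (HTensor M M')).comp
    (TensorProduct.mapIsometry (tensorEmb L L') (tensorEmb M M'))

theorem continuous_vecTensor : Continuous fun p : L × M => vecTensor p.1 p.2 :=
  (LinearMap.mkContinuous₂ (vecTensorₗ (L := L) (M := M)) 1 fun ξ η => by
    rw [vecTensorₗ_apply, norm_vecTensor, one_mul]).continuous₂

/-- Elementary tensors depend jointly continuously on their factors, so those of completed vectors
are limits of those of algebraic ones; their span is dense. -/
theorem denseRange_tensorEmb₄ : DenseRange (tensorEmb₄ L L' M M') := by
  let S : Submodule ℂ (HTensor (HTensor L L') (HTensor M M')) :=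
    (LinearMap.range (tensorEmb₄ L L' M M').toLinearMap).topologicalClosure
  have hS : IsClosed (S : Set (HTensor (HTensor L L') (HTensor M M'))) :=
    Submodule.isClosed_topologicalClosure _
  have h1 : ∀ x y, vecTensor x y ∈ S := fun x y => by
    refine map_mem_closure₂ (s := Set.range (tensorEmb L L')) (t := Set.range (tensorEmb M M'))
      continuous_vecTensor (denseRange_tensorEmb x) (denseRange_tensorEmb y) ?_
    rintro _ ⟨a, rfl⟩ _ ⟨b, rfl⟩
    exact ⟨a ⊗ₜ b, rfl⟩
  have h2 : ∀ x, tensorEmb (HTensor L L') (HTensor M M') x ∈ S := fun x => by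
    induction x using TensorProduct.induction_on with
    | zero => rw [map_zero]; exact S.zero_mem
    | tmul a b => exact h1 a b
    | add a b ha hb => rw [map_add]; exact S.add_mem ha hb
  intro x
  exact closure_minimal (Set.range_subset_iff.mpr h2) hS (denseRange_tensorEmb x)

/-- Bounded operators that agree on tensors of elementary tensors are equal. -/
theorem op_ext₄ {K : Type*} [NormedAddCommGroup K] [InnerProductSpace ℂ K]
    {S T : HTensor (HTensor L L') (HTensor M M') →L[ℂ] K}
    (h : ∀ a b c d, S (vecTensor (vecTensor a b) (vecTensor c d)) =
      T (vecTensor (vecTensor a b) (vecTensor c d))) : S = T := by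
  have key : S.toLinearMap.comp (tensorEmb₄ L L' M M').toLinearMap =
      T.toLinearMap.comp (tensorEmb₄ L L' M M').toLinearMap :=
    TensorProduct.ext_fourfold' h
  exact DFunLike.coe_injective (denseRange_tensorEmb₄.equalizer S.continuous T.continuous
    (funext fun x => LinearMap.congr_fun key x))

variable (L L' M M') in
/-- The isometry `(a ⊗ b) ⊗ (c ⊗ d) ↦ (a ⊗ c) ⊗ (b ⊗ d)` of algebraic tensor products. -/
def shuffleIsometry : (L ⊗[ℂ] L') ⊗[ℂ] (M ⊗[ℂ] M') ≃ₗᵢ[ℂ] (L ⊗[ℂ] M) ⊗[ℂ] (L' ⊗[ℂ] M') :=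
  ((TensorProduct.assocIsometry ℂ L L' (M ⊗[ℂ] M')).trans
    (LinearIsometryEquiv.lTensor L
      (((TensorProduct.assocIsometry ℂ L' M M').symm.trans
        (LinearIsometryEquiv.rTensor M' (TensorProduct.commIsometry ℂ L' M))).trans
          (TensorProduct.assocIsometry ℂ M L' M')))).trans
      (TensorProduct.assocIsometry ℂ L M (L' ⊗[ℂ] M')).symm

variable (L L' M M') in
/-- The unitary `(a ⊗ b) ⊗ (c ⊗ d) ↦ (a ⊗ c) ⊗ (b ⊗ d)`. -/
def shuffle : HTensor (HTensor L L') (HTensor M M') ≃ₗᵢ[ℂ] HTensor (HTensor L M) (HTensor L' M') :=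
  LinearEquiv.extendOfIsometry (shuffleIsometry L L' M M').toLinearEquiv
    (tensorEmb₄ L L' M M').toLinearMap (tensorEmb₄ L M L' M').toLinearMap denseRange_tensorEmb₄
    denseRange_tensorEmb₄ fun x => by
      change ‖tensorEmb₄ L M L' M' (shuffleIsometry L L' M M' x)‖ = ‖tensorEmb₄ L L' M M' x‖
      rw [LinearIsometry.norm_map, LinearIsometry.norm_map, LinearIsometryEquiv.norm_map]

theorem shuffle_vecTensor (a : L) (b : L') (c : M) (d : M') :
    shuffle L L' M M' (vecTensor (vecTensor a b) (vecTensor c d)) =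
      vecTensor (vecTensor a c) (vecTensor b d) := by
  have h := LinearEquiv.extendOfIsometry_eq (shuffleIsometry L L' M M').toLinearEquiv
    (tensorEmb₄ L L' M M').toLinearMap (tensorEmb₄ L M L' M').toLinearMap denseRange_tensorEmb₄
    denseRange_tensorEmb₄ (fun x => by
      change ‖tensorEmb₄ L M L' M' (shuffleIsometry L L' M M' x)‖ = ‖tensorEmb₄ L L' M M' x‖
      rw [LinearIsometry.norm_map, LinearIsometry.norm_map, LinearIsometryEquiv.norm_map])
    ((a ⊗ₜ b) ⊗ₜ (c ⊗ₜ d))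
  exact h

/-- By `op_ext₄` it suffices to test on tensors of elementary tensors. This identifies operators on
M ⊗ M with operators on legs 2 and 4. -/
theorem shuffle_conj (S : L →L[ℂ] L) (S' : L' →L[ℂ] L') (T : M →L[ℂ] M) (T' : M' →L[ℂ] M') :
    (shuffle L L' M M').conjStarAlgEquiv (opTensor (opTensor S S') (opTensor T T')) =
      opTensor (opTensor S T) (opTensor S' T') := by
  refine op_ext₄ fun a b c d => ?_
  rw [LinearIsometryEquiv.conjStarAlgEquiv_apply_apply]
  have h : (shuffle L L' M M').symm (vecTensor (vecTensor a b) (vecTensor c d)) =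
      vecTensor (vecTensor a c) (vecTensor b d) := by
    rw [LinearIsometryEquiv.symm_apply_eq, shuffle_vecTensor]
  rw [h]
  simp only [opTensor_vecTensor, shuffle_vecTensor]

end Shuffle

/-! ### Coactions written through the point functions δ_t. -/

section DeltaSum

variable {N : ℕ} [NeZero N] {ω : ℂ} {H K : Type*}
  [NormedAddCommGroup H] [InnerProductSpace ℂ H] [CompleteSpace H]
  [NormedAddCommGroup K] [InnerProductSpace ℂ K] [CompleteSpace K]
  {X Y : Type*} [CStarAlgebra X] [CStarAlgebra Y]

omit [NeZero N] in
theorem single_mul_single_one (s t : ZMod N) :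
    (Pi.single s 1 * Pi.single t 1 : ZMod N → ℂ) = if s = t then Pi.single s 1 else 0 := by
  by_cases h : s = t
  · subst h
    rw [if_pos rfl, ← Pi.single_mul, one_mul]
  · rw [if_neg h]
    funext r
    rw [Pi.mul_apply]
    by_cases hr : r = s
    · subst hr
      rw [Pi.single_eq_of_ne h, mul_zero]; rfl
    · rw [Pi.single_eq_of_ne hr, zero_mul]; rfl

theorem sum_single_one (f : ZMod N → ℂ) : ∑ t, f t • (Pi.single t 1 : ZMod N → ℂ) = f := by
  funext r
  rw [Finset.sum_apply, Finset.sum_eq_single r]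
  · simp
  · intro t _ ht
    simp [Pi.single_eq_of_ne (Ne.symm ht)]
  · simp

/-- The homomorphism `x ↦ ∑ t, F(x)(t) ⊗ e(δ_t)`. -/
def deltaSum (F : X →⋆ₐ[ℂ] (ZMod N → X)) (f : X →⋆ₐ[ℂ] (H →L[ℂ] H))
    (e : (ZMod N → ℂ) →⋆ₐ[ℂ] (K →L[ℂ] K)) : X →⋆ₐ[ℂ] (HTensor H K →L[ℂ] HTensor H K) where
  toFun x := ∑ t, opTensor (f (F x t)) (e (Pi.single t 1))
  map_one' := by
    simp only [map_one, Pi.one_apply]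
    rw [← opTensor_sum_right, ← map_sum]
    have := sum_single_one (1 : ZMod N → ℂ)
    simp only [Pi.one_apply, one_smul] at this
    rw [this, map_one, opTensor_one]
  map_mul' x y := by
    rw [Finset.sum_mul_sum]
    refine Finset.sum_congr rfl fun t _ => ?_
    -- Distinct δ_s and δ_t multiply to zero, so the double sum is diagonal.
    rw [Finset.sum_eq_single t]
    · rw [opTensor_mul, ← map_mul, ← map_mul, single_mul_single_one, if_pos rfl, map_mul]; rfl
    · intro s _ hs
      rw [opTensor_mul, ← map_mul e, single_mul_single_one, if_neg (Ne.symm hs), map_zero,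
        opTensor_zero_right]
    · simp
  map_zero' := by
    refine Finset.sum_eq_zero fun t _ => ?_
    rw [map_zero, Pi.zero_apply, map_zero, ← opTensorₗ_apply, map_zero, LinearMap.zero_apply]
  map_add' x y := by
    rw [← Finset.sum_add_distrib]
    refine Finset.sum_congr rfl fun t _ => ?_
    rw [map_add, Pi.add_apply, map_add, opTensor_add_left]
  commutes' c := by
    have h1 : ∀ t, f (F (algebraMap ℂ X c) t) = c • 1 := fun t => by
      rw [AlgHomClass.commutes, Pi.algebraMap_apply, AlgHomClass.commutes,
        Algebra.algebraMap_eq_smul_one]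
    simp only [h1, opTensor_smul_left]
    rw [← Finset.smul_sum, ← opTensor_sum_right, ← map_sum]
    have := sum_single_one (1 : ZMod N → ℂ)
    simp only [Pi.one_apply, one_smul] at this
    rw [this, map_one, opTensor_one, Algebra.algebraMap_eq_smul_one]
  map_star' x := by
    rw [star_sum]
    refine Finset.sum_congr rfl fun t _ => ?_
    have h1 : star (Pi.single t 1 : ZMod N → ℂ) = Pi.single t 1 := by
      rw [← Pi.single_star, star_one]
    rw [opTensor_star, ← map_star, ← map_star, h1, map_star]
    rfl

theorem deltaSum_apply (F : X →⋆ₐ[ℂ] (ZMod N → X)) (f : X →⋆ₐ[ℂ] (H →L[ℂ] H))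
    (e : (ZMod N → ℂ) →⋆ₐ[ℂ] (K →L[ℂ] K)) (x : X) :
    deltaSum F f e x = ∑ t, opTensor (f (F x t)) (e (Pi.single t 1)) := rfl

/-- The phases assemble with the point functions into ∑ ω^(td) δ_t = z^d. -/
theorem deltaSum_of_homogeneous (F : X →⋆ₐ[ℂ] (ZMod N → X)) (f : X →⋆ₐ[ℂ] (H →L[ℂ] H))
    (e : (ZMod N → ℂ) →⋆ₐ[ℂ] (K →L[ℂ] K)) {x : X} {d : ZMod N}
    (hx : ∀ t, F x t = rootPow ω (t * d) • x) :
    deltaSum F f e x = opTensor (f x) (e (character ω d)) := by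
  have h : ∀ t, opTensor (f (F x t)) (e (Pi.single t 1)) =
      opTensor (f x) (e (rootPow ω (d * t) • Pi.single t 1)) := fun t => by
    rw [hx, map_smul, map_smul, opTensor_smul_left, opTensor_smul_right, mul_comm]
  rw [deltaSum_apply, Finset.sum_congr rfl fun t _ => h t, ← opTensor_sum_right, ← map_sum]
  congr 2
  exact sum_single_one (character ω d)

theorem deltaSum_mem (F : X →⋆ₐ[ℂ] (ZMod N → X)) (f : X →⋆ₐ[ℂ] (H →L[ℂ] H))
    (e : (ZMod N → ℂ) →⋆ₐ[ℂ] (K →L[ℂ] K)) {S : StarSubalgebra ℂ (H →L[ℂ] H)}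
    {T : StarSubalgebra ℂ (K →L[ℂ] K)} (hf : ∀ x, f x ∈ S) (he : ∀ x, e x ∈ T) (x : X) :
    deltaSum F f e x ∈ spatialTensor S T :=
  sum_mem fun _ _ => StarSubalgebra.le_topologicalClosure _
    (StarAlgebra.subset_adjoin ℂ _ ⟨_, hf _, _, he _, rfl⟩)

end DeltaSum

/-! ### Word identities for a product of three unitaries. -/

section Monoid

variable {R : Type*} [Monoid R]

/-- In the application u, v, w are the twist on legs 1 and 2, the middle twist on legs 2 and 3, and
the twist on legs 3 and 4. The element x on leg 2 picks up z on leg 3 from v and p on leg 1 from u.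
-/
theorem conj_first_leg {u v w x p z : R} (h1 : w * x = x * w) (h2 : v * x = x * z * v)
    (h3 : u * x = x * p * u) (h4 : u * z = z * u) : u * v * w * x = x * p * z * (u * v * w) := by
  calc u * v * w * x = u * (v * x) * w := by rw [mul_assoc, h1]; simp only [mul_assoc]
    _ = u * x * z * v * w := by rw [h2]; simp only [mul_assoc]
    _ = x * p * (u * z) * v * w := by rw [h3]; simp only [mul_assoc]
    _ = _ := by rw [h4]; simp only [mul_assoc]

/-- Passing y on leg 4 through w creates q on leg 3; then v absorbs c from leg 2, since v(cq) = qv.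
-/
theorem conj_second_leg {u v w c y q : R} (h1 : w * c = c * w) (h2 : w * y = y * q * w)
    (h3 : q * v = v * (c * q)) (h4 : u * q = q * u) (h5 : c * y = y * c) (h6 : v * y = y * v)
    (h7 : u * y = y * u) (h8 : q * y = y * q) :
    u * v * w * (c * y) = q * y * (u * v * w) := by
  calc u * v * w * (c * y) = u * v * (w * c) * y := by simp only [mul_assoc]
    _ = u * v * c * (w * y) := by rw [h1]; simp only [mul_assoc]
    _ = u * v * (c * y) * q * w := by rw [h2]; simp only [mul_assoc]
    _ = u * (v * y) * c * q * w := by rw [h5]; simp only [mul_assoc]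
    _ = u * y * (v * (c * q)) * w := by rw [h6]; simp only [mul_assoc]
    _ = y * (u * q) * v * w := by rw [h7, ← h3]; simp only [mul_assoc]
    _ = _ := by rw [h4, h8]; simp only [mul_assoc]

/-- On legs 1 and 3, a leaves c behind when it passes u, and b leaves d behind when it passes w; the
remaining passages are commutations. -/
theorem conj_both_legs {u v w a b c d : R} (h1 : a * u = u * (a * c)) (h2 : b * u = u * b)
    (h3 : a * v = v * a) (h4 : b * v = v * b) (h5 : c * v = v * c) (h6 : a * w = w * a)
    (h7 : b * w = w * (b * d)) (h8 : c * w = w * c) (h9 : b * c = c * b) :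
    a * b * (u * v * w) = u * v * w * (a * b * (c * d)) := by
  calc a * b * (u * v * w) = a * (b * u) * v * w := by simp only [mul_assoc]
    _ = a * u * (b * v) * w := by rw [h2]; simp only [mul_assoc]
    _ = u * a * (c * v) * (b * w) := by rw [h1, h4]; simp only [mul_assoc]
    _ = u * (a * v) * (c * w) * b * d := by rw [h5, h7]; simp only [mul_assoc]
    _ = u * v * (a * w) * c * b * d := by rw [h3, h8]; simp only [mul_assoc]
    _ = u * v * w * a * (b * c) * d := by rw [h6, h9]; simp only [mul_assoc]
    _ = _ := by simp only [mul_assoc]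

end Monoid

/-! ### The unitary implementing ψ on the braided square. -/

section Implementation

variable {N : ℕ} [NeZero N] {ω : ℂ} {L M : Type*}
  [NormedAddCommGroup L] [InnerProductSpace ℂ L] [CompleteSpace L]
  [NormedAddCommGroup M] [InnerProductSpace ℂ M] [CompleteSpace M]

/-- Conjugation by an isometric isomorphism. -/
def isometryConj (e : L ≃ₗᵢ[ℂ] M) : (L →L[ℂ] L) →⋆ₐ[ℂ] (M →L[ℂ] M) where
  toFun a := e.conjStarAlgEquiv a
  map_one' := map_one _
  map_mul' := map_mul _
  map_zero' := map_zero _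
  map_add' := map_add _
  commutes' := AlgHomClass.commutes _
  map_star' := map_star _

variable (L M) in
/-- Operators on the first factor of `(L ⊗ M) ⊗ (L ⊗ M)`. -/
def leg₁ : (L →L[ℂ] L) →⋆ₐ[ℂ]
    (HTensor (HTensor L M) (HTensor L M) →L[ℂ] HTensor (HTensor L M) (HTensor L M)) :=
  (inlHom (HTensor L M) (HTensor L M)).comp (inlHom L M)

variable (L M) in
/-- Operators on the second factor of `(L ⊗ M) ⊗ (L ⊗ M)`. -/
def leg₂ : (M →L[ℂ] M) →⋆ₐ[ℂ]
    (HTensor (HTensor L M) (HTensor L M) →L[ℂ] HTensor (HTensor L M) (HTensor L M)) :=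
  (inlHom (HTensor L M) (HTensor L M)).comp (inrHom L M)

variable (L M) in
/-- Operators on the third factor of `(L ⊗ M) ⊗ (L ⊗ M)`. -/
def leg₃ : (L →L[ℂ] L) →⋆ₐ[ℂ]
    (HTensor (HTensor L M) (HTensor L M) →L[ℂ] HTensor (HTensor L M) (HTensor L M)) :=
  (inrHom (HTensor L M) (HTensor L M)).comp (inlHom L M)

variable (L M) in
/-- Operators on the fourth factor of `(L ⊗ M) ⊗ (L ⊗ M)`. -/
def leg₄ : (M →L[ℂ] M) →⋆ₐ[ℂ]
    (HTensor (HTensor L M) (HTensor L M) →L[ℂ] HTensor (HTensor L M) (HTensor L M)) :=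
  (inrHom (HTensor L M) (HTensor L M)).comp (inrHom L M)

variable (L M) in
/-- Operators on `M ⊗ M`, acting on the second and fourth factors of `(L ⊗ M) ⊗ (L ⊗ M)`. -/
def leg₂₄ : (HTensor M M →L[ℂ] HTensor M M) →⋆ₐ[ℂ]
    (HTensor (HTensor L M) (HTensor L M) →L[ℂ] HTensor (HTensor L M) (HTensor L M)) :=
  (isometryConj (shuffle L L M M)).comp (inrHom (HTensor L L) (HTensor M M))

theorem leg₁_apply (a : L →L[ℂ] L) : leg₁ L M a = inlHom _ _ (inlHom L M a) := rfl

theorem leg₂_apply (a : M →L[ℂ] M) : leg₂ L M a = inlHom _ _ (inrHom L M a) := rfl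

theorem leg₃_apply (a : L →L[ℂ] L) : leg₃ L M a = inrHom _ _ (inlHom L M a) := rfl

theorem leg₄_apply (a : M →L[ℂ] M) : leg₄ L M a = inrHom _ _ (inrHom L M a) := rfl

omit [CompleteSpace L] [CompleteSpace M] in
theorem leg₂₄_apply (T : HTensor M M →L[ℂ] HTensor M M) :
    leg₂₄ L M T = (shuffle L L M M).conjStarAlgEquiv (inrHom (HTensor L L) (HTensor M M) T) := rfl

theorem commute_leg₁_inr (a : L →L[ℂ] L) (T : HTensor L M →L[ℂ] HTensor L M) :
    Commute (leg₁ L M a) (inrHom (HTensor L M) (HTensor L M) T) := by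
  rw [leg₁_apply]
  exact commute_inl_inr (inlHom L M a) T

theorem commute_leg₂_inr (a : M →L[ℂ] M) (T : HTensor L M →L[ℂ] HTensor L M) :
    Commute (leg₂ L M a) (inrHom (HTensor L M) (HTensor L M) T) := by
  rw [leg₂_apply]
  exact commute_inl_inr (inrHom L M a) T

theorem commute_inl_leg₃ (T : HTensor L M →L[ℂ] HTensor L M) (a : L →L[ℂ] L) :
    Commute (inlHom (HTensor L M) (HTensor L M) T) (leg₃ L M a) := by
  rw [leg₃_apply]
  exact commute_inl_inr T (inlHom L M a)

theorem commute_inl_leg₄ (T : HTensor L M →L[ℂ] HTensor L M) (a : M →L[ℂ] M) :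
    Commute (inlHom (HTensor L M) (HTensor L M) T) (leg₄ L M a) := by
  rw [leg₄_apply]
  exact commute_inl_inr T (inrHom L M a)

theorem commute_leg₁₃ (a b : L →L[ℂ] L) : Commute (leg₁ L M a) (leg₃ L M b) := by
  rw [leg₁_apply]
  exact commute_inl_leg₃ _ b

theorem commute_leg₂₃ (a : M →L[ℂ] M) (b : L →L[ℂ] L) : Commute (leg₂ L M a) (leg₃ L M b) := by
  rw [leg₂_apply]
  exact commute_inl_leg₃ _ b

theorem commute_leg₂_leg₄ (a b : M →L[ℂ] M) : Commute (leg₂ L M a) (leg₄ L M b) := by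
  rw [leg₂_apply]
  exact commute_inl_leg₄ _ b

theorem commute_leg₁₂ (a : L →L[ℂ] L) (b : M →L[ℂ] M) : Commute (leg₁ L M a) (leg₂ L M b) :=
  (commute_inl_inr a b).map (inlHom (HTensor L M) (HTensor L M))

theorem commute_leg₃₄ (a : L →L[ℂ] L) (b : M →L[ℂ] M) : Commute (leg₃ L M a) (leg₄ L M b) :=
  (commute_inl_inr a b).map (inrHom (HTensor L M) (HTensor L M))

theorem leg₂₄_opTensor (a b : M →L[ℂ] M) :
    leg₂₄ L M (opTensor a b) = leg₂ L M a * leg₄ L M b := by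
  have h := shuffle_conj (1 : L →L[ℂ] L) (1 : L →L[ℂ] L) a b
  rw [opTensor_one] at h
  rw [leg₂₄_apply, inrHom_apply, h, opTensor_eq, leg₂_apply, leg₄_apply, inrHom_apply (L := L),
    inrHom_apply (L := L)]

/-- Before the shuffle these operators act on the separate factors L ⊗ L and M ⊗ M; c need not be an
elementary tensor. -/
theorem commute_leg₁₃_leg₂₄ (a b : L →L[ℂ] L) (c : HTensor M M →L[ℂ] HTensor M M) :
    Commute (leg₁ L M a * leg₃ L M b) (leg₂₄ L M c) := by
  have h1 : (shuffle L L M M).conjStarAlgEquiv (inlHom _ _ (opTensor a b)) =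
      leg₁ L M a * leg₃ L M b := by
    have h := shuffle_conj a b (1 : M →L[ℂ] M) (1 : M →L[ℂ] M)
    rw [opTensor_one] at h
    rw [inlHom_apply, h, opTensor_eq, leg₁_apply, leg₃_apply, inlHom_apply (L := L),
      inlHom_apply (L := L)]
  rw [← h1, leg₂₄_apply]
  exact (commute_inl_inr (opTensor a b) c).map (shuffle L L M M).conjStarAlgEquiv

variable {X : Type*} [CStarAlgebra X] {ρ : CyclicCoaction N X}

/-- The unitary `∑ p, P_p ⊗ z ^ p` on the second and third factors. -/
def middleTwist (ω : ℂ) (r : EquivariantRep (cyclicCoaction N) L) (s : EquivariantRep ρ M) :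
    HTensor (HTensor L M) (HTensor L M) →L[ℂ] HTensor (HTensor L M) (HTensor L M) :=
  controlled (fun p => leg₂ L M (spectralProj ω s.rep p))
    fun p => leg₃ L M (r.hom (character ω p))

/-- The unitary on `(L ⊗ M) ⊗ (L ⊗ M)` implementing the comultiplication of the bosonization. -/
def implementer (ω : ℂ) (r : EquivariantRep (cyclicCoaction N) L) (s : EquivariantRep ρ M) :
    HTensor (HTensor L M) (HTensor L M) →L[ℂ] HTensor (HTensor L M) (HTensor L M) :=
  inlHom _ _ (twist ω r.rep s.rep) * middleTwist ω r s * inrHom _ _ (twist ω r.rep s.rep)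

theorem commute_middle (r : EquivariantRep (cyclicCoaction N) L) (s : EquivariantRep ρ M)
    (p q : ZMod N) :
    Commute (leg₂ L M (spectralProj ω s.rep p)) (leg₃ L M (r.hom (character ω q))) :=
  commute_leg₂₃ _ _

theorem middle_projDecomp (hω : IsPrimitiveRoot ω N) (s : EquivariantRep ρ M) :
    IsProjDecomp fun p => leg₂ L M (spectralProj ω s.rep p) :=
  (spectralProj_isProjDecomp hω s.rep).map _

theorem middle_family (hω : IsPrimitiveRoot ω N) (r : EquivariantRep (cyclicCoaction N) L) :
    IsUnitaryFamily fun p => leg₃ L M (r.hom (character ω p)) :=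
  (character_isUnitaryFamily hω).map ((leg₃ L M).comp r.hom)

variable (r : EquivariantRep (cyclicCoaction N) L) (s : EquivariantRep ρ M)

theorem implementer_star_mul (hω : IsPrimitiveRoot ω N) :
    star (implementer ω r s) * implementer ω r s = 1 := by
  have h1 : star (inlHom (HTensor L M) (HTensor L M) (twist ω r.rep s.rep)) *
      inlHom _ _ (twist ω r.rep s.rep) = 1 := by
    rw [← map_star, ← map_mul, twist_star_mul hω, map_one]
  have h2 : star (inrHom (HTensor L M) (HTensor L M) (twist ω r.rep s.rep)) *
      inrHom _ _ (twist ω r.rep s.rep) = 1 := by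
    rw [← map_star, ← map_mul, twist_star_mul hω, map_one]
  have h3 : star (middleTwist ω r s) * middleTwist ω r s = 1 :=
    controlled_star_mul (middle_projDecomp hω s) (middle_family hω r) (commute_middle r s)
  rw [implementer, star_mul, star_mul]
  calc _ = star (inrHom (HTensor L M) (HTensor L M) (twist ω r.rep s.rep)) *
      (star (middleTwist ω r s) * (star (inlHom (HTensor L M) (HTensor L M)
        (twist ω r.rep s.rep)) * inlHom _ _ (twist ω r.rep s.rep)) * middleTwist ω r s) *
          inrHom _ _ (twist ω r.rep s.rep) := by simp only [mul_assoc]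
    _ = 1 := by rw [h1, mul_one, h3, mul_one, h2]

theorem implementer_mul_star (hω : IsPrimitiveRoot ω N) :
    implementer ω r s * star (implementer ω r s) = 1 := by
  have h1 : inlHom (HTensor L M) (HTensor L M) (twist ω r.rep s.rep) *
      star (inlHom _ _ (twist ω r.rep s.rep)) = 1 := by
    rw [← map_star, ← map_mul, twist_mul_star hω, map_one]
  have h2 : inrHom (HTensor L M) (HTensor L M) (twist ω r.rep s.rep) *
      star (inrHom _ _ (twist ω r.rep s.rep)) = 1 := by
    rw [← map_star, ← map_mul, twist_mul_star hω, map_one]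
  have h3 : middleTwist ω r s * star (middleTwist ω r s) = 1 :=
    controlled_mul_star (middle_projDecomp hω s) (middle_family hω r) (commute_middle r s)
  rw [implementer, star_mul, star_mul]
  calc _ = inlHom (HTensor L M) (HTensor L M) (twist ω r.rep s.rep) *
      (middleTwist ω r s * (inrHom (HTensor L M) (HTensor L M)
        (twist ω r.rep s.rep) * star (inrHom _ _ (twist ω r.rep s.rep))) *
          star (middleTwist ω r s)) *
          star (inlHom _ _ (twist ω r.rep s.rep)) := by simp only [mul_assoc]
    _ = 1 := by rw [h2, mul_one, h3, mul_one, h1]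

/-- The middle twist leaves z^d on leg 3 and the first twist leaves π(-d) on leg 1. Together with x
on leg 2 this is j₂(x) ⊗ z^d, the value required by the coaction. -/
theorem implementer_mul_leg₂ (hω : IsPrimitiveRoot ω N) {d : ZMod N} {x : M →L[ℂ] M}
    (hx : IsHomogeneous ω s.rep d x) :
    implementer ω r s * leg₂ L M x =
      leg₂ L M x * leg₁ L M (r.rep.op (-d)) * leg₃ L M (r.hom (character ω d)) *
        implementer ω r s := by
  refine conj_first_leg (commute_leg₂_inr _ _).symm.eq ?_ ?_ (commute_inl_leg₃ _ _).eq
  · exact controlled_mul_of_shift (middle_family hω r) (commute_middle r s)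
      (fun q => by rw [← map_mul, hx.spectralProj_mul hω, map_mul])
      fun q => (commute_leg₂₃ _ _).symm
  · rw [leg₂_apply, leg₁_apply, ← map_mul, twist_mul_inr hω r.rep hx, map_mul, map_mul]

/-- On leg 3, π(d) scales z^q by ω^(dq); against the spectral projections on leg 2 these phases sum
to σ(d). -/
theorem op_mul_middleTwist (hω : IsPrimitiveRoot ω N) (d : ZMod N) :
    leg₃ L M (r.rep.op d) * middleTwist ω r s =
      middleTwist ω r s * (leg₂ L M (s.rep.op d) * leg₃ L M (r.rep.op d)) := by
  have h := mul_controlled_of_scale (c := leg₃ L M (r.rep.op d))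
    (s := fun q => rootPow ω (d * q)) (middle_projDecomp (L := L) hω s)
    (fun q => (commute_leg₂₃ _ _).symm)
    (fun q => by rw [← map_mul, hom_character hω r q d, map_smul, map_mul])
    (commute_middle r s)
  have h' : ∑ q, rootPow ω (d * q) • leg₂ L M (spectralProj ω s.rep q) =
      leg₂ L M (s.rep.op d) := by
    rw [← sum_smul_spectralProj hω s.rep d, map_sum]
    exact Finset.sum_congr rfl fun q _ => (map_smul _ _ _).symm
  rw [h'] at h
  exact h

/-- In X ⊠ X, j₂(x) is σ(-d) ⊗ x. The last twist creates π(-d) on leg 3 and the middle twist then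
absorbs σ(-d), so what remains is 1 ⊗ j₂(x). -/
theorem implementer_mul_leg₂₄ (hω : IsPrimitiveRoot ω N) {d : ZMod N} {x : M →L[ℂ] M}
    (hx : IsHomogeneous ω s.rep d x) :
    implementer ω r s * (leg₂ L M (s.rep.op (-d)) * leg₄ L M x) =
      leg₃ L M (r.rep.op (-d)) * leg₄ L M x * implementer ω r s := by
  refine conj_second_leg (commute_leg₂_inr _ _).symm.eq ?_ (op_mul_middleTwist r s hω (-d))
    (commute_inl_leg₃ _ _).eq (commute_leg₂_leg₄ _ _).eq ?_ (commute_inl_leg₄ _ _).eq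
    (commute_leg₃₄ _ _).eq
  · rw [leg₄_apply, leg₃_apply, ← map_mul, twist_mul_inr hω r.rep hx, map_mul, map_mul]
  · exact (Commute.sum_left _ _ _ fun q _ =>
      Commute.mul_left (commute_leg₂_leg₄ _ _) (commute_leg₃₄ _ _)).eq

/-- Each z^k leaves σ(k) behind when it passes the twist on its own pair of legs. The two copies of
σ(k) form the diagonal action on M ⊗ M, the source of covariance for ψ. -/
theorem leg₁₃_mul_implementer (hω : IsPrimitiveRoot ω N) (k : ZMod N) :
    leg₁ L M (r.hom (character ω k)) * leg₃ L M (r.hom (character ω k)) * implementer ω r s =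
      implementer ω r s * (leg₁ L M (r.hom (character ω k)) * leg₃ L M (r.hom (character ω k)) *
        (leg₂ L M (s.rep.op k) * leg₄ L M (s.rep.op k))) := by
  have hχ := hom_character hω r k
  refine conj_both_legs ?_ (commute_inl_leg₃ _ _).symm.eq ?_ ?_ ?_ (commute_leg₁_inr _ _).eq ?_
    (commute_leg₂_inr _ _).eq (commute_leg₂₃ _ _).symm.eq
  · rw [leg₁_apply, leg₂_apply, ← map_mul, inl_mul_twist hω s.rep hχ, map_mul, opTensor_eq,
      map_mul]
  · exact (Commute.sum_right _ _ _ fun q _ =>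
      Commute.mul_right (commute_leg₁₂ _ _) (commute_leg₁₃ _ _)).eq
  · refine (Commute.sum_right _ _ _ fun q _ =>
      Commute.mul_right (commute_leg₂₃ _ _).symm ?_).eq
    rw [commute_iff_eq, ← (middle_family hω r).add, ← (middle_family hω r).add, add_comm]
  · refine (Commute.sum_right _ _ _ fun q _ =>
      Commute.mul_right ?_ (commute_leg₂₃ _ _)).eq
    exact (commute_spectralProj s.rep q k).symm.map (leg₂ L M)
  · rw [leg₃_apply, leg₄_apply, ← map_mul, inl_mul_twist hω s.rep hχ, map_mul, opTensor_eq,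
      map_mul]

/-- The homomorphism `T ↦ W (1 ⊗ T) W*` on operators on `M ⊗ M`. -/
def implementedHom (hω : IsPrimitiveRoot ω N) : (HTensor M M →L[ℂ] HTensor M M) →⋆ₐ[ℂ]
    (HTensor (HTensor L M) (HTensor L M) →L[ℂ] HTensor (HTensor L M) (HTensor L M)) :=
  conjHom (leg₂₄ L M) (implementer ω r s) (implementer_star_mul r s hω)
    (implementer_mul_star r s hω)

theorem implementedHom_eq (hω : IsPrimitiveRoot ω N) {T : HTensor M M →L[ℂ] HTensor M M}
    {b : HTensor (HTensor L M) (HTensor L M) →L[ℂ] HTensor (HTensor L M) (HTensor L M)}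
    (h : implementer ω r s * leg₂₄ L M T = b * implementer ω r s) :
    implementedHom r s hω T = b := by
  rw [implementedHom, conjHom_apply, h, mul_assoc, implementer_mul_star r s hω, mul_one]

theorem implementedHom_leftOp (hω : IsPrimitiveRoot ω N) {d : ZMod N} {x : M →L[ℂ] M}
    (hx : IsHomogeneous ω s.rep d x) :
    implementedHom r s hω (leftOp M x) =
      opTensor (rightOp ω r.rep s.rep x) (leftOp M (r.hom (character ω d))) := by
  refine implementedHom_eq r s hω ?_
  rw [leftOp, leg₂₄_opTensor, map_one, mul_one, implementer_mul_leg₂ r s hω hx,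
    rightOp_of_isHomogeneous hω r.rep hx, opTensor_eq, opTensor_eq, map_mul,
    ((commute_inl_inr _ _).map (inlHom (HTensor L M) (HTensor L M))).eq]
  rfl

theorem implementedHom_rightOp (hω : IsPrimitiveRoot ω N) {d : ZMod N} {x : M →L[ℂ] M}
    (hx : IsHomogeneous ω s.rep d x) :
    implementedHom r s hω (rightOp ω s.rep s.rep x) =
      opTensor 1 (rightOp ω r.rep s.rep x) := by
  refine implementedHom_eq r s hω ?_
  rw [rightOp_of_isHomogeneous hω s.rep hx, leg₂₄_opTensor, implementer_mul_leg₂₄ r s hω hx,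
    rightOp_of_isHomogeneous hω r.rep hx, opTensor_eq (r.rep.op (-d)), ← inrHom_apply, map_mul]
  rfl

/-- Acting on legs 1 and 3, z^k ⊗ z^k commutes with T on legs 2 and 4; only its passage through W
and W* contributes, by the diagonal action of k. -/
theorem implementedHom_covariant (hω : IsPrimitiveRoot ω N) (k : ZMod N)
    (T : HTensor M M →L[ℂ] HTensor M M) :
    implementedHom r s hω T *
        (leg₁ L M (r.hom (character ω k)) * leg₃ L M (r.hom (character ω k))) =
      leg₁ L M (r.hom (character ω k)) * leg₃ L M (r.hom (character ω k)) *
        implementedHom r s hω ((s.rep.tensor s.rep).op (-k) * T *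
          star ((s.rep.tensor s.rep).op (-k))) := by
  have hU := (s.rep.tensor s.rep).isUnitaryFamily
  have hs : ∀ k, leg₂ L M (s.rep.op k) * leg₄ L M (s.rep.op k) =
      leg₂₄ L M ((s.rep.tensor s.rep).op k) := fun k => (leg₂₄_opTensor _ _).symm
  rw [implementedHom, conjHom_apply, conjHom_apply, hU.star, neg_neg]
  have hW := leg₁₃_mul_implementer r s hω k
  rw [hs] at hW
  set W := implementer ω r s with hWdef
  set B := leg₁ L M (r.hom (character ω k)) * leg₃ L M (r.hom (character ω k)) with hB
  have hBc : ∀ c, B * leg₂₄ L M c = leg₂₄ L M c * B := fun c => (commute_leg₁₃_leg₂₄ _ _ c).eq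
  have h1 : W * star W = 1 := implementer_mul_star r s hω
  have h2 : star W * W = 1 := implementer_star_mul r s hω
  have hW' : star W * B = B * leg₂₄ L M ((s.rep.tensor s.rep).op k) * star W := by
    calc star W * B = star W * (B * W) * star W := by
          rw [mul_assoc, mul_assoc, h1, mul_one]
      _ = _ := by rw [hW, ← mul_assoc, h2, one_mul]
  calc W * leg₂₄ L M T * star W * B
      = W * leg₂₄ L M T * (star W * B) := by simp only [mul_assoc]
    _ = W * (leg₂₄ L M T * B) * leg₂₄ L M ((s.rep.tensor s.rep).op k) * star W := by
        rw [hW']; simp only [mul_assoc]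
    _ = W * B * leg₂₄ L M (T * (s.rep.tensor s.rep).op k) * star W := by
        rw [← hBc, map_mul]; simp only [mul_assoc]
    _ = W * (B * leg₂₄ L M ((s.rep.tensor s.rep).op k)) *
          leg₂₄ L M ((s.rep.tensor s.rep).op (-k) * T * (s.rep.tensor s.rep).op k) * star W := by
        have : T * (s.rep.tensor s.rep).op k = (s.rep.tensor s.rep).op k *
            ((s.rep.tensor s.rep).op (-k) * T * (s.rep.tensor s.rep).op k) := by
          rw [← mul_assoc, ← mul_assoc, hU.mul_neg, one_mul]
        rw [this, map_mul (leg₂₄ L M) ((s.rep.tensor s.rep).op k)]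
        simp only [mul_assoc]
    _ = _ := by rw [← hW]; simp only [mul_assoc]

end Implementation

/-! ### The map ψ and the comultiplication of the bosonization. -/

section BosonizationComult

variable {N : ℕ} [NeZero N] {ω : ℂ} {L M : Type*}
  [NormedAddCommGroup L] [InnerProductSpace ℂ L] [CompleteSpace L]
  [NormedAddCommGroup M] [InnerProductSpace ℂ M] [CompleteSpace M]

/-- The homomorphism `(j₁ ⊗ j₁) Δ_{ℤ/N}`. -/
def cyclicComult {X : Type*} [CStarAlgebra X] {ρ : CyclicCoaction N X} (ω : ℂ)
    (r : EquivariantRep (cyclicCoaction N) L) (s : EquivariantRep ρ M) :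
    (ZMod N → ℂ) →⋆ₐ[ℂ] spatialTensor (boxTensor ω r s) (boxTensor ω r s) :=
  (deltaSum (cyclicCoaction N).hom ((inlHom L M).comp r.hom)
    ((inlHom L M).comp r.hom)).codRestrict _
      fun x => deltaSum_mem _ _ _ (fun f => (j₁ ω r s f).2) (fun f => (j₁ ω r s f).2) x

theorem cyclicComult_coe {X : Type*} [CStarAlgebra X] {ρ : CyclicCoaction N X}
    (r : EquivariantRep (cyclicCoaction N) L) (s : EquivariantRep ρ M) (f : ZMod N → ℂ) :
    (cyclicComult ω r s f).1 = deltaSum (cyclicCoaction N).hom ((inlHom L M).comp r.hom)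
      ((inlHom L M).comp r.hom) f := rfl

theorem deltaSum_character (hω : IsPrimitiveRoot ω N) (r : EquivariantRep (cyclicCoaction N) L)
    (k : ZMod N) :
    deltaSum (cyclicCoaction N).hom ((inlHom L M).comp r.hom) ((inlHom L M).comp r.hom)
      (character ω k) =
      opTensor (inlHom L M (r.hom (character ω k))) (inlHom L M (r.hom (character ω k))) := by
  refine deltaSum_of_homogeneous _ _ _ fun t => ?_
  funext q
  change rootPow ω (k * (q + t)) = rootPow ω (t * k) * rootPow ω (k * q)
  rw [← rootPow_add hω]
  congr 1
  ring

variable (r : EquivariantRep (cyclicCoaction N) L)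

/-- The homomorphism `(j₂ ⊗ j₁) ρ`. -/
def coactionTensor (hω : IsPrimitiveRoot ω N) (s : EquivariantRep (freeUnitaryCoaction hω) M) :
    FreeUnitary N ω →⋆ₐ[ℂ]
      (HTensor (HTensor L M) (HTensor L M) →L[ℂ] HTensor (HTensor L M) (HTensor L M)) :=
  deltaSum (freeUnitaryCoaction hω).hom ((rightHom hω r.rep s.rep).comp s.hom)
    ((inlHom L M).comp r.hom)

theorem coactionTensor_u (hω : IsPrimitiveRoot ω N)
    (s : EquivariantRep (freeUnitaryCoaction hω) M) (i j : ZMod N) :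
    coactionTensor r hω s (FreeUnitary.u N ω i j) =
      opTensor (rightHom hω r.rep s.rep (s.hom (FreeUnitary.u N ω i j)))
        (inlHom L M (r.hom (character ω (j - i)))) :=
  deltaSum_of_homogeneous _ _ _ fun t => freeUnitaryCoaction_u hω i j t

/-- Both sides are homomorphisms in x, so the formula for homogeneous elements need only be applied
to the u_ij. -/
theorem implementedHom_squareLeft (hω : IsPrimitiveRoot ω N)
    (s : EquivariantRep (freeUnitaryCoaction hω) M) (x : FreeUnitary N ω) :
    implementedHom r s hω (leftOp M (s.hom x)) = coactionTensor r hω s x := by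
  have key : (implementedHom r s hω).comp ((inlHom M M).comp s.hom) = coactionTensor r hω s := by
    refine FreeUnitary.hom_ext ω fun i j => ?_
    rw [coactionTensor_u, rightHom_apply]
    exact implementedHom_leftOp r s hω (hom_u_isHomogeneous hω s i j)
  exact DFunLike.congr_fun key x

theorem implementedHom_squareRight (hω : IsPrimitiveRoot ω N)
    (s : EquivariantRep (freeUnitaryCoaction hω) M) (x : FreeUnitary N ω) :
    implementedHom r s hω (rightOp ω s.rep s.rep (s.hom x)) =
      opTensor 1 (rightOp ω r.rep s.rep (s.hom x)) := by
  have key : (implementedHom r s hω).comp ((rightHom hω s.rep s.rep).comp s.hom) =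
      (inrHom (HTensor L M) (HTensor L M)).comp ((rightHom hω r.rep s.rep).comp s.hom) := by
    refine FreeUnitary.hom_ext ω fun i j => ?_
    rw [StarAlgHom.comp_apply, StarAlgHom.comp_apply, StarAlgHom.comp_apply,
      StarAlgHom.comp_apply, rightHom_apply, rightHom_apply, inrHom_apply]
    exact implementedHom_rightOp r s hω (hom_u_isHomogeneous hω s i j)
  have h := DFunLike.congr_fun key x
  rwa [StarAlgHom.comp_apply, StarAlgHom.comp_apply, StarAlgHom.comp_apply,
    StarAlgHom.comp_apply, rightHom_apply, rightHom_apply, inrHom_apply] at h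

/-- The generators of X ⊠ X go to (j₂ ⊗ j₁)ρ(x) and 1 ⊗ j₂(x), and the spatial tensor product is
closed. -/
theorem implementedHom_mem (hω : IsPrimitiveRoot ω N)
    (s : EquivariantRep (freeUnitaryCoaction hω) M) :
    ∀ a ∈ boxTensor ω s s,
      implementedHom r s hω a ∈ spatialTensor (boxTensor ω r s) (boxTensor ω r s) := by
  have hright : ∀ x, rightOp ω r.rep s.rep (s.hom x) ∈ boxTensor ω r s := fun x => (j₂ ω r s x).2
  refine braidedTensor_map_mem _ (StarSubalgebra.isClosed_topologicalClosure _)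
    (implementedHom r s hω) ?_ ?_
  · rintro _ ⟨x, rfl⟩
    have h := implementedHom_squareLeft r hω s x
    have hm : coactionTensor r hω s x ∈ spatialTensor (boxTensor ω r s) (boxTensor ω r s) :=
      deltaSum_mem _ _ _ (fun y => by
        rw [StarAlgHom.comp_apply, rightHom_apply]; exact hright y)
        (fun f => (j₁ ω r s f).2) x
    rw [← h] at hm
    exact hm
  · rintro _ ⟨x, rfl⟩
    have h := implementedHom_squareRight r hω s x
    have hm : opTensor 1 (rightOp ω r.rep s.rep (s.hom x)) ∈
        spatialTensor (boxTensor ω r s) (boxTensor ω r s) :=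
      StarSubalgebra.le_topologicalClosure _
        (StarAlgebra.subset_adjoin ℂ _ ⟨_, one_mem _, _, hright x, rfl⟩)
    rw [← h] at hm
    exact hm

/-- The restriction of `ψ` to the braided square of `FreeUnitary`. -/
def squareComult (hω : IsPrimitiveRoot ω N) (s : EquivariantRep (freeUnitaryCoaction hω) M) :
    boxTensor ω s s →⋆ₐ[ℂ] spatialTensor (boxTensor ω r s) (boxTensor ω r s) :=
  ((implementedHom r s hω).comp (boxTensor ω s s).subtype).codRestrict _
    fun a => implementedHom_mem r hω s a.1 a.2

theorem squareComult_isCovariant (hω : IsPrimitiveRoot ω N)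
    (s : EquivariantRep (freeUnitaryCoaction hω) M) :
    IsCovariant (diagonalAction hω s s) (squareComult r hω s)
      fun k => cyclicComult ω r s (character ω k) where
  family := (character_isUnitaryFamily hω).map _
  comm k x := by
    refine Subtype.ext ?_
    change implementedHom r s hω x.1 * (cyclicComult ω r s (character ω k)).1 =
      (cyclicComult ω r s (character ω k)).1 * implementedHom r s hω
        ((s.rep.tensor s.rep).op (-k) * x.1 * star ((s.rep.tensor s.rep).op (-k)))
    rw [cyclicComult_coe, deltaSum_character hω, opTensor_eq, ← leg₁_apply, ← leg₃_apply]
    exact implementedHom_covariant r s hω k x.1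

/-- The homomorphism `ψ`. -/
def tripleComult (hω : IsPrimitiveRoot ω N) (s : EquivariantRep (freeUnitaryCoaction hω) M) :
    tripleTensor ω r s →⋆ₐ[ℂ] spatialTensor (boxTensor ω r s) (boxTensor ω r s) :=
  crossedLift (tripleEmbed_isCovariant hω r s) (tripleEmbed_bijective hω r s)
    (squareComult_isCovariant r hω s)

theorem tripleComult_tripleLeft (hω : IsPrimitiveRoot ω N)
    (s : EquivariantRep (freeUnitaryCoaction hω) M) (f : ZMod N → ℂ) :
    tripleComult r hω s (tripleLeft ω r s f) = cyclicComult ω r s f := by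
  obtain ⟨a, rfl⟩ := character_fourier hω f
  simp only [map_sum, map_smul]
  refine Finset.sum_congr rfl fun k _ => congrArg _ ?_
  exact crossedLift_family _ _ _ k

theorem tripleComult_tripleEmbed (hω : IsPrimitiveRoot ω N)
    (s : EquivariantRep (freeUnitaryCoaction hω) M) (x : boxTensor ω s s) :
    (tripleComult r hω s (braidedTensor.right x)).1 = implementedHom r s hω x.1 := by
  rw [← tripleEmbed_apply hω r s]
  exact congrArg Subtype.val (crossedLift_hom _ _ _ x)

theorem isBosonizationComult (hω : IsPrimitiveRoot ω N)
    (s : EquivariantRep (freeUnitaryCoaction hω) M) :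
    IsBosonizationComult ω r s (freeUnitaryComult hω s)
      ((tripleComult r hω s).comp (idBoxComult hω r s)) := by
  refine ⟨idBoxComult hω r s, tripleComult r hω s, idBoxComult_apply hω r s, fun f => ?_,
    fun x => ?_, fun x => ?_, rfl⟩
  · exact congrArg Subtype.val (tripleComult_tripleLeft r hω s f)
  · rw [tripleComult_tripleEmbed]
    refine (implementedHom_squareLeft r hω s x).trans ?_
    rw [coactionTensor, deltaSum_apply]
    refine Finset.sum_congr rfl fun t _ => ?_
    rw [StarAlgHom.comp_apply, rightHom_apply]
    rfl
  · rw [tripleComult_tripleEmbed]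
    exact implementedHom_squareRight r hω s x

theorem IsBosonizationComult.apply_z (hω : IsPrimitiveRoot ω N)
    {s : EquivariantRep (freeUnitaryCoaction hω) M}
    {Δ : FreeUnitary N ω →⋆ₐ[ℂ] boxTensor ω s s}
    {Δ_B : boxTensor ω r s →⋆ₐ[ℂ] spatialTensor (boxTensor ω r s) (boxTensor ω r s)}
    (h : IsBosonizationComult ω r s Δ Δ_B) :
    (Δ_B (boxCharacter ω r s 1)).1 =
      opTensor (boxCharacter ω r s 1).1 (boxCharacter ω r s 1).1 := by
  obtain ⟨Φ, Ψ, hΦ, hΨ, -, -, rfl⟩ := h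
  -- The condition on Φ speaks of products j₁(f) j₂(x), so z is written with x = 1.
  have h1 : boxCharacter ω r s 1 = j₁ ω r s (character ω 1) * j₂ ω r s 1 := by
    rw [← boxEmbed_apply hω, map_one, mul_one]
    rfl
  rw [StarAlgHom.comp_apply]
  conv_lhs => rw [h1]
  rw [hΦ, map_one, ← tripleEmbed_apply hω r s, map_one, mul_one, hΨ]
  exact deltaSum_character hω r 1

theorem IsBosonizationComult.apply_u (hω : IsPrimitiveRoot ω N)
    {s : EquivariantRep (freeUnitaryCoaction hω) M}
    {Δ : FreeUnitary N ω →⋆ₐ[ℂ] boxTensor ω s s} (hΔ : IsFreeUnitaryComult hω s Δ)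
    {Δ_B : boxTensor ω r s →⋆ₐ[ℂ] spatialTensor (boxTensor ω r s) (boxTensor ω r s)}
    (h : IsBosonizationComult ω r s Δ Δ_B) (i j : ZMod N) :
    (Δ_B (boxEmbed hω r s (FreeUnitary.u N ω i j))).1 =
      ∑ k, opTensor (boxEmbed hω r s (FreeUnitary.u N ω i k)).1
        (boxCharacter ω r s 1 ^ (k - i).val * boxEmbed hω r s (FreeUnitary.u N ω k j)).1 := by
  obtain ⟨Φ, Ψ, hΦ, -, hΨ₂, hΨ₃, rfl⟩ := h
  have h1 : boxEmbed hω r s (FreeUnitary.u N ω i j) =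
      j₁ ω r s 1 * j₂ ω r s (FreeUnitary.u N ω i j) := by
    have : j₁ ω r s (1 : ZMod N → ℂ) = 1 := map_one (boxLeft ω r.rep s.rep r.hom s.hom.range)
    rw [this, one_mul, boxEmbed_apply]
  have h2 : braidedTensor.left (r.hom.rangeRestrict (1 : ZMod N → ℂ)) =
      (1 : tripleTensor ω r s) := map_one (tripleLeft ω r s)
  rw [StarAlgHom.comp_apply, h1, hΦ, h2, one_mul, hΔ.1, ← tripleEmbed_apply hω r s, map_sum,
    map_sum]
  refine (map_sum (spatialTensor (boxTensor ω r s) (boxTensor ω r s)).subtype _ _).trans ?_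
  refine Finset.sum_congr rfl fun k _ => ?_
  rw [map_mul, map_mul, tripleEmbed_apply, tripleEmbed_apply]
  refine (congrArg₂ (· * ·) (hΨ₂ _) (hΨ₃ _)).trans ?_
  -- Since u_ik has degree k - i, its coaction collapses to u_ik ⊗ z^(k-i), the origin of the power
  -- of z in the formula.
  have h3 : ∑ t, opTensor (j₂ ω r s ((freeUnitaryCoaction hω).hom (FreeUnitary.u N ω i k) t)).1
      (j₁ ω r s (Pi.single t 1)).1 = opTensor (boxEmbed hω r s (FreeUnitary.u N ω i k)).1
        (boxCharacter ω r s (k - i)).1 := by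
    refine Eq.trans ?_ (coactionTensor_u r hω s i k)
    rw [coactionTensor, deltaSum_apply]
    refine Finset.sum_congr rfl fun t _ => ?_
    rw [StarAlgHom.comp_apply, rightHom_apply]
    rfl
  rw [h3, ← (boxEmbed_isCovariant hω r s).family.eq_pow (k - i)]
  refine (opTensor_mul _ _ _ _).trans ?_
  rw [mul_one, ← boxEmbed_apply hω]
  rfl

theorem IsBosonizationComult.eq (hω : IsPrimitiveRoot ω N)
    {s : EquivariantRep (freeUnitaryCoaction hω) M}
    {Δ : FreeUnitary N ω →⋆ₐ[ℂ] boxTensor ω s s} (hΔ : IsFreeUnitaryComult hω s Δ)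
    {Δ_B Δ_B' : boxTensor ω r s →⋆ₐ[ℂ] spatialTensor (boxTensor ω r s) (boxTensor ω r s)}
    (h : IsBosonizationComult ω r s Δ Δ_B) (h' : IsBosonizationComult ω r s Δ Δ_B') :
    Δ_B' = Δ_B := by
  -- The comparison takes place in the C*-algebra of all operators; both maps have the forced values
  -- on z and u_ij.
  have key : (spatialTensor (boxTensor ω r s) (boxTensor ω r s)).subtype.comp Δ_B' =
      (spatialTensor (boxTensor ω r s) (boxTensor ω r s)).subtype.comp Δ_B :=
    hom_ext_bosonization hω r s ((h'.apply_z r hω).trans (h.apply_z r hω).symm) fun i j =>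
      (h'.apply_u r hω hΔ i j).trans (h.apply_u r hω hΔ i j).symm
  ext1 x
  exact Subtype.ext (DFunLike.congr_fun key x)

end BosonizationComult

end Anyonic

end

theorem theorem3 (N : ℕ) [NeZero N] (ω : ℂ) (hω : IsPrimitiveRoot ω N)
    {L : Type u} [NormedAddCommGroup L] [InnerProductSpace ℂ L] [CompleteSpace L]
    (r : EquivariantRep (cyclicCoaction N) L)
    {M : Type v} [NormedAddCommGroup M] [InnerProductSpace ℂ M] [CompleteSpace M]
    (s : EquivariantRep (freeUnitaryCoaction hω) M) :
    let z : boxTensor ω r s := j₁ ω r s (zFun N ω)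
    let u : Matrix (ZMod N) (ZMod N) (boxTensor ω r s) :=
      Matrix.of fun i j => j₂ ω r s (FreeUnitary.u N ω i j)
    IsUniversalBosonization.{max u v, w} ω z u ∧
    ∃ (Δ : FreeUnitary N ω →⋆ₐ[ℂ] boxTensor ω s s)
      (Δ_B : boxTensor ω r s →⋆ₐ[ℂ] spatialTensor (boxTensor ω r s) (boxTensor ω r s)),
      IsFreeUnitaryComult hω s Δ ∧ (∀ Δ', IsFreeUnitaryComult hω s Δ' → Δ' = Δ) ∧
      IsBosonizationComult ω r s Δ Δ_B ∧
      (∀ Δ_B', IsBosonizationComult ω r s Δ Δ_B' → Δ_B' = Δ_B) ∧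
      (Δ_B z).1 = opTensor z.1 z.1 ∧
      ∀ i j, (Δ_B (u i j)).1 =
        ∑ k : ZMod N, opTensor (u i k).1 (z ^ (k - i).val * u k j).1 := by
  intro z u
  have hz : z = boxCharacter ω r s 1 := by
    change j₁ ω r s (zFun N ω) = j₁ ω r s (character ω 1)
    rw [character_one]
  have hu : u = (FreeUnitary.u N ω).map (boxEmbed hω r s) := by
    ext1 i j
    exact (boxEmbed_apply hω r s _).symm
  have hΔ := freeUnitaryComult_isFreeUnitaryComult hω s
  have hB := isBosonizationComult r hω s
  rw [hz, hu]
  exact ⟨isUniversalBosonization hω r s, freeUnitaryComult hω s, _, hΔ,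
    fun Δ' h' => hΔ.eq hω s h', hB, fun Δ_B' h' => hB.eq r hω hΔ h', hB.apply_z r hω,
    hB.apply_u r hω hΔ⟩
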